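/- Let $a,b,c_1,c_2\in\mathbb C$, $\alpha=e^{2\pi i a}$, $\beta=e^{2\pi i b}$, $\gamma_j=e^{2\pi i c_j}$. Appell's series is $$F_4(a,b,c_1,c_2;x)=\sum_{n_1,n_2\ge 0}\frac{(a)_{n_1+n_2}(b)_{n_1+n_2}}{(c_1)_{n_1}(c_2)_{n_2}\,n_1!\,n_2!}x_1^{n_1}x_2^{n_2},\qquad x\in\mathbb D=\{\sqrt{|x_1|}+\sqrt{|x_2|}<1\},$$ and, with $L=1-t_1-t_2$ and $M=1-\frac{x_1}{t_1}-\frac{x_2}{t_2}$, put $$f_i(x)=\int_{\Delta_i}t_1^{-c_1}t_2^{-c_2}L^{c_1+c_2-a-2}M^{-b}\,dt_1\wedge dt_2\qquad(i=1,2,3,4).$$ Let $U\subset\mathbb D\cap\{x_1x_2\neq0\}$ be a connected open set (for instance a simply connected one) containing a point $x^0$ with positive real coordinates, such that $\log x_1,\log x_2$ have continuous branches on $U$ that are real at $x^0$; the powers $x_j^{1-c_j}$ on $U$ are taken with these branches. *The cycle $\Delta_1$.* Given $x$, take any $\varepsilon_1,\varepsilon_2,\varepsilon_3>0$ with $\varepsilon_1+\varepsilon_2+\varepsilon_3<1$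 and $|x_1|/\varepsilon_1+|x_2|/\varepsilon_2<1$. Let $\triangle=\{t\in\mathbb R^2: t_1\ge\varepsilon_1,\ t_2\ge\varepsilon_2,\ L\ge\varepsilon_3\}$ with the standard orientation and boundary sides $I_1\,(t_1=\varepsilon_1)$, $I_2\,(t_2=\varepsilon_2)$, $I_3\,(L=\varepsilon_3)$, and let $\circlearrowleft_1,\circlearrowleft_2,\circlearrowleft_3$ be the positive circles $t_1=\varepsilon_1e^{i\theta}$, $t_2=\varepsilon_2e^{i\theta}$, $L=\varepsilon_3e^{i\theta}$, $0\le\theta\le2\pi$. For $m_1,m_2,m_3\neq1$ put $$\triangle^{\rm reg}_{m}=\triangle+\sum_{j=1}^3\frac{\circlearrowleft_j\times I_j}{1-m_j}+\frac{\circlearrowleft_1\times\circlearrowleft_2}{(1-m_1)(1-m_2)}+\frac{\circlearrowleft_2\times\circlearrowleft_3}{(1-m_2)(1-m_3)}+\frac{\circlearrowleft_3\times\circlearrowleft_1}{(1-m_3)(1-m_1)}.$$ Here $\circlearrowleft_j\times I_j$ is the tube on which the $j$-th of the functions $t_1,t_2,L$ runs through its circle and the other two, whose sum is then prescribed, run affinely,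 in the direction of the boundary orientation of $I_j$, from the point where the preceding one (in the cyclic order $t_1,t_2,L$) is equal to its $\varepsilon$ to the point where the following one is; $\circlearrowleft_j\times\circlearrowleft_k$ is the torus on which the $j$-th and $k$-th functions run through their circles. The argument of $M$ lies in $(-\frac\pi2,\frac\pi2)$; the arguments of $t_1,t_2,L$ are $0$ on $\triangle$ and at the starting points $\theta=0$ of the circles, and are continued continuously (a function that is not running through a circle has positive real part and argument in $(-\frac\pi2,\frac\pi2)$). Then $\Delta_1=\triangle^{\rm reg}_m$ with $m=(\gamma_1^{-1},\gamma_2^{-1},\gamma_1\gamma_2\alpha^{-1})$, the factors by which the integrand is multiplied along the circles. *The cycle $\Delta_4$* is the image under $(t_1,t_2)\mapsto(x_1/t_1,x_2/t_2)$, which exchanges $L$ and $M$, of $\triangle^{\rm reg}_m$ with $m=(\gamma_1,\gamma_2,\beta^{-1})$, the factors by which the integrand is multiplied along the images of the circles; $\log(x_j/t_j)=\log x_j-\log t_j$. *The chambers $\Delta_2,\Delta_3$.* For real $x_1,x_2>0$ with $\sqrt{x_1}+\sqrt{x_2}<1$, the region $\{t\in\mathbb R^2: t_1,t_2>0,\ L<0,\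 M<0\}$ has two connected components; $\Delta_2$ is the one on which $t_1$ is bounded (the part with $\sqrt{x_2}\,t_1<\sqrt{x_1}\,t_2$), $\Delta_3$ the one on which $t_2$ is bounded (the part with $\sqrt{x_1}\,t_2<\sqrt{x_2}\,t_1$). Both have the standard orientation, and $\arg t_1=\arg t_2=0$, $\arg L=\arg M=-\pi$. On $U$, $f_2$ and $f_3$ denote the holomorphic continuations to $U$ of these integrals from the real points near $x^0$. Then the following hold, where $1/\Gamma=0$ at the poles of $\Gamma$. 1. If $c_1,c_2,a-c_1-c_2\notin\mathbb Z$, then for all $x\in U$ and all $\varepsilon$ as above the integral $f_1(x)$ converges and $$f_1(x)=\frac{\Gamma(1-c_1)\Gamma(1-c_2)\Gamma(c_1+c_2-a-1)}{\Gamma(1-a)}F_4(a,b,c_1,c_2;x).$$ 2. If $\operatorname{Re}(b-c_1+1),\operatorname{Re}(c_1+c_2-a-1),\operatorname{Re}(1-b),\operatorname{Re}(a-c_1+1)>0$, then for all real $x_1,x_2>0$ with $\sqrt{x_1}+\sqrt{x_2}<1$ the integral $f_2(x)$ converges absolutely, and (with $x_1^{1-c_1}$ taken with real $\log x_1$) $$f_2(x)=\frac{\Gamma(a+1-c_1)\Gamma(b+1-c_1)\Gamma(1-b)\Gamma(c_1+c_2-a-1)}{\Gamma(2-c_1)\Gamma(c_2)}e^{-\pi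 i(c_1+c_2-a-b)}x_1^{1-c_1}F_4(a+1-c_1,b+1-c_1,2-c_1,c_2;x);$$ moreover $f_2$ has a holomorphic continuation to $U$, and every such continuation is given by this formula for all $x\in U$. 3. If $\operatorname{Re}(b-c_2+1),\operatorname{Re}(c_1+c_2-a-1),\operatorname{Re}(1-b),\operatorname{Re}(a-c_2+1)>0$, then the same holds for $f_3$ with $$f_3(x)=\frac{\Gamma(a+1-c_2)\Gamma(b+1-c_2)\Gamma(1-b)\Gamma(c_1+c_2-a-1)}{\Gamma(c_1)\Gamma(2-c_2)}e^{-\pi i(c_1+c_2-a-b)}x_2^{1-c_2}F_4(a+1-c_2,b+1-c_2,c_1,2-c_2;x).$$ 4. If $c_1,c_2,b\notin\mathbb Z$, then for all $x\in U$ and all $\varepsilon$ as above the integral $f_4(x)$ converges and $$f_4(x)=\frac{\Gamma(c_1-1)\Gamma(c_2-1)\Gamma(1-b)}{\Gamma(c_1+c_2-b-1)}x_1^{1-c_1}x_2^{1-c_2}F_4(a+2-c_1-c_2,b+2-c_1-c_2,2-c_1,2-c_2;x).$$ -/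

import Mathlib

open Complex MeasureTheory Filter Topology

noncomputable section

namespace AppellF4

/-- The Pochhammer symbol `(z, n) = z (z + 1) ⋯ (z + n - 1)`. -/
def poch (z : ℂ) (n : ℕ) : ℂ := (ascPochhammer ℂ n).eval z

/-- Appell's series `F₄(a, b, c₁, c₂; x)`. -/
def F4 (a b c₁ c₂ : ℂ) (x : ℂ × ℂ) : ℂ :=
  ∑' n : ℕ × ℕ,
    poch a (n.1 + n.2) * poch b (n.1 + n.2) /
      (poch c₁ n.1 * poch c₂ n.2 * poch 1 n.1 * poch 1 n.2) * x.1 ^ n.1 * x.2 ^ n.2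

/-- The domain `√|x₁| + √|x₂| < 1` of convergence of `F₄`. -/
def convDomain : Set (ℂ × ℂ) := {x | Real.sqrt ‖x.1‖ + Real.sqrt ‖x.2‖ < 1}

/-- A parametrized piece of an oriented real surface in `t`-space, loaded with a branch of
the integrand: the piece is `p ↦ (t₁ p, t₂ p)` for `p` in the plane region `dom` (oriented by the
standard orientation of the plane), and the branch is given by the logarithms
of the factors `t₁`, `t₂`, `L = 1 - t₁ - t₂` and `M = 1 - x₁ / t₁ - x₂ / t₂` along it. -/
structure LoadedCell where
  dom : Set (ℝ × ℝ)
  t₁ : ℝ × ℝ → ℂ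
  t₂ : ℝ × ℝ → ℂ
  logt₁ : ℝ × ℝ → ℂ
  logt₂ : ℝ × ℝ → ℂ
  logL : ℝ × ℝ → ℂ
  logM : ℝ × ℝ → ℂ

/-- The Jacobian `∂(t₁, t₂) / ∂(p₁, p₂)`, i.e. the coefficient of the pull-back of
`dt₁ ∧ dt₂` with respect to `dp₁ ∧ dp₂`. -/
def LoadedCell.jac (σ : LoadedCell) (p : ℝ × ℝ) : ℂ :=
  deriv (fun s : ℝ => σ.t₁ (s, p.2)) p.1 * deriv (fun s : ℝ => σ.t₂ (p.1, s)) p.2 -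
    deriv (fun s : ℝ => σ.t₁ (p.1, s)) p.2 * deriv (fun s : ℝ => σ.t₂ (s, p.2)) p.1

/-- The pull-back of `t₁^{-c₁} t₂^{-c₂} L^{c₁+c₂-a-2} M^{-b} dt₁ ∧ dt₂` to the parameter
region of a loaded cell. -/
def LoadedCell.pullback (a b c₁ c₂ : ℂ) (σ : LoadedCell) (p : ℝ × ℝ) : ℂ :=
  exp (-c₁ * σ.logt₁ p - c₂ * σ.logt₂ p + (c₁ + c₂ - a - 2) * σ.logL p - b * σ.logM p) *
    σ.jac p

/-- A twisted chain: a finite formal linear combination of loaded cells. -/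
abbrev TwistedChain := List (ℂ × LoadedCell)

/-- The integral over every cell of the chain converges absolutely. -/
def TwistedChain.Converges (a b c₁ c₂ : ℂ) (Δ : TwistedChain) : Prop :=
  ∀ q ∈ Δ, IntegrableOn (q.2.pullback a b c₁ c₂) q.2.dom

/-- The integral of `t₁^{-c₁} t₂^{-c₂} L^{c₁+c₂-a-2} M^{-b} dt₁ ∧ dt₂` over a twisted chain. -/
def TwistedChain.integral (a b c₁ c₂ : ℂ) (Δ : TwistedChain) : ℂ :=
  (Δ.map fun q => q.1 * ∫ p in q.2.dom, q.2.pullback a b c₁ c₂ p).sum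

/-! ### The cycles `Δ₁` and `Δ₄` -/

/-- Admissible distances of the sides of the triangle `△` to the lines
`t₁ = 0`, `t₂ = 0`, `1 - t₁ - t₂ = 0`. Such a triple exists exactly when
`√|x₁| + √|x₂| < 1`. The last condition makes the circle around `t₁ = 0` (resp. `t₂ = 0`)
enclose also the curve `t₁ t₂ - t₁ x₂ - t₂ x₁ = 0`. -/
structure Admissible (ε₁ ε₂ ε₃ : ℝ) (x : ℂ × ℂ) : Prop where
  pos₁ : 0 < ε₁
  pos₂ : 0 < ε₂
  pos₃ : 0 < ε₃
  sum_lt : ε₁ + ε₂ + ε₃ < 1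
  enclose : ‖x.1‖ / ε₁ + ‖x.2‖ / ε₂ < 1

/-- The cell with given parameter region, points and logarithms of `t₁`, `t₂`, `L`; the
logarithm of `M = 1 - x₁ / t₁ - x₂ / t₂` is the principal one (on all the cells built from
this, `|x₁ / t₁| + |x₂ / t₂| < 1`). -/
def cellM (x : ℂ × ℂ) (dom : Set (ℝ × ℝ)) (t₁ t₂ logt₁ logt₂ logL : ℝ × ℝ → ℂ) :
    LoadedCell where
  dom := dom
  t₁ := t₁
  t₂ := t₂
  logt₁ := logt₁
  logt₂ := logt₂
  logL := logL
  logM := fun p => log (1 - x.1 / t₁ p - x.2 / t₂ p)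

/-- `ε e^{iθ}`, the point of the positively oriented circle of radius `ε` about `0`. -/
def circ (ε θ : ℝ) : ℂ := ε * exp (θ * I)

/-- The logarithm of `ε e^{iθ}` continued along the circle from the real value at `θ = 0`. -/
def logCirc (ε θ : ℝ) : ℂ := Real.log ε + θ * I

/-- The segment from `z` to `w`, parametrized by `[0, 1]`. -/
def seg (z w : ℂ) (τ : ℝ) : ℂ := (1 - τ) * z + τ * w

/-- Parameter region of a circle times a side. -/
def tubeDom : Set (ℝ × ℝ) := Set.Icc 0 (2 * Real.pi) ×ˢ Set.Icc 0 1

/-- Parameter region of a circle times a circle. -/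
def torusDom : Set (ℝ × ℝ) := Set.Icc 0 (2 * Real.pi) ×ˢ Set.Icc 0 (2 * Real.pi)

/-- The real triangle `△`: `t₁ ≥ ε₁`, `t₂ ≥ ε₂`, `1 - t₁ - t₂ ≥ ε₃`, with arguments `0` (for
real positive `x`). Its sides, oriented as the boundary of `△`, are
`I₁` (on `t₁ = ε₁`, downwards), `I₂` (on `t₂ = ε₂`, to the right) and
`I₃` (on `1 - t₁ - t₂ = ε₃`, upwards to the left). -/
def triangle (ε₁ ε₂ ε₃ : ℝ) (x : ℂ × ℂ) : LoadedCell :=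
  cellM x {p | ε₁ ≤ p.1 ∧ ε₂ ≤ p.2 ∧ ε₃ ≤ 1 - p.1 - p.2}
    (fun p => (p.1 : ℂ)) (fun p => (p.2 : ℂ))
    (fun p => (Real.log p.1 : ℂ)) (fun p => (Real.log p.2 : ℂ))
    (fun p => (Real.log (1 - p.1 - p.2) : ℂ))

/-- The tube `↺₁ × I₁`: `t₁ = ε₁ e^{iθ}`, and `t₂` runs from the point with `L = ε₃` to `ε₂`. -/
def tube₁ (ε₁ ε₂ ε₃ : ℝ) (x : ℂ × ℂ) : LoadedCell :=
  let t₁ : ℝ × ℝ → ℂ := fun p => circ ε₁ p.1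
  let t₂ : ℝ × ℝ → ℂ := fun p => seg (1 - ε₃ - circ ε₁ p.1) ε₂ p.2
  cellM x tubeDom t₁ t₂
    (fun p => logCirc ε₁ p.1) (fun p => log (t₂ p)) (fun p => log (1 - t₁ p - t₂ p))

/-- The tube `↺₂ × I₂`: `t₂ = ε₂ e^{iθ}`, and `t₁` runs from `ε₁` to the point with `L = ε₃`. -/
def tube₂ (ε₁ ε₂ ε₃ : ℝ) (x : ℂ × ℂ) : LoadedCell :=
  let t₁ : ℝ × ℝ → ℂ := fun p => seg ε₁ (1 - ε₃ - circ ε₂ p.1) p.2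
  let t₂ : ℝ × ℝ → ℂ := fun p => circ ε₂ p.1
  cellM x tubeDom t₁ t₂
    (fun p => log (t₁ p)) (fun p => logCirc ε₂ p.1) (fun p => log (1 - t₁ p - t₂ p))

/-- The tube `↺₃ × I₃`: `L = ε₃ e^{iθ}`, and `t₁` runs from the point with `t₂ = ε₂` to `ε₁`. -/
def tube₃ (ε₁ ε₂ ε₃ : ℝ) (x : ℂ × ℂ) : LoadedCell :=
  let t₁ : ℝ × ℝ → ℂ := fun p => seg (1 - ε₂ - circ ε₃ p.1) ε₁ p.2
  let t₂ : ℝ × ℝ → ℂ := fun p => 1 - circ ε₃ p.1 - t₁ p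
  cellM x tubeDom t₁ t₂
    (fun p => log (t₁ p)) (fun p => log (t₂ p)) (fun p => logCirc ε₃ p.1)

/-- The torus `↺₁ × ↺₂`: `t₁ = ε₁ e^{iθ}`, `t₂ = ε₂ e^{iφ}`. -/
def torus₁₂ (ε₁ ε₂ : ℝ) (x : ℂ × ℂ) : LoadedCell :=
  cellM x torusDom (fun p => circ ε₁ p.1) (fun p => circ ε₂ p.2)
    (fun p => logCirc ε₁ p.1) (fun p => logCirc ε₂ p.2)
    (fun p => log (1 - circ ε₁ p.1 - circ ε₂ p.2))

/-- The torus `↺₂ × ↺₃`: `t₂ = ε₂ e^{iθ}`, `L = ε₃ e^{iφ}`. -/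
def torus₂₃ (ε₂ ε₃ : ℝ) (x : ℂ × ℂ) : LoadedCell :=
  let t₁ : ℝ × ℝ → ℂ := fun p => 1 - circ ε₂ p.1 - circ ε₃ p.2
  cellM x torusDom t₁ (fun p => circ ε₂ p.1)
    (fun p => log (t₁ p)) (fun p => logCirc ε₂ p.1) (fun p => logCirc ε₃ p.2)

/-- The torus `↺₃ × ↺₁`: `L = ε₃ e^{iθ}`, `t₁ = ε₁ e^{iφ}`. -/
def torus₃₁ (ε₁ ε₃ : ℝ) (x : ℂ × ℂ) : LoadedCell :=
  let t₂ : ℝ × ℝ → ℂ := fun p => 1 - circ ε₃ p.1 - circ ε₁ p.2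
  cellM x torusDom (fun p => circ ε₁ p.2) t₂
    (fun p => logCirc ε₁ p.2) (fun p => log (t₂ p)) (fun p => logCirc ε₃ p.1)

/-- The regularized triangle, for a branch which is multiplied by `m₁`, `m₂`, `m₃` along
the circles around `t₁ = 0`, `t₂ = 0`, `L = 0`. -/
def regTriangle (m₁ m₂ m₃ : ℂ) (ε₁ ε₂ ε₃ : ℝ) (x : ℂ × ℂ) : TwistedChain :=
  [(1, triangle ε₁ ε₂ ε₃ x),
   (1 / (1 - m₁), tube₁ ε₁ ε₂ ε₃ x),
   (1 / (1 - m₂), tube₂ ε₁ ε₂ ε₃ x),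
   (1 / (1 - m₃), tube₃ ε₁ ε₂ ε₃ x),
   (1 / ((1 - m₁) * (1 - m₂)), torus₁₂ ε₁ ε₂ x),
   (1 / ((1 - m₂) * (1 - m₃)), torus₂₃ ε₂ ε₃ x),
   (1 / ((1 - m₃) * (1 - m₁)), torus₃₁ ε₁ ε₃ x)]

/-- `e^{2πi z}`. -/
def e2pi (z : ℂ) : ℂ := exp (2 * Real.pi * I * z)

/-- The twisted cycle `Δ₁`: along the three circles the integrand is multiplied by
`γ₁⁻¹`, `γ₂⁻¹`, `γ₁ γ₂ α⁻¹`. -/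
def Delta₁ (a c₁ c₂ : ℂ) (ε₁ ε₂ ε₃ : ℝ) (x : ℂ × ℂ) : TwistedChain :=
  regTriangle (e2pi c₁)⁻¹ (e2pi c₂)⁻¹ (e2pi c₁ * e2pi c₂ * (e2pi a)⁻¹) ε₁ ε₂ ε₃ x

/-- The image of a loaded cell under the involution `(t₁, t₂) ↦ (x₁ / t₁, x₂ / t₂)`, which
exchanges `L` and `M`. Here `l₁`, `l₂` are the logarithms of `x₁`, `x₂`. -/
def LoadedCell.involution (x : ℂ × ℂ) (l₁ l₂ : ℂ) (σ : LoadedCell) : LoadedCell where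
  dom := σ.dom
  t₁ := fun p => x.1 / σ.t₁ p
  t₂ := fun p => x.2 / σ.t₂ p
  logt₁ := fun p => l₁ - σ.logt₁ p
  logt₂ := fun p => l₂ - σ.logt₂ p
  logL := σ.logM
  logM := σ.logL

/-- The twisted cycle `Δ₄`, image of the regularized triangle under the involution: along the
images of the three circles the integrand is multiplied by `γ₁`, `γ₂`, `β⁻¹`. -/
def Delta₄ (b c₁ c₂ : ℂ) (ε₁ ε₂ ε₃ : ℝ) (x : ℂ × ℂ) (l₁ l₂ : ℂ) : TwistedChain :=
  (regTriangle (e2pi c₁) (e2pi c₂) (e2pi b)⁻¹ ε₁ ε₂ ε₃ x).map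
    fun q => (q.1, q.2.involution x l₁ l₂)

/-! ### The chambers `Δ₂` and `Δ₃` for real positive `x` -/

/-- A region of the real `t`-plane in which `t₁, t₂ > 0`, `L < 0`, `M < 0`, with
`arg t₁ = arg t₂ = 0` and `arg L = arg M = -π`. -/
def chamberCell (x₁ x₂ : ℝ) (dom : Set (ℝ × ℝ)) : LoadedCell where
  dom := dom
  t₁ := fun p => (p.1 : ℂ)
  t₂ := fun p => (p.2 : ℂ)
  logt₁ := fun p => (Real.log p.1 : ℂ)
  logt₂ := fun p => (Real.log p.2 : ℂ)
  logL := fun p => (Real.log |1 - p.1 - p.2| : ℂ) - Real.pi * I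
  logM := fun p => (Real.log |1 - x₁ / p.1 - x₂ / p.2| : ℂ) - Real.pi * I

/-- The region `t₁, t₂ > 0`, `1 - t₁ - t₂ < 0`, `1 - x₁ / t₁ - x₂ / t₂ < 0`. If
`√x₁ + √x₂ < 1` it does not meet the line `√x₂ t₁ = √x₁ t₂`, and it has two connected
components, one on each side of this line. -/
def outerRegion (x₁ x₂ : ℝ) : Set (ℝ × ℝ) :=
  {p | 0 < p.1 ∧ 0 < p.2 ∧ 1 - p.1 - p.2 < 0 ∧ 1 - x₁ / p.1 - x₂ / p.2 < 0}

/-- `Δ₂` is the component of the outer region on which `t₁` is bounded. -/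
def Delta₂ (x₁ x₂ : ℝ) : TwistedChain :=
  [(1, chamberCell x₁ x₂ (outerRegion x₁ x₂ ∩ {p | √x₂ * p.1 < √x₁ * p.2}))]

/-- `Δ₃` is the component of the outer region on which `t₂` is bounded. -/
def Delta₃ (x₁ x₂ : ℝ) : TwistedChain :=
  [(1, chamberCell x₁ x₂ (outerRegion x₁ x₂ ∩ {p | √x₁ * p.2 < √x₂ * p.1}))]

/-! ### Branches and continuation on a complex domain -/

/-- `l` is the continuous branch on `U` of the logarithm of the function `ξ` (one of the
coordinates `x₁`, `x₂`) with the real value `l₀` at the base point `x₀`. -/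
structure IsLogBranch (U : Set (ℂ × ℂ)) (x₀ : ℂ × ℂ) (l₀ : ℝ) (ξ l : ℂ × ℂ → ℂ) : Prop where
  cont : ContinuousOn l U
  exp_eq : ∀ x ∈ U, exp (l x) = ξ x
  base : l x₀ = l₀

/-- `f` is holomorphic on `U` and is given near the real point `x₀` by the function `J` of real
variables: it is the holomorphic continuation of `J` to `U`. -/
structure IsContinuation (J : ℝ → ℝ → ℂ) (U : Set (ℂ × ℂ)) (x₀ : ℝ × ℝ) (f : ℂ × ℂ → ℂ) :
    Prop where
  holo : DifferentiableOn ℂ f U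
  eq_near : ∀ᶠ y : ℝ × ℝ in 𝓝 x₀, f ((y.1 : ℂ), (y.2 : ℂ)) = J y.1 y.2

end AppellF4

end

/-! ### Pochhammer symbols, convergence and holomorphy of Appell's series -/

namespace AppellF4

/-! The four integrals are of two kinds: regularized triangles (Δ₁, Δ₄) and real chambers (Δ₂, Δ₃).

On every cell of Δ₁ one has |x₁/t₁| + |x₂/t₂| < 1, so M^{-b} expands in a double binomial series and
f₁ becomes a series of moments ∫ t₁^{p-1} t₂^{q-1} L^{r-1} with p = 1-c₁-n₁, q = 1-c₂-n₂, r =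
c₁+c₂-a-1. Each moment has Dirichlet's value Γ(p)Γ(q)Γ(r)/Γ(p+q+r) (`moment_regTriangle`). If the
exponents have real part > 1, the circles can be contracted: a loaded circle contributes e^{2πiP} -
1 times the integral over its radius (`integral_circ_eq`). With the orientations of the chain, a
tube divided by 1-m_j is then the strip along a side of the standard simplex, a torus divided by its
two factors is the parallelogram at a vertex, and together with the triangle they tile the simplex
(`setIntegral_simplex_tiling`). Other non-integral exponents are reached by the identity theorem on
ℂ∖ℤ, one exponent at a time. The functional equation of Γ turns the shifts by n₁, n₂ into Pochhammer
symbols, and the series is F₄. The involution t_j ↦ x_j/t_j changes the integrand into one of the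
same type with parameters (b+2-c₁-c₂, a+2-c₁-c₂, 2-c₁, 2-c₂), times x₁^{1-c₁} x₂^{1-c₂}; hence Δ₄
follows from Δ₁.

For Δ₂ put X = t₁, Y = x₂/t₂. On the chamber X + Y < 1, and ξ = X(1-Y)/x₁, η = Y(1-X)/x₂ map it
bijectively onto the open unit square (`image_straighten`, `injOn_straighten`). Up to monomials, 1-ξ
and 1-η are -M and -L, and the Jacobian is -(1-X-Y). The closed form F₄(A,B,B,A; X(1-Y), Y(1-X)) =
(1-Y)^{1-B} (1-X)^{1-A} / (1-X-Y) (`F4_self_eq`), with A = a+1-c₁ and B = b+1-c₁, absorbs everything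
else: in the new coordinates the integrand is a constant times two beta densities times F₄(A,B,B,A;
x₁ξ, x₂η). Termwise integration replaces the lower parameters B, A by 2-c₁, c₂
(`integral_beta_mul_F4`). Δ₃ follows by exchanging the indices. The formulas extend to U because a
holomorphic function on a connected open set is determined by its values at real points near x⁰
(`eqOn_zero_of_eventually_real`). -/

theorem poch_zero (z : ℂ) : poch z 0 = 1 := by simp [poch]

theorem poch_succ (z : ℂ) (n : ℕ) : poch z (n + 1) = poch z n * (z + n) := by
  simp [poch, ascPochhammer_succ_eval]

theorem poch_add (z : ℂ) (m n : ℕ) : poch z (m + n) = poch z m * poch (z + m) n := by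
  simp [poch, ← ascPochhammer_mul, Polynomial.eval_mul, Polynomial.eval_comp]

theorem poch_one (n : ℕ) : poch 1 n = n.factorial := by
  simp [poch]

theorem poch_ne_zero {z : ℂ} (hz : ∀ k : ℕ, z ≠ -k) (n : ℕ) : poch z n ≠ 0 := by
  induction n with
  | zero => simp [poch_zero]
  | succ n ih =>
    rw [poch_succ]
    exact mul_ne_zero ih fun h => hz n (eq_neg_of_add_eq_zero_left h)

theorem ne_neg_nat_of_re_pos {z : ℂ} (hz : 0 < z.re) (k : ℕ) : z ≠ -k := by
  rintro rfl
  simp at hz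
  linarith [(Nat.cast_nonneg k : (0 : ℝ) ≤ k)]

theorem poch_ofReal_nonneg {r : ℝ} (hr : 0 ≤ r) (n : ℕ) : 0 ≤ (poch r n).re ∧ (poch r n).im = 0 := by
  induction n with
  | zero => simp [poch_zero]
  | succ n ih =>
    rw [poch_succ]
    simp only [mul_re, mul_im, add_re, ofReal_re, natCast_re, add_im, ofReal_im, natCast_im, ih.2]
    exact ⟨by have := ih.1; simp; positivity, by simp⟩

theorem norm_poch_ofReal {r : ℝ} (hr : 0 ≤ r) (n : ℕ) : ((‖poch r n‖ : ℝ) : ℂ) = poch r n := by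
  obtain ⟨h1, h2⟩ := poch_ofReal_nonneg hr n
  have h3 : poch r n = ((poch r n).re : ℂ) := Complex.ext rfl (by simp [h2])
  rw [h3, norm_real, Real.norm_of_nonneg h1]

theorem norm_poch_le {z : ℂ} {r : ℝ} (h : ‖z‖ ≤ r) (n : ℕ) : ‖poch z n‖ ≤ ‖poch r n‖ := by
  have hr : 0 ≤ r := (norm_nonneg z).trans h
  induction n with
  | zero => simp [poch_zero]
  | succ n ih =>
    rw [poch_succ, poch_succ, norm_mul, norm_mul]
    refine mul_le_mul ih ?_ (norm_nonneg _) (norm_nonneg _)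
    have h1 : ((r : ℂ) + n) = ((r + n : ℝ) : ℂ) := by push_cast; rfl
    rw [h1, norm_real, Real.norm_of_nonneg (by positivity)]
    refine (norm_add_le _ _).trans ?_
    simpa using h

/-- A positive sequence whose successive ratios tend to `1` is `O(tⁿ)` for every `t > 1`. -/
theorem exists_le_mul_pow_of_ratio_tendsto_one {u : ℕ → ℝ} (hu : ∀ n, 0 < u n)
    (h : Tendsto (fun n => u (n + 1) / u n) atTop (𝓝 1)) {t : ℝ} (ht : 1 < t) :
    ∃ C, 0 < C ∧ ∀ n, u n ≤ C * t ^ n := by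
  have ht0 : 0 < t := by linarith
  -- The ratios of u n / tⁿ tend to 1/t < 1; each term of a convergent positive series is at most
  -- its sum, which serves as C.
  have hs : Summable fun n => u n / t ^ n := by
    refine summable_of_ratio_test_tendsto_lt_one (l := 1 / t) (by rw [div_lt_one ht0]; exact ht)
      (Eventually.of_forall fun n => (div_pos (hu n) (by positivity)).ne') ?_
    refine (h.div_const t).congr fun n => ?_
    have := hu n
    have := hu (n + 1)
    rw [Real.norm_of_nonneg (by positivity), Real.norm_of_nonneg (by positivity)]
    field_simp
    rw [pow_succ']
  refine ⟨∑' n, u n / t ^ n, hs.tsum_pos (fun n => by have := hu n; positivity) 0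
    (by simpa using hu 0), fun n => ?_⟩
  rw [← div_le_iff₀ (by positivity)]
  exact hs.le_tsum n fun m _ => by have := hu m; positivity

/-- These are the successive ratios of ‖poch z n‖ / n! wherever they are defined, so a nonvanishing
Pochhammer symbol is comparable to n! up to factors tⁿ with t > 1 arbitrary. -/
theorem tendsto_norm_add_div (z : ℂ) : Tendsto (fun n : ℕ => ‖z + n‖ / ((n : ℝ) + 1)) atTop (𝓝 1) := by
  have h1 : Tendsto (fun n : ℕ => (z - 1) / ((n : ℂ) + 1) + 1) atTop (𝓝 1) := by
    have h2 := tendsto_one_div_add_atTop_nhds_zero_nat (𝕜 := ℂ)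
    simpa [div_eq_mul_inv] using (h2.const_mul (z - 1)).add_const 1
  have h3 := h1.norm
  rw [norm_one] at h3
  refine h3.congr fun n => ?_
  have h4 : ((n : ℂ) + 1) ≠ 0 := by exact_mod_cast Nat.succ_ne_zero n
  have h5 : (z - 1) / ((n : ℂ) + 1) + 1 = (z + n) / ((n + 1 : ℝ) : ℂ) := by
    push_cast
    field_simp
    ring
  rw [h5, norm_div, norm_real, Real.norm_of_nonneg (by positivity)]

theorem exists_norm_poch_le (z : ℂ) {t : ℝ} (ht : 1 < t) :
    ∃ C, 0 < C ∧ ∀ n : ℕ, ‖poch z n‖ ≤ C * t ^ n * n.factorial := by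
  -- The positive number r majorizes ‖z‖ and its Pochhammer symbols never vanish, so the ratio
  -- argument also covers z a nonpositive integer.
  set r : ℝ := ‖z‖ + 1
  have hr : 0 < r := by positivity
  have hr0 : ∀ n, poch r n ≠ 0 := poch_ne_zero (ne_neg_nat_of_re_pos (by simpa using hr))
  have hlim : Tendsto (fun n : ℕ => ‖poch r (n + 1)‖ / (n + 1).factorial /
      (‖poch r n‖ / n.factorial)) atTop (𝓝 1) := by
    refine (tendsto_norm_add_div (r : ℂ)).congr fun n => ?_
    have := norm_pos_iff.2 (hr0 n)
    rw [poch_succ, norm_mul, Nat.factorial_succ]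
    push_cast
    field_simp
  obtain ⟨C, hC, h⟩ := exists_le_mul_pow_of_ratio_tendsto_one
    (u := fun n => ‖poch r n‖ / n.factorial)
    (fun n => div_pos (norm_pos_iff.2 (hr0 n)) (by positivity)) hlim ht
  refine ⟨C, hC, fun n => (norm_poch_le (r := r) (by simp [r]) n).trans ?_⟩
  exact (div_le_iff₀ (by positivity)).1 (h n)

theorem exists_factorial_le_norm_poch {z : ℂ} (hz : ∀ k : ℕ, z ≠ -k) {t : ℝ} (ht : 1 < t) :
    ∃ C, 0 < C ∧ ∀ n : ℕ, (n.factorial : ℝ) / ‖poch z n‖ ≤ C * t ^ n := by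
  have h0 : ∀ n, 0 < ‖poch z n‖ := fun n => norm_pos_iff.2 (poch_ne_zero hz n)
  refine exists_le_mul_pow_of_ratio_tendsto_one (fun n => div_pos (by positivity) (h0 n)) ?_ ht
  have h1 := (tendsto_norm_add_div z).inv₀ one_ne_zero
  rw [inv_one] at h1
  refine h1.congr fun n => ?_
  have h2 := h0 n
  have h3 : 0 < ‖z + n‖ := norm_pos_iff.2 fun h => hz n (eq_neg_of_add_eq_zero_left h)
  rw [poch_succ, norm_mul, Nat.factorial_succ]
  push_cast
  field_simp

theorem summable_prod_iff_antidiagonal {f : ℕ × ℕ → ℝ} (hf : ∀ n, 0 ≤ f n) :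
    Summable f ↔ Summable fun N => ∑ n ∈ Finset.HasAntidiagonal.antidiagonal N, f n := by
  rw [← Finset.HasAntidiagonal.sigmaAntidiagonalEquivProd.summable_iff,
    summable_sigma_of_nonneg (f := f ∘ Finset.HasAntidiagonal.sigmaAntidiagonalEquivProd)
      (fun _ => hf _)]
  have h : ∀ N, ∑' y : Finset.HasAntidiagonal.antidiagonal N,
      (f ∘ Finset.HasAntidiagonal.sigmaAntidiagonalEquivProd) ⟨N, y⟩ = ∑ n ∈ Finset.HasAntidiagonal.antidiagonal N, f n := by
    intro N
    rw [tsum_fintype]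
    exact Finset.sum_coe_sort _ f
  simp only [h]
  exact ⟨fun h => h.2, fun h => ⟨fun N => Summable.of_finite, h⟩⟩

theorem hasSum_prod_antidiagonal {f : ℕ × ℕ → ℂ} (hf : Summable f) :
    HasSum f (∑' N, ∑ n ∈ Finset.HasAntidiagonal.antidiagonal N, f n) := by
  have h1 : Summable (f ∘ Finset.HasAntidiagonal.sigmaAntidiagonalEquivProd) :=
    Finset.HasAntidiagonal.sigmaAntidiagonalEquivProd.summable_iff.2 hf
  have h2 := h1.tsum_sigma
  simp only [Function.comp_def] at h2
  rw [Finset.HasAntidiagonal.sigmaAntidiagonalEquivProd.tsum_eq f] at h2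
  convert hf.hasSum using 1
  rw [h2]
  refine tsum_congr fun N => ?_
  rw [tsum_fintype]
  exact (Finset.sum_coe_sort _ f).symm

theorem sum_antidiagonal_choose_mul_pow {R : Type*} [CommSemiring R] (x y : R) (N : ℕ) :
    ∑ n ∈ Finset.HasAntidiagonal.antidiagonal N, (n.1 + n.2).choose n.1 * (x ^ n.1 * y ^ n.2) = (x + y) ^ N := by
  rw [(Commute.all x y).add_pow']
  refine Finset.sum_congr rfl fun n hn => ?_
  rw [Finset.HasAntidiagonal.mem_antidiagonal.1 hn, nsmul_eq_mul]

theorem choose_add_eq {K : Type*} [Field K] [CharZero K] (m n : ℕ) :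
    (((m + n).choose m : ℕ) : K) = (m + n).factorial / (m.factorial * n.factorial) := by
  have h1 := Nat.cast_ne_zero (R := K).2 m.factorial_ne_zero
  have h2 := Nat.cast_ne_zero (R := K).2 n.factorial_ne_zero
  rw [eq_div_iff (mul_ne_zero h1 h2), ← Nat.add_choose_mul_factorial_mul_factorial m n,
    Nat.choose_symm_add]
  push_cast
  ring

/-- On the antidiagonal m + n = N a sum of squares is at most the square of the sum, and the
binomial theorem in √r₁, √r₂ gives (√r₁ + √r₂)^{2N}. This is where the domain √|x₁| + √|x₂| < 1
comes from. -/
theorem summable_choose_sq {r₁ r₂ : ℝ} (h₁ : 0 ≤ r₁) (h₂ : 0 ≤ r₂) (h : √r₁ + √r₂ < 1) :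
    Summable fun n : ℕ × ℕ => ((n.1 + n.2).choose n.1 : ℝ) ^ 2 * (r₁ ^ n.1 * r₂ ^ n.2) := by
  rw [summable_prod_iff_antidiagonal (fun n => by positivity)]
  have h0 : 0 ≤ √r₁ + √r₂ := by positivity
  refine Summable.of_nonneg_of_le (fun N => Finset.sum_nonneg fun n _ => by positivity) (fun N => ?_)
    (summable_geometric_of_lt_one (sq_nonneg _) (by nlinarith : (√r₁ + √r₂) ^ 2 < 1))
  rw [← pow_mul, mul_comm 2 N, pow_mul, ← sum_antidiagonal_choose_mul_pow]
  refine le_trans (le_of_eq ?_) (Finset.sum_sq_le_sq_sum_of_nonneg fun n _ => by positivity)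
  refine Finset.sum_congr rfl fun n _ => ?_
  rw [mul_pow, mul_pow, ← pow_mul, ← pow_mul, mul_comm n.1, mul_comm n.2, pow_mul, pow_mul,
    Real.sq_sqrt h₁, Real.sq_sqrt h₂]

/-- The coefficients of Appell's series. -/
noncomputable def coeffF4 (a b c₁ c₂ : ℂ) (n : ℕ × ℕ) : ℂ :=
  poch a (n.1 + n.2) * poch b (n.1 + n.2) /
    (poch c₁ n.1 * poch c₂ n.2 * poch 1 n.1 * poch 1 n.2)

theorem summable_coeffF4 (a b : ℂ) {c₁ c₂ : ℂ} (hc₁ : ∀ k : ℕ, c₁ ≠ -k) (hc₂ : ∀ k : ℕ, c₂ ≠ -k)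
    {r₁ r₂ : ℝ} (h₁ : 0 ≤ r₁) (h₂ : 0 ≤ r₂) (h : √r₁ + √r₂ < 1) :
    Summable fun n : ℕ × ℕ => ‖coeffF4 a b c₁ c₂ n‖ * (r₁ ^ n.1 * r₂ ^ n.2) := by
  -- Replacing Pochhammer symbols by factorials costs t^{m+n} for each upper one and t^m, t^n for
  -- the lower ones, that is t^{3(m+n)} in all; what remains is the squared binomial coefficient.
  obtain ⟨t, ht, hts⟩ : ∃ t : ℝ, 1 < t ∧ √(t ^ 3 * r₁) + √(t ^ 3 * r₂) < 1 := by
    have hc : Tendsto (fun t : ℝ => √(t ^ 3 * r₁) + √(t ^ 3 * r₂)) (𝓝[>] 1)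
        (𝓝 (√((1 : ℝ) ^ 3 * r₁) + √((1 : ℝ) ^ 3 * r₂))) :=
      Tendsto.mono_left (Continuous.tendsto (by fun_prop) 1) nhdsWithin_le_nhds
    have h1 := hc.eventually (gt_mem_nhds (by simpa using h))
    obtain ⟨t, h2, h3⟩ := (h1.and self_mem_nhdsWithin).exists
    exact ⟨t, h3, h2⟩
  obtain ⟨Ca, hCa, ha⟩ := exists_norm_poch_le a ht
  obtain ⟨Cb, hCb, hb⟩ := exists_norm_poch_le b ht
  obtain ⟨C1, hC1, h1⟩ := exists_factorial_le_norm_poch hc₁ ht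
  obtain ⟨C2, hC2, h2⟩ := exists_factorial_le_norm_poch hc₂ ht
  have ht0 : 0 < t := by linarith
  refine Summable.of_nonneg_of_le (fun n => by positivity) (fun n => ?_)
    ((summable_choose_sq (by positivity) (by positivity) hts).mul_left (Ca * Cb * C1 * C2))
  obtain ⟨m, n⟩ := n
  simp only [coeffF4, norm_div, norm_mul, poch_one, norm_natCast]
  have e1 : ((m + n).choose m : ℝ) = (m + n).factorial / (m.factorial * n.factorial) :=
    choose_add_eq m n
  have p1 := norm_pos_iff.2 (poch_ne_zero hc₁ m)
  have p2 := norm_pos_iff.2 (poch_ne_zero hc₂ n)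
  calc _ = ‖poch a (m + n)‖ * ‖poch b (m + n)‖ * ((m.factorial : ℝ) / ‖poch c₁ m‖) *
        ((n.factorial : ℝ) / ‖poch c₂ n‖) / (m.factorial * n.factorial) ^ 2 * (r₁ ^ m * r₂ ^ n) := by
        field_simp
    _ ≤ (Ca * t ^ (m + n) * (m + n).factorial) * (Cb * t ^ (m + n) * (m + n).factorial) *
        (C1 * t ^ m) * (C2 * t ^ n) / (m.factorial * n.factorial) ^ 2 * (r₁ ^ m * r₂ ^ n) := by
        gcongr
        · exact ha _
        · exact hb _
        · exact h1 _
        · exact h2 _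
    _ = _ := by
        rw [e1]
        simp only [mul_pow, ← pow_mul, pow_add]
        field_simp
        ring

theorem F4_eq_tsum (a b c₁ c₂ : ℂ) (x : ℂ × ℂ) :
    F4 a b c₁ c₂ x = ∑' n : ℕ × ℕ, coeffF4 a b c₁ c₂ n * (x.1 ^ n.1 * x.2 ^ n.2) := by
  simp only [F4, coeffF4, mul_assoc]

theorem F4_swap (a b c₁ c₂ : ℂ) (x : ℂ × ℂ) : F4 a b c₁ c₂ x = F4 a b c₂ c₁ x.swap := by
  rw [F4_eq_tsum, F4_eq_tsum, ← (Equiv.prodComm ℕ ℕ).tsum_eq]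
  refine tsum_congr fun n => ?_
  simp only [coeffF4, Equiv.prodComm_apply, Prod.fst_swap, Prod.snd_swap, add_comm n.2 n.1]
  ring

theorem F4_comm (a b c₁ c₂ : ℂ) (x : ℂ × ℂ) : F4 a b c₁ c₂ x = F4 b a c₁ c₂ x := by
  rw [F4_eq_tsum, F4_eq_tsum]
  refine tsum_congr fun n => ?_
  simp only [coeffF4, mul_comm (poch a _)]

theorem poch_eq_factorial_mul_choose (b : ℂ) (n : ℕ) :
    poch b n = n.factorial * Ring.choose (b + n - 1) n := by
  have h := Ring.factorial_nsmul_multichoose_eq_ascPochhammer b n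
  rw [Ring.multichoose_eq, ← Polynomial.eval₂_smulOneHom_eq_smeval, nsmul_eq_mul] at h
  rw [h, poch, ← ascPochhammer_map (RingHom.smulOneHom (R := ℕ) (S := ℂ)), Polynomial.eval_map]

theorem hasSum_binomial (b : ℂ) {z : ℂ} (hz : ‖z‖ < 1) :
    HasSum (fun n : ℕ => poch b n / n.factorial * z ^ n) ((1 - z) ^ (-b)) := by
  have h := (one_div_one_sub_cpow_hasFPowerSeriesOnBall_zero b).hasSum (y := z)
    (by rw [← ENNReal.ofReal_one, Metric.eball_ofReal]; simpa using hz)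
  simp only [zero_add, one_div, ← cpow_neg] at h
  have e : (fun n : ℕ => poch b n / n.factorial * z ^ n) = fun n =>
      (FormalMultilinearSeries.ofScalars ℂ (fun n : ℕ => Ring.choose (b + n - 1) n) n)
        fun _ => z := by
    funext n
    rw [poch_eq_factorial_mul_choose, mul_div_cancel_left₀ _ (Nat.cast_ne_zero.2 n.factorial_ne_zero)]
    simp [FormalMultilinearSeries.ofScalars, mul_comm]
  rw [e]
  exact h

theorem summable_binomial (b : ℂ) {r : ℝ} (h0 : 0 ≤ r) (hr : r < 1) :
    Summable fun n : ℕ => ‖poch b n‖ / n.factorial * r ^ n := by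
  have h := (hasSum_binomial ((‖b‖ : ℝ) : ℂ) (z := (r : ℂ))
    (by rwa [norm_real, Real.norm_of_nonneg h0])).summable.norm
  refine h.of_nonneg_of_le (fun n => by positivity) fun n => ?_
  simp only [norm_mul, norm_div, norm_pow, norm_natCast, norm_real, Real.norm_of_nonneg h0]
  gcongr
  exact norm_poch_le le_rfl n

/-- The terms with m + n = N add up to the N-th term of the one-variable binomial series at r₁ + r₂.
-/
theorem summable_binomial₂ (b : ℂ) {r₁ r₂ : ℝ} (h₁ : 0 ≤ r₁) (h₂ : 0 ≤ r₂) (h : r₁ + r₂ < 1) :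
    Summable fun n : ℕ × ℕ => ‖poch b (n.1 + n.2) / (n.1.factorial * n.2.factorial)‖ *
      (r₁ ^ n.1 * r₂ ^ n.2) := by
  rw [summable_prod_iff_antidiagonal (fun n => by positivity)]
  refine (summable_binomial b (by positivity) h).congr fun N => ?_
  rw [← sum_antidiagonal_choose_mul_pow, Finset.mul_sum]
  refine Finset.sum_congr rfl fun n hn => ?_
  rw [Finset.HasAntidiagonal.mem_antidiagonal.1 hn, ← Finset.HasAntidiagonal.mem_antidiagonal.1 hn]
  have e1 : ((n.1 + n.2).choose n.1 : ℝ) =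
      (n.1 + n.2).factorial / (n.1.factorial * n.2.factorial) := choose_add_eq n.1 n.2
  rw [e1, norm_div, norm_mul, Complex.norm_natCast, Complex.norm_natCast]
  field_simp

theorem hasSum_binomial₂ (b : ℂ) {z₁ z₂ : ℂ} (h : ‖z₁‖ + ‖z₂‖ < 1) :
    HasSum (fun n : ℕ × ℕ => poch b (n.1 + n.2) / (n.1.factorial * n.2.factorial) *
      (z₁ ^ n.1 * z₂ ^ n.2)) ((1 - z₁ - z₂) ^ (-b)) := by
  have hs : Summable fun n : ℕ × ℕ => poch b (n.1 + n.2) / (n.1.factorial * n.2.factorial) *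
      (z₁ ^ n.1 * z₂ ^ n.2) := by
    refine .of_norm ((summable_binomial₂ b (norm_nonneg z₁) (norm_nonneg z₂) h).congr fun n => ?_)
    rw [norm_mul, norm_mul, norm_pow, norm_pow]
  convert hasSum_prod_antidiagonal hs using 1
  rw [sub_sub, ← (hasSum_binomial b (z := z₁ + z₂) ((norm_add_le _ _).trans_lt h)).tsum_eq]
  refine tsum_congr fun N => ?_
  rw [← sum_antidiagonal_choose_mul_pow, Finset.mul_sum]
  refine Finset.sum_congr rfl fun n hn => ?_
  rw [← Finset.HasAntidiagonal.mem_antidiagonal.1 hn, choose_add_eq]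
  have := Nat.cast_ne_zero (R := ℂ).2 (n.1 + n.2).factorial_ne_zero
  field_simp

/-- Appell's series is holomorphic in its domain of convergence. -/
theorem differentiableOn_F4 (a b : ℂ) {c₁ c₂ : ℂ} (hc₁ : ∀ k : ℕ, c₁ ≠ -k)
    (hc₂ : ∀ k : ℕ, c₂ ≠ -k) : DifferentiableOn ℂ (F4 a b c₁ c₂) convDomain := by
  intro x hx
  -- One δ opens a polydisc around the origin containing x; the second pays for the derivatives of
  -- the monomials, through n r^{n-1} ≤ (r+δ)ⁿ/δ.
  obtain ⟨δ, hδ, hδs⟩ : ∃ δ : ℝ, 0 < δ ∧ √(‖x.1‖ + 2 * δ) + √(‖x.2‖ + 2 * δ) < 1 := by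
    have hc : Tendsto (fun t : ℝ => √(‖x.1‖ + 2 * t) + √(‖x.2‖ + 2 * t)) (𝓝[>] 0)
        (𝓝 (√(‖x.1‖ + 2 * 0) + √(‖x.2‖ + 2 * 0))) :=
      Tendsto.mono_left (Continuous.tendsto (by fun_prop) 0) nhdsWithin_le_nhds
    have h1 := hc.eventually (gt_mem_nhds (by simpa [convDomain] using hx))
    obtain ⟨t, h2, h3⟩ := (h1.and self_mem_nhdsWithin).exists
    exact ⟨t, h3, h2⟩
  set r₁ := ‖x.1‖ + δ
  set r₂ := ‖x.2‖ + δ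
  have hr₁ : 0 < r₁ := by positivity
  have hr₂ : 0 < r₂ := by positivity
  have hpow : ∀ (r : ℝ) (n : ℕ), 0 ≤ r → n * r ^ (n - 1) ≤ (r + δ) ^ n / δ := by
    intro r n hr
    rw [le_div_iff₀ hδ]
    rcases n with _ | n
    · simp
    · induction n with
      | zero => simp [hr]
      | succ n ih =>
        have h1 : r * r ^ n ≤ (r + δ) ^ (n + 1) := by
          rw [← pow_succ']
          gcongr
          linarith
        simp only [Nat.add_sub_cancel] at ih ⊢
        rw [pow_succ (r + δ), pow_succ r]
        push_cast at ih ⊢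
        nlinarith
  let f' : ℕ × ℕ → ℂ × ℂ → (ℂ × ℂ →L[ℂ] ℂ) := fun n y => coeffF4 a b c₁ c₂ n •
    (y.1 ^ n.1 • ((n.2 * y.2 ^ (n.2 - 1)) • ContinuousLinearMap.snd ℂ ℂ ℂ) +
      y.2 ^ n.2 • ((n.1 * y.1 ^ (n.1 - 1)) • ContinuousLinearMap.fst ℂ ℂ ℂ))
  let u : ℕ × ℕ → ℝ := fun n => 2 / δ * (‖coeffF4 a b c₁ c₂ n‖ *
    ((‖x.1‖ + 2 * δ) ^ n.1 * (‖x.2‖ + 2 * δ) ^ n.2))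
  have hF : F4 a b c₁ c₂ = fun y : ℂ × ℂ =>
      ∑' n : ℕ × ℕ, coeffF4 a b c₁ c₂ n * (y.1 ^ n.1 * y.2 ^ n.2) := by
    ext y; exact F4_eq_tsum ..
  have hx' : x ∈ Metric.ball (0 : ℂ) r₁ ×ˢ Metric.ball (0 : ℂ) r₂ := by
    simp [r₁, r₂, hδ]
  have key := hasFDerivAt_tsum_of_isPreconnected (𝕜 := ℂ) (u := u)
    (f := fun n (y : ℂ × ℂ) => coeffF4 a b c₁ c₂ n * (y.1 ^ n.1 * y.2 ^ n.2)) (f' := f')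
    (s := Metric.ball (0 : ℂ) r₁ ×ˢ Metric.ball (0 : ℂ) r₂) (x₀ := x) (x := x)
    ((summable_coeffF4 a b hc₁ hc₂ (by positivity) (by positivity) hδs).mul_left _)
    (Metric.isOpen_ball.prod Metric.isOpen_ball)
    ((convex_ball (0 : ℂ) r₁).prod (convex_ball (0 : ℂ) r₂)).isPreconnected ?_ ?_ hx' ?_ hx'
  · rw [hF]
    exact key.differentiableAt.differentiableWithinAt
  · intro n y _
    have h1 : HasFDerivAt (fun y : ℂ × ℂ => y.1 ^ n.1)
        ((n.1 * y.1 ^ (n.1 - 1)) • ContinuousLinearMap.fst ℂ ℂ ℂ) y := by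
      exact (hasDerivAt_pow n.1 y.1).comp_hasFDerivAt y hasFDerivAt_fst
    have h2 : HasFDerivAt (fun y : ℂ × ℂ => y.2 ^ n.2)
        ((n.2 * y.2 ^ (n.2 - 1)) • ContinuousLinearMap.snd ℂ ℂ ℂ) y := by
      exact (hasDerivAt_pow n.2 y.2).comp_hasFDerivAt y hasFDerivAt_snd
    exact (h1.mul h2).const_mul _
  · intro n y hy
    simp only [Set.mem_prod, mem_ball_zero_iff] at hy
    have n1 : ‖ContinuousLinearMap.fst ℂ ℂ ℂ‖ ≤ 1 := ContinuousLinearMap.norm_fst_le ..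
    have n2 : ‖ContinuousLinearMap.snd ℂ ℂ ℂ‖ ≤ 1 := ContinuousLinearMap.norm_snd_le ..
    have e1 : r₁ + δ = ‖x.1‖ + 2 * δ := by simp only [r₁]; ring
    have e2 : r₂ + δ = ‖x.2‖ + 2 * δ := by simp only [r₂]; ring
    have b1 := hpow r₁ n.1 hr₁.le
    have b2 := hpow r₂ n.2 hr₂.le
    calc ‖f' n y‖ ≤ ‖coeffF4 a b c₁ c₂ n‖ * (‖y.1‖ ^ n.1 * ((n.2 * ‖y.2‖ ^ (n.2 - 1)) * 1) +
          ‖y.2‖ ^ n.2 * ((n.1 * ‖y.1‖ ^ (n.1 - 1)) * 1)) := by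
          simp only [f']
          rw [norm_smul]
          gcongr
          refine (norm_add_le _ _).trans ?_
          simp only [norm_smul, norm_mul, norm_pow, Complex.norm_natCast]
          gcongr
      _ ≤ ‖coeffF4 a b c₁ c₂ n‖ * ((r₁ + δ) ^ n.1 * ((r₂ + δ) ^ n.2 / δ) +
          (r₂ + δ) ^ n.2 * ((r₁ + δ) ^ n.1 / δ)) := by
          rw [mul_one, mul_one]
          gcongr
          · linarith [hy.1]
          · refine le_trans ?_ b2
            gcongr
            exact hy.2.le
          · linarith [hy.2]
          · refine le_trans ?_ b1
            gcongr
            exact hy.1.le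
      _ = u n := by
          simp only [u]
          rw [e1, e2]
          ring
  · refine .of_norm (((summable_coeffF4 a b hc₁ hc₂ (norm_nonneg x.1) (norm_nonneg x.2) hx)).congr
      fun n => ?_)
    rw [norm_mul, norm_mul, norm_pow, norm_pow]

end AppellF4

/-! ### The closed form of F₄(A, B, B, A) -/

namespace AppellF4

theorem tsum_binomial_norm {r R : ℝ} (hr : 0 ≤ r) (h0 : 0 ≤ R) (hR : R < 1) :
    ∑' n : ℕ, ‖poch r n‖ / n.factorial * R ^ n = (1 - R) ^ (-r) := by
  have h := (hasSum_binomial (r : ℂ) (z := (R : ℂ))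
    (by rwa [norm_real, Real.norm_of_nonneg h0])).tsum_eq
  apply ofReal_injective
  rw [ofReal_tsum, ofReal_cpow (by linarith)]
  push_cast
  rw [← h]
  simp only [norm_poch_ofReal hr]

theorem hasSum_of_eq {ι : Type*} {f g : ι → ℂ} {a b : ℂ} (h : HasSum f a) (hf : ∀ i, g i = f i)
    (hab : b = a) : HasSum g b := by
  rw [hab, funext hf]
  exact h

/-- Cauchy's formula extracts the m-th Taylor coefficient of (1-s)^{-c}, and uniqueness of power
series identifies it with the binomial one. -/
theorem circleIntegral_binomial_coeff (c : ℂ) (m : ℕ) {ρ : ℝ} (h0 : 0 < ρ) (h1 : ρ < 1) :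
    (∮ s in C(0, ρ), 1 / s ^ (m + 1) * (1 - s) ^ (-c)) =
      2 * Real.pi * I * (poch c m / m.factorial) := by
  have hd : ∀ s ∈ Metric.ball (0 : ℂ) 1, DifferentiableAt ℂ (fun s : ℂ => (1 - s) ^ (-c)) s := by
    intro s hs
    refine DifferentiableAt.cpow_const (by fun_prop) ?_
    rw [sub_eq_add_neg]
    exact mem_slitPlane_of_norm_lt_one (by simpa using hs)
  have hc := DiffContOnCl.circleIntegral_one_div_sub_center_pow_smul h0 m
    (f := fun s : ℂ => (1 - s) ^ (-c)) (c := 0) (DifferentiableOn.diffContOnCl_ball (U := Metric.ball 0 1)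
      (fun s hs => (hd s hs).differentiableWithinAt) (Metric.closedBall_subset_ball h1))
  simp only [sub_zero, smul_eq_mul] at hc
  rw [hc]
  have ha : AnalyticAt ℂ (fun s : ℂ => (1 - s) ^ (-c)) 0 :=
    DifferentiableOn.analyticAt (fun s hs => (hd s hs).differentiableWithinAt)
      (Metric.ball_mem_nhds 0 one_pos)
  have hp : HasFPowerSeriesAt (fun s : ℂ => (1 - s) ^ (-c))
      (FormalMultilinearSeries.ofScalars ℂ fun n : ℕ => Ring.choose (c + n - 1) n) 0 := by
    have := (one_div_one_sub_cpow_hasFPowerSeriesOnBall_zero c).hasFPowerSeriesAt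
    simpa only [one_div, ← cpow_neg] using this
  have he := hp.eq_formalMultilinearSeries ha.hasFPowerSeriesAt
  rw [FormalMultilinearSeries.ofScalars_series_eq_iff] at he
  have he' := congrFun he m
  have hf : (m.factorial : ℂ) ≠ 0 := Nat.cast_ne_zero.2 m.factorial_ne_zero
  rw [poch_eq_factorial_mul_choose, he']
  field_simp

variable {X Y : ℝ}

/-- Splitting (A)_{m+n} = (A)_n (A+n)_m and (B)_{m+n} = (B)_m (B+m)_n cancels both lower symbols.
The first remaining factor will be written as a contour integral, the second summed directly. -/
theorem coeffF4_self (A B : ℂ) (hA : ∀ k : ℕ, A ≠ -k) (hB : ∀ k : ℕ, B ≠ -k) (n : ℕ × ℕ) :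
    coeffF4 A B B A n = poch (A + n.2) n.1 / n.1.factorial *
      (poch (B + n.1) n.2 / n.2.factorial) := by
  obtain ⟨m, n⟩ := n
  have h1 := poch_ne_zero hA n
  have h2 := poch_ne_zero hB m
  have h3 : poch A (m + n) = poch A n * poch (A + n) m := by rw [add_comm, poch_add]
  simp only [coeffF4, h3, poch_add B m n, poch_one]
  field_simp

/-- For fixed s the sum over n is a binomial series in q/(1-s), and the sum over m is then geometric
with ratio (p/s)(1-q/(1-s))⁻¹. The majorant replaces B + m by ‖B‖ + m and s by its modulus; its
summability is the same computation at s = ρ, and it later allows sum and contour integral to be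
interchanged. -/
theorem hasSum_lagrange_kernel (A B : ℂ) {p q ρ : ℝ} (hp : 0 < p) (hq : 0 < q) (hρ : 0 < ρ)
    (hqρ : q < 1 - ρ) (hpρ : p / ρ * (1 - q / (1 - ρ))⁻¹ < 1) {s : ℂ} (hs : ‖s‖ = ρ) :
    HasSum (fun n : ℕ × ℕ => ((p : ℂ) ^ n.1 * q ^ n.2 * (poch (B + n.1) n.2 / n.2.factorial)) *
        (1 / s ^ (n.1 + 1) * (1 - s) ^ (-(A + n.2))))
      ((1 - s) ^ (-A) * (1 - q / (1 - s)) ^ (-B) * (s - p / (1 - q / (1 - s)))⁻¹) ∧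
    (∀ n : ℕ × ℕ, ‖((p : ℂ) ^ n.1 * q ^ n.2 * (poch (B + n.1) n.2 / n.2.factorial)) *
        (1 / s ^ (n.1 + 1) * (1 - s) ^ (-(A + n.2)))‖ ≤ ρ⁻¹ * ‖(1 - s) ^ (-A)‖ *
        ((p / ρ) ^ n.1 * (‖poch ((‖B‖ + n.1 : ℝ) : ℂ) n.2‖ / n.2.factorial *
          (q / (1 - ρ)) ^ n.2))) ∧
    Summable (fun n : ℕ × ℕ => (p / ρ) ^ n.1 *
      (‖poch ((‖B‖ + n.1 : ℝ) : ℂ) n.2‖ / n.2.factorial * (q / (1 - ρ)) ^ n.2)) := by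
  have hρ1 : 0 < 1 - ρ := hq.trans hqρ
  have hR0 : 0 ≤ q / (1 - ρ) := by positivity
  have hR1 : q / (1 - ρ) < 1 := by rwa [div_lt_one hρ1]
  have hs0 : s ≠ 0 := by rintro rfl; simp at hs; linarith
  have h1s : 1 - ρ ≤ ‖1 - s‖ := by
    have := norm_sub_norm_le (1 : ℂ) s
    rwa [norm_one, hs] at this
  have h1s0 : 1 - s ≠ 0 := norm_pos_iff.1 (hρ1.trans_le h1s)
  have hwR : ‖(q : ℂ) / (1 - s)‖ ≤ q / (1 - ρ) := by
    rw [norm_div, norm_real, Real.norm_of_nonneg hq.le]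
    gcongr
  have hw1 : ‖(q : ℂ) / (1 - s)‖ < 1 := hwR.trans_lt hR1
  have hw0 : 1 - (q : ℂ) / (1 - s) ≠ 0 := by
    intro h
    rw [← sub_eq_zero.1 h, norm_one] at hw1
    exact lt_irrefl _ hw1
  have hterm : ∀ n : ℕ × ℕ, ((p : ℂ) ^ n.1 * q ^ n.2 * (poch (B + n.1) n.2 / n.2.factorial)) *
        (1 / s ^ (n.1 + 1) * (1 - s) ^ (-(A + n.2))) = s⁻¹ * (1 - s) ^ (-A) * ((p / s) ^ n.1 *
        (poch (B + n.1) n.2 / n.2.factorial * (q / (1 - s)) ^ n.2)) := by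
    intro n
    rw [neg_add, ← sub_eq_add_neg, cpow_sub _ _ h1s0, cpow_natCast,
      div_pow, div_pow, pow_succ]
    field_simp
  have hbound : ∀ n : ℕ × ℕ, ‖((p : ℂ) ^ n.1 * q ^ n.2 * (poch (B + n.1) n.2 / n.2.factorial)) *
        (1 / s ^ (n.1 + 1) * (1 - s) ^ (-(A + n.2)))‖ ≤ ρ⁻¹ * ‖(1 - s) ^ (-A)‖ *
        ((p / ρ) ^ n.1 * (‖poch ((‖B‖ + n.1 : ℝ) : ℂ) n.2‖ / n.2.factorial *
          (q / (1 - ρ)) ^ n.2)) := by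
    intro n
    rw [hterm]
    simp only [norm_mul, norm_inv, norm_pow, hs, Complex.norm_natCast, norm_div _ (n.2.factorial : ℂ),
      norm_div _ s, norm_real, Real.norm_of_nonneg hp.le]
    gcongr
    refine norm_poch_le ?_ _
    refine (norm_add_le _ _).trans ?_
    simp
  have hsum : Summable (fun n : ℕ × ℕ => (p / ρ) ^ n.1 *
      (‖poch ((‖B‖ + n.1 : ℝ) : ℂ) n.2‖ / n.2.factorial * (q / (1 - ρ)) ^ n.2)) := by
    rw [summable_prod_of_nonneg (fun n => by positivity)]
    constructor
    · intro m
      exact (summable_binomial ((‖B‖ + m : ℝ) : ℂ) hR0 hR1).mul_left ((p / ρ) ^ m)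
    · have h : ∀ m : ℕ, ∑' n : ℕ, (p / ρ) ^ m * (‖poch ((‖B‖ + m : ℝ) : ℂ) n‖ / n.factorial *
          (q / (1 - ρ)) ^ n) = (1 - q / (1 - ρ)) ^ (-‖B‖) * (p / ρ * (1 - q / (1 - ρ))⁻¹) ^ m := by
        intro m
        rw [tsum_mul_left, tsum_binomial_norm (by positivity) hR0 hR1, neg_add, ← sub_eq_add_neg,
          Real.rpow_sub_natCast (by linarith), mul_pow, inv_pow]
        ring
      simp only [h]
      have h3 : 0 < 1 - q / (1 - ρ) := by linarith
      exact (summable_geometric_of_lt_one (by positivity) hpρ).mul_left _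
  refine ⟨?_, hbound, hsum⟩
  have hs' : Summable fun n : ℕ × ℕ =>
      ((p : ℂ) ^ n.1 * q ^ n.2 * (poch (B + n.1) n.2 / n.2.factorial)) *
        (1 / s ^ (n.1 + 1) * (1 - s) ^ (-(A + n.2))) :=
    .of_norm_bounded (hsum.mul_left _) hbound
  have hfib : ∀ m : ℕ, HasSum (fun n : ℕ =>
      ((p : ℂ) ^ m * q ^ n * (poch (B + m) n / n.factorial)) *
        (1 / s ^ (m + 1) * (1 - s) ^ (-(A + n))))
      (s⁻¹ * (1 - s) ^ (-A) * (1 - q / (1 - s)) ^ (-B) * (p / s * (1 - q / (1 - s))⁻¹) ^ m) := by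
    intro m
    have h1 := ((hasSum_binomial (B + m) hw1).mul_left ((p / s : ℂ) ^ m)).mul_left
      (s⁻¹ * (1 - s) ^ (-A))
    rw [neg_add, ← sub_eq_add_neg, cpow_sub _ _ hw0, cpow_natCast] at h1
    refine hasSum_of_eq h1 (fun n => hterm (m, n)) ?_
    rw [mul_pow, inv_pow]
    ring
  have hsm := hs'.hasSum.prod_fiberwise hfib
  have hratio : ‖(p : ℂ) / s * (1 - q / (1 - s))⁻¹‖ < 1 := by
    refine lt_of_le_of_lt ?_ hpρ
    rw [norm_mul, norm_div, hs, norm_real, Real.norm_of_nonneg hp.le, norm_inv]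
    have h2 : 1 - q / (1 - ρ) ≤ ‖1 - (q : ℂ) / (1 - s)‖ := by
      have := norm_sub_norm_le (1 : ℂ) (q / (1 - s))
      rw [norm_one] at this
      linarith
    have h3 : 0 < 1 - q / (1 - ρ) := by linarith
    gcongr
  have hg := (hasSum_geometric_of_norm_lt_one hratio).mul_left
    (s⁻¹ * (1 - s) ^ (-A) * (1 - q / (1 - s)) ^ (-B))
  have hval := hsm.unique hg
  convert hs'.hasSum using 1
  rw [hval, mul_comm (s⁻¹), mul_assoc _ s⁻¹, mul_comm s⁻¹, ← mul_assoc _ _ s⁻¹, mul_assoc _ s⁻¹,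
    ← mul_inv]
  congr 2
  field_simp

/-- The generating function of the series `F₄(A, B, B, A)`. -/
theorem F4_self_eq (A B : ℂ) (hA : ∀ k : ℕ, A ≠ -k) (hB : ∀ k : ℕ, B ≠ -k)
    (hX : 0 < X) (hY : 0 < Y) (hXY : X + Y < 1) :
    F4 A B B A (((X * (1 - Y) : ℝ) : ℂ), ((Y * (1 - X) : ℝ) : ℂ)) =
      (1 - Y : ℂ) ^ (1 - B) * (1 - X : ℂ) ^ (1 - A) / (1 - X - Y) := by
  set p : ℝ := X * (1 - Y) with hpdef
  set q : ℝ := Y * (1 - X) with hqdef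
  have hp : 0 < p := mul_pos hX (by linarith)
  have hq : 0 < q := mul_pos hY (by linarith)
  -- X and 1 - Y are the two zeros of the kernel's denominator; the circle separates them, so only s
  -- = X contributes.
  obtain ⟨ρ, hρX, hρY⟩ : ∃ ρ, X < ρ ∧ ρ < 1 - Y := exists_between (by linarith)
  have hρ : 0 < ρ := hX.trans hρX
  have hρ1 : ρ < 1 := by linarith
  have hqY : q < Y := by nlinarith
  have hqρ : q < 1 - ρ := by linarith
  -- Cleared of denominators this is (ρ - X)(1 - Y - ρ) > 0.
  have hpρ : p / ρ * (1 - q / (1 - ρ))⁻¹ < 1 := by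
    have h1 : 0 < 1 - ρ := by linarith
    have h2 : 1 - q / (1 - ρ) = (1 - ρ - q) / (1 - ρ) := by field_simp
    have h3 : 0 < 1 - ρ - q := by linarith
    rw [h2, inv_div, div_mul_div_comm, div_lt_one (by positivity)]
    nlinarith [mul_pos (sub_pos.2 hρX) (sub_pos.2 hρY)]
  -- The summed kernel is h(s)/(s - X), with h holomorphic for |s| < 1 - Y; Cauchy's formula
  -- therefore gives h(X).
  let h : ℂ → ℂ := fun s => (1 - s) ^ (-A) * (1 - q / (1 - s)) ^ (-B) * ((1 - s - q) / (1 - Y - s))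
  have hslit : ∀ s ∈ Metric.ball (0 : ℂ) (1 - Y), 1 - s ∈ slitPlane ∧ 1 - q / (1 - s) ∈ slitPlane ∧
      1 - (Y : ℂ) - s ≠ 0 := by
    intro s hs
    rw [mem_ball_zero_iff] at hs
    have h1s : Y < ‖1 - s‖ := by
      have := norm_sub_norm_le (1 : ℂ) s
      rw [norm_one] at this
      linarith
    refine ⟨?_, ?_, ?_⟩
    · rw [sub_eq_add_neg]
      exact mem_slitPlane_of_norm_lt_one (by rw [norm_neg]; linarith)
    · rw [sub_eq_add_neg]
      refine mem_slitPlane_of_norm_lt_one ?_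
      rw [norm_neg, norm_div, norm_real, Real.norm_of_nonneg hq.le, div_lt_one (by linarith)]
      linarith
    · intro h0
      have h1 : s = ((1 - Y : ℝ) : ℂ) := by push_cast; linear_combination -h0
      rw [h1, norm_real, Real.norm_of_nonneg (by linarith)] at hs
      exact lt_irrefl _ hs
  have hh : DifferentiableOn ℂ h (Metric.ball 0 (1 - Y)) := by
    intro s hs
    obtain ⟨h1, h2, h3⟩ := hslit s hs
    have h4 := slitPlane_ne_zero h1
    refine DifferentiableAt.differentiableWithinAt ?_
    refine ((DifferentiableAt.cpow_const (by fun_prop) h1).mul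
      (DifferentiableAt.cpow_const ?_ h2)).mul (DifferentiableAt.div (by fun_prop) (by fun_prop) h3)
    exact (differentiableAt_const _).sub ((differentiableAt_const _).div (by fun_prop) h4)
  have hsph : ∀ θ : ℝ, ‖circleMap 0 ρ θ‖ = ρ := fun θ => by simp [abs_of_pos hρ]
  have hball : ∀ θ : ℝ, circleMap 0 ρ θ ∈ Metric.ball (0 : ℂ) (1 - Y) := fun θ => by
    rw [mem_ball_zero_iff, hsph]
    exact hρY
  have hC : ∀ c : ℂ, Continuous fun θ : ℝ => (1 - circleMap 0 ρ θ) ^ c := fun c =>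
    Continuous.cpow (continuous_const.sub (continuous_circleMap 0 ρ)) continuous_const
      fun θ => (hslit _ (hball θ)).1
  obtain ⟨K, hK⟩ := isCompact_uIcc.exists_bound_of_continuousOn (s := Set.uIcc 0 (2 * Real.pi))
    (hC (-A)).continuousOn
  have key := intervalIntegral.hasSum_integral_of_dominated_convergence (a := 0) (b := 2 * Real.pi)
    (μ := volume)
    (F := fun (n : ℕ × ℕ) (θ : ℝ) => deriv (circleMap 0 ρ) θ •
      (((p : ℂ) ^ n.1 * q ^ n.2 * (poch (B + n.1) n.2 / n.2.factorial)) *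
        (1 / circleMap 0 ρ θ ^ (n.1 + 1) * (1 - circleMap 0 ρ θ) ^ (-(A + n.2)))))
    (f := fun θ : ℝ => deriv (circleMap 0 ρ) θ • ((circleMap 0 ρ θ - X)⁻¹ • h (circleMap 0 ρ θ)))
    (fun n _ => ρ * (ρ⁻¹ * K * ((p / ρ) ^ n.1 *
      (‖poch ((‖B‖ + n.1 : ℝ) : ℂ) n.2‖ / n.2.factorial * (q / (1 - ρ)) ^ n.2))))
    ?_ ?_ ?_ ?_ ?_
  · have hcau := DiffContOnCl.circleIntegral_sub_inv_smul (R := ρ) (c := 0) (w := (X : ℂ)) (f := h)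
      (hh.diffContOnCl_ball (Metric.closedBall_subset_ball hρY))
      (by rwa [mem_ball_zero_iff, norm_real, Real.norm_of_nonneg hX.le])
    rw [circleIntegral] at hcau
    rw [hcau] at key
    have hX1 : (1 - X : ℂ) ≠ 0 := by exact_mod_cast (by linarith : (1 - X : ℝ) ≠ 0)
    have hY1 : (1 - Y : ℂ) ≠ 0 := by exact_mod_cast (by linarith : (1 - Y : ℝ) ≠ 0)
    have hXY1 : (1 - Y - X : ℂ) ≠ 0 := by exact_mod_cast (by linarith : (1 - Y - X : ℝ) ≠ 0)
    have hXY2 : (1 - X - Y : ℂ) ≠ 0 := by exact_mod_cast (by linarith : (1 - X - Y : ℝ) ≠ 0)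
    have hhX : h X = (1 - Y : ℂ) ^ (1 - B) * (1 - X : ℂ) ^ (1 - A) / (1 - X - Y) := by
      have e1 : 1 - (q : ℂ) / (1 - X) = 1 - Y := by
        rw [hqdef]; push_cast; field_simp
      simp only [h, e1]
      rw [sub_eq_add_neg 1 B, sub_eq_add_neg 1 A, cpow_add _ _ hX1, cpow_add _ _ hY1, cpow_one,
        cpow_one, hqdef]
      push_cast
      field_simp
      ring
    have h2 : (2 * Real.pi * I : ℂ) ≠ 0 := two_pi_I_ne_zero
    rw [hhX, smul_eq_mul] at key
    have key2 := key.mul_left ((2 * Real.pi * I : ℂ)⁻¹)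
    rw [inv_mul_cancel_left₀ h2] at key2
    rw [F4_eq_tsum, ← key2.tsum_eq]
    refine tsum_congr fun n => ?_
    have h3 := circleIntegral_binomial_coeff (A + n.2) n.1 hρ hρ1
    rw [circleIntegral] at h3
    simp only [smul_eq_mul] at h3 ⊢
    simp only [mul_left_comm (deriv (circleMap 0 ρ) _) ((p : ℂ) ^ n.1 * q ^ n.2 *
      (poch (B + n.1) n.2 / n.2.factorial))]
    rw [intervalIntegral.integral_const_mul, h3, coeffF4_self A B hA hB]
    field_simp
  · intro n
    refine Continuous.aestronglyMeasurable ?_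
    simp only [deriv_circleMap]
    refine Continuous.smul ((continuous_circleMap 0 ρ).mul continuous_const) (continuous_const.mul (Continuous.mul ?_ (hC _)))
    refine continuous_const.div ((continuous_circleMap 0 ρ).pow _) fun θ => pow_ne_zero _ ?_
    exact norm_pos_iff.1 (by rw [hsph]; exact hρ)
  · intro n
    refine Eventually.of_forall fun θ hθ => ?_
    rw [norm_smul]
    have h1 : ‖deriv (circleMap 0 ρ) θ‖ = ρ := by simp [deriv_circleMap, abs_of_pos hρ]
    rw [h1]
    refine mul_le_mul_of_nonneg_left ?_ hρ.le
    refine ((hasSum_lagrange_kernel A B hp hq hρ hqρ hpρ (hsph θ)).2.1 n).trans ?_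
    have : 0 < 1 - ρ := by linarith
    gcongr
    exact hK θ (Set.uIoc_subset_uIcc hθ)
  · refine Eventually.of_forall fun θ _ => ?_
    exact ((hasSum_lagrange_kernel A B hp hq hρ hqρ hpρ (hsph θ)).2.2.mul_left _).mul_left _
  · exact intervalIntegrable_const
  · refine Eventually.of_forall fun θ _ => ?_
    refine HasSum.const_smul _ ?_
    have h1 := (hasSum_lagrange_kernel A B hp hq hρ hqρ hpρ (hsph θ)).1
    refine hasSum_of_eq h1 (fun _ => rfl) ?_
    obtain ⟨s1, s2, s3⟩ := hslit _ (hball θ)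
    have h4 := slitPlane_ne_zero s1
    have h5 := slitPlane_ne_zero s2
    have h6 : circleMap 0 ρ θ - X ≠ 0 := by
      intro h0
      have := hsph θ
      rw [sub_eq_zero.1 h0, norm_real, Real.norm_of_nonneg hX.le] at this
      linarith
    set s := circleMap 0 ρ θ
    have h7 : 1 - s - q ≠ 0 := by
      intro h0
      apply h5
      have e : 1 - (q : ℂ) / (1 - s) = (1 - s - q) / (1 - s) := by field_simp
      rw [e, h0, zero_div]
    -- The quadratic s(1-s-q) - p(1-s) factors because p - q = X - Y and p = X(1-Y).
    have h8 : s - p / (1 - q / (1 - s)) = (s - X) * (1 - Y - s) / (1 - s - q) := by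
      have e : 1 - (q : ℂ) / (1 - s) = (1 - s - q) / (1 - s) := by field_simp
      rw [e]
      field_simp
      rw [hpdef, hqdef]
      push_cast
      ring
    simp only [h, h8, smul_eq_mul, inv_div]
    field_simp

end AppellF4

/-! ### Beta integrals and the chamber Δ₂ -/

namespace AppellF4

theorem integrableOn_beta {u v : ℂ} (hu : 0 < u.re) (hv : 0 < v.re) :
    IntegrableOn (fun t : ℝ => (t : ℂ) ^ (u - 1) * (1 - t : ℂ) ^ (v - 1)) (Set.Ioo 0 1) := by
  have h := betaIntegral_convergent hu hv
  rw [intervalIntegrable_iff_integrableOn_Ioo_of_le zero_le_one] at h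
  exact h

theorem setIntegral_beta (u v : ℂ) :
    ∫ t in Set.Ioo (0 : ℝ) 1, (t : ℂ) ^ (u - 1) * (1 - t : ℂ) ^ (v - 1) = betaIntegral u v := by
  rw [betaIntegral, intervalIntegral.integral_of_le zero_le_one, integral_Ioc_eq_integral_Ioo]

/-- Integrating the m-th power against a beta density thus trades a denominator (u)_m of a series
for (u+v)_m. -/
theorem betaIntegral_add_nat {u v : ℂ} (hu : 0 < u.re) (hv : 0 < v.re) (m : ℕ) :
    betaIntegral (u + m) v = betaIntegral u v * (poch u m / poch (u + v) m) := by
  have h1 : 0 < (u + m).re := by simp; positivity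
  have h2 : 0 < (u + v).re := by simp; positivity
  have hu' := Gamma_ne_zero_of_re_pos hu
  have h2' := Gamma_ne_zero_of_re_pos h2
  rw [betaIntegral_eq_Gamma_mul_div _ _ h1 hv, betaIntegral_eq_Gamma_mul_div _ _ hu hv, poch, poch,
    ← Gamma_add_nat_div_Gamma_eq u (ne_neg_nat_of_re_pos hu),
    ← Gamma_add_nat_div_Gamma_eq (u + v) (ne_neg_nat_of_re_pos h2), add_right_comm u m v]
  field_simp

theorem mem_convDomain_mul {x₁ x₂ ξ η : ℝ} (hx₁ : 0 < x₁) (hx₂ : 0 < x₂) (hx : √x₁ + √x₂ < 1)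
    (hξ : 0 ≤ ξ ∧ ξ ≤ 1) (hη : 0 ≤ η ∧ η ≤ 1) :
    (((x₁ * ξ : ℝ) : ℂ), ((x₂ * η : ℝ) : ℂ)) ∈ convDomain := by
  simp only [convDomain, Set.mem_ofPred_eq, norm_real]
  rw [Real.norm_of_nonneg (mul_nonneg hx₁.le hξ.1), Real.norm_of_nonneg (mul_nonneg hx₂.le hη.1)]
  refine lt_of_le_of_lt (add_le_add (Real.sqrt_le_sqrt ?_) (Real.sqrt_le_sqrt ?_)) hx
  · nlinarith
  · nlinarith

/-- Termwise integration of Appell's series against a product of two beta densities. -/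
theorem integral_beta_mul_F4 {A B l μ : ℂ} (hA : 0 < A.re) (hB : 0 < B.re) (hl : 0 < l.re)
    (hμ : 0 < μ.re) {x₁ x₂ : ℝ} (hx₁ : 0 < x₁) (hx₂ : 0 < x₂) (hx : √x₁ + √x₂ < 1) :
    IntegrableOn (fun p : ℝ × ℝ => (((p.1 : ℂ) ^ (B - 1) * (1 - p.1 : ℂ) ^ (μ - 1)) *
      ((p.2 : ℂ) ^ (A - 1) * (1 - p.2 : ℂ) ^ (l - 1))) *
      F4 A B B A (((x₁ * p.1 : ℝ) : ℂ), ((x₂ * p.2 : ℝ) : ℂ)))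
      (Set.Ioo (0 : ℝ) 1 ×ˢ Set.Ioo (0 : ℝ) 1) ∧
    ∫ p in Set.Ioo (0 : ℝ) 1 ×ˢ Set.Ioo (0 : ℝ) 1,
      (((p.1 : ℂ) ^ (B - 1) * (1 - p.1 : ℂ) ^ (μ - 1)) *
      ((p.2 : ℂ) ^ (A - 1) * (1 - p.2 : ℂ) ^ (l - 1))) *
      F4 A B B A (((x₁ * p.1 : ℝ) : ℂ), ((x₂ * p.2 : ℝ) : ℂ)) =
    betaIntegral B μ * betaIntegral A l * F4 A B (B + μ) (A + l) ((x₁ : ℂ), (x₂ : ℂ)) := by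
  have hA0 := ne_neg_nat_of_re_pos hA
  have hB0 := ne_neg_nat_of_re_pos hB
  set S : Set (ℝ × ℝ) := Set.Ioo (0 : ℝ) 1 ×ˢ Set.Ioo (0 : ℝ) 1 with hS
  have hSm : MeasurableSet S := measurableSet_Ioo.prod measurableSet_Ioo
  let w : ℝ × ℝ → ℂ := fun p => ((p.1 : ℂ) ^ (B - 1) * (1 - p.1 : ℂ) ^ (μ - 1)) *
      ((p.2 : ℂ) ^ (A - 1) * (1 - p.2 : ℂ) ^ (l - 1))
  have hres : (volume : Measure (ℝ × ℝ)).restrict S =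
      (volume.restrict (Set.Ioo (0 : ℝ) 1)).prod (volume.restrict (Set.Ioo (0 : ℝ) 1)) := by
    rw [Measure.prod_restrict]; rfl
  have hw : IntegrableOn w S := by
    rw [IntegrableOn, hres]
    exact (integrableOn_beta hB hμ).mul_prod (integrableOn_beta hA hl)
  -- On the unit square each monomial is at most its value at the corner (1, 1), so one summable
  -- majorant serves all points.
  let u : ℕ × ℕ → ℝ := fun n => ‖coeffF4 A B B A n‖ * (x₁ ^ n.1 * x₂ ^ n.2)
  have hu : Summable u := summable_coeffF4 A B hB0 hA0 hx₁.le hx₂.le hx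
  let F : ℕ × ℕ → ℝ × ℝ → ℂ := fun n p => w p * (coeffF4 A B B A n *
    (((x₁ * p.1 : ℝ) : ℂ) ^ n.1 * ((x₂ * p.2 : ℝ) : ℂ) ^ n.2))
  have hFn : ∀ n, ∀ p ∈ S, ‖F n p‖ ≤ ‖w p‖ * u n := by
    intro n p hp
    obtain ⟨⟨h1, h2⟩, h3, h4⟩ := hp
    simp only [F, u, norm_mul, norm_pow, norm_real, Real.norm_of_nonneg hx₁.le,
      Real.norm_of_nonneg hx₂.le, Real.norm_of_nonneg h1.le, Real.norm_of_nonneg h3.le]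
    gcongr
    · nlinarith
    · nlinarith
  have hFi : ∀ n, IntegrableOn (F n) S := by
    intro n
    refine (hw.norm.mul_const (u n)).mono' ?_ ((ae_restrict_iff' hSm).2 (.of_forall (hFn n)))
    refine hw.aestronglyMeasurable.mul (Continuous.aestronglyMeasurable ?_)
    fun_prop
  have hFs : Summable fun n => ∫ p in S, ‖F n p‖ := by
    refine .of_nonneg_of_le (fun n => integral_nonneg fun p => norm_nonneg _) (fun n => ?_)
      (hu.mul_left (∫ p in S, ‖w p‖))
    rw [← integral_mul_const]
    exact setIntegral_mono_on (hFi n).norm (hw.norm.mul_const _) hSm (hFn n)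
  have hF4 : ∀ p : ℝ × ℝ, w p * F4 A B B A (((x₁ * p.1 : ℝ) : ℂ), ((x₂ * p.2 : ℝ) : ℂ)) =
      ∑' n, F n p := by
    intro p
    rw [F4_eq_tsum, ← tsum_mul_left]
  have hsum := hasSum_integral_of_summable_integral_norm hFi hFs
  refine ⟨?_, ?_⟩
  · refine (hw.norm.mul_const (∑' n, u n)).mono' (hw.aestronglyMeasurable.mul ?_) ?_
    · refine ContinuousOn.aestronglyMeasurable ?_ hSm
      refine (differentiableOn_F4 A B hB0 hA0).continuousOn.comp (by fun_prop) fun p hp => ?_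
      exact mem_convDomain_mul hx₁ hx₂ hx ⟨hp.1.1.le, hp.1.2.le⟩ ⟨hp.2.1.le, hp.2.2.le⟩
    · refine (ae_restrict_iff' hSm).2 (.of_forall fun p hp => ?_)
      show ‖w p * F4 A B B A (((x₁ * p.1 : ℝ) : ℂ), ((x₂ * p.2 : ℝ) : ℂ))‖ ≤ _
      rw [hF4, ← tsum_mul_left]
      exact tsum_of_norm_bounded (hu.mul_left _).hasSum fun n => hFn n p hp
  · show ∫ p in S, w p * F4 A B B A (((x₁ * p.1 : ℝ) : ℂ), ((x₂ * p.2 : ℝ) : ℂ)) = _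
    simp only [hF4]
    rw [← hsum.tsum_eq, F4_eq_tsum, ← tsum_mul_left]
    refine tsum_congr fun n => ?_
    have hint : ∫ p in S, F n p = coeffF4 A B B A n * ((x₁ : ℂ) ^ n.1 * (x₂ : ℂ) ^ n.2) *
        (betaIntegral (B + n.1) μ * betaIntegral (A + n.2) l) := by
      rw [← setIntegral_beta, ← setIntegral_beta, ← setIntegral_prod_mul, ← integral_const_mul]
      refine setIntegral_congr_fun hSm fun p hp => ?_
      obtain ⟨⟨h1, h2⟩, h3, h4⟩ := hp
      have e1 : (p.1 : ℂ) ≠ 0 := ofReal_ne_zero.2 h1.ne'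
      have e2 : (p.2 : ℂ) ≠ 0 := ofReal_ne_zero.2 h3.ne'
      have e3 : B + n.1 - 1 = B - 1 + n.1 := by ring
      have e4 : A + n.2 - 1 = A - 1 + n.2 := by ring
      simp only [F, w, e3, e4, cpow_add _ _ e1, cpow_add _ _ e2, cpow_natCast]
      push_cast
      ring
    have p1 := poch_ne_zero hA0 n.2
    have p2 := poch_ne_zero hB0 n.1
    rw [hint, betaIntegral_add_nat hB hμ, betaIntegral_add_nat hA hl]
    simp only [coeffF4]
    field_simp

/-- The chamber on which the coordinate `t₁` is bounded. -/
def chamber (x₁ x₂ : ℝ) : Set (ℝ × ℝ) := outerRegion x₁ x₂ ∩ {p | √x₂ * p.1 < √x₁ * p.2}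

theorem measurableSet_chamber (x₁ x₂ : ℝ) : MeasurableSet (chamber x₁ x₂) := by
  refine MeasurableSet.inter ?_ (measurableSet_lt (by fun_prop) (by fun_prop))
  have h₁ : MeasurableSet {p : ℝ × ℝ | 0 < p.1} := measurableSet_lt (by fun_prop) (by fun_prop)
  have h₂ : MeasurableSet {p : ℝ × ℝ | 0 < p.2} := measurableSet_lt (by fun_prop) (by fun_prop)
  have h₃ : MeasurableSet {p : ℝ × ℝ | 1 - p.1 - p.2 < 0} :=
    measurableSet_lt (by fun_prop) (by fun_prop)
  have h₄ : MeasurableSet {p : ℝ × ℝ | 1 - x₁ / p.1 - x₂ / p.2 < 0} :=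
    measurableSet_lt (by fun_prop) (by fun_prop)
  exact h₁.inter (h₂.inter (h₃.inter h₄))

/-- The map that straightens the chamber to the unit square. -/
noncomputable def straighten (x₁ x₂ : ℝ) (p : ℝ × ℝ) : ℝ × ℝ :=
  (p.1 / x₁ * (1 - x₂ / p.2), (1 - p.1) / p.2)

/-- The derivative of `straighten`. -/
noncomputable def straightenDeriv (x₁ x₂ : ℝ) (p : ℝ × ℝ) : ℝ × ℝ →L[ℝ] ℝ × ℝ :=
  LinearMap.toContinuousLinearMap (Matrix.toLin (Module.Basis.finTwoProd ℝ) (Module.Basis.finTwoProd ℝ)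
    !![(1 - x₂ / p.2) / x₁, p.1 / x₁ * (x₂ / p.2 ^ 2); -1 / p.2, -(1 - p.1) / p.2 ^ 2])

theorem hasFDerivAt_straighten (x₁ x₂ : ℝ) {p : ℝ × ℝ} (hp : p.2 ≠ 0) :
    HasFDerivAt (straighten x₁ x₂) (straightenDeriv x₁ x₂ p) p := by
  rw [straightenDeriv, Matrix.toLin_finTwoProd_toContinuousLinearMap]
  have h1 : HasFDerivAt (fun p : ℝ × ℝ => p.1) (ContinuousLinearMap.fst ℝ ℝ ℝ) p := hasFDerivAt_fst
  have h2 : HasFDerivAt (fun p : ℝ × ℝ => p.2) (ContinuousLinearMap.snd ℝ ℝ ℝ) p := hasFDerivAt_snd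
  have hinv : HasFDerivAt (fun p : ℝ × ℝ => p.2⁻¹)
      ((-(p.2 ^ 2)⁻¹) • ContinuousLinearMap.snd ℝ ℝ ℝ) p :=
    (hasDerivAt_inv hp).comp_hasFDerivAt p h2
  simp only [div_eq_mul_inv]
  refine HasFDerivAt.prodMk ?_ ?_
  · refine ((h1.mul_const x₁⁻¹).mul ((hinv.const_mul x₂).const_sub 1)).congr_fderiv ?_
    ext
    · simp
    · simp
  · refine ((h1.const_sub 1).mul hinv).congr_fderiv ?_
    ext <;> simp
    ring

/-- The factor 1 - X - Y, with X = t₁ and Y = x₂/t₂, is exactly the denominator in `F4_self_eq`. -/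
theorem det_straightenDeriv {x₁ x₂ : ℝ} (hx₁ : x₁ ≠ 0) {p : ℝ × ℝ} (hp : p.2 ≠ 0) :
    (straightenDeriv x₁ x₂ p).det = -((1 - p.1 - x₂ / p.2) / (x₁ * p.2 ^ 2)) := by
  rw [straightenDeriv, LinearMap.det_toContinuousLinearMap, LinearMap.det_toLin,
    Matrix.det_fin_two_of]
  field_simp
  ring

variable {x₁ x₂ : ℝ}

/-- With X = t₁ and Y = x₂/t₂, write X + Y = X(1-Y) + Y(1-X) + 2XY. The first two terms are below x₁
(from M < 0) and x₂ (from L < 0), and the choice of component gives XY < √x₁√x₂; the total is below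
(√x₁ + √x₂)² < 1. -/
theorem chamber_bounds (hx₁ : 0 < x₁) (hx₂ : 0 < x₂) (hx : √x₁ + √x₂ < 1) {p : ℝ × ℝ}
    (hp : p ∈ chamber x₁ x₂) : 0 < p.1 ∧ 0 < p.2 ∧ p.1 * (1 - x₂ / p.2) < x₁ ∧
      x₂ / p.2 * (1 - p.1) < x₂ ∧ p.1 + x₂ / p.2 < 1 := by
  obtain ⟨⟨h1, h2, h3, h4⟩, h5⟩ := hp
  have h6 : p.1 * (1 - x₂ / p.2) < x₁ := by
    have : p.1 * (1 - x₁ / p.1 - x₂ / p.2) < 0 := mul_neg_of_pos_of_neg h1 h4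
    have e : p.1 * (1 - x₁ / p.1 - x₂ / p.2) = p.1 * (1 - x₂ / p.2) - x₁ := by
      field_simp; ring
    linarith
  have h7 : x₂ / p.2 * (1 - p.1) < x₂ := by
    rw [div_mul_eq_mul_div, div_lt_iff₀ h2]
    nlinarith
  have s1 : 0 < √x₁ := Real.sqrt_pos.2 hx₁
  have s2 : 0 < √x₂ := Real.sqrt_pos.2 hx₂
  have q1 := Real.sq_sqrt hx₁.le
  have q2 := Real.sq_sqrt hx₂.le
  have h8 : p.1 * (x₂ / p.2) < √x₁ * √x₂ := by
    rw [mul_div_assoc', div_lt_iff₀ h2]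
    have h9 : √x₂ * (√x₂ * p.1) < √x₂ * (√x₁ * p.2) := mul_lt_mul_of_pos_left h5 s2
    nlinarith
  refine ⟨h1, h2, h6, h7, ?_⟩
  have h9 : (√x₁ + √x₂) ^ 2 < 1 := by nlinarith
  nlinarith

theorem image_straighten (hx₁ : 0 < x₁) (hx₂ : 0 < x₂) (hx : √x₁ + √x₂ < 1) :
    straighten x₁ x₂ '' chamber x₁ x₂ = Set.Ioo (0 : ℝ) 1 ×ˢ Set.Ioo (0 : ℝ) 1 := by
  ext ⟨ξ, η⟩
  constructor
  · rintro ⟨p, hp, he⟩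
    obtain ⟨h1, h2, h3, h4, h5⟩ := chamber_bounds hx₁ hx₂ hx hp
    rw [← he]
    have hY : 0 < x₂ / p.2 := by positivity
    refine ⟨⟨?_, ?_⟩, ?_, ?_⟩
    · exact mul_pos (by positivity) (by linarith)
    · simp only [straighten]
      rw [div_mul_eq_mul_div, div_lt_one hx₁]
      exact h3
    · exact div_pos (by linarith) h2
    · simp only [straighten]
      rw [div_lt_one h2]
      linarith [hp.1.2.2.1]
  · rintro ⟨⟨h1, h2⟩, h3, h4⟩
    simp only at h1 h2 h3 h4
    set p := x₁ * ξ with hpd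
    set q := x₂ * η with hqd
    have hp : 0 < p := mul_pos hx₁ h1
    have hq : 0 < q := mul_pos hx₂ h3
    have hpx : p < x₁ := by nlinarith
    have hqx : q < x₂ := by nlinarith
    have hs : √p + √q < 1 :=
      lt_of_le_of_lt (add_le_add (Real.sqrt_le_sqrt hpx.le) (Real.sqrt_le_sqrt hqx.le)) hx
    have q1 := Real.sq_sqrt hp.le
    have q2 := Real.sq_sqrt hq.le
    have s1 : 0 < √p := Real.sqrt_pos.2 hp
    have s2 : 0 < √q := Real.sqrt_pos.2 hq
    have hpq : 2 * (√p * √q) < 1 - p - q := by nlinarith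
    have hD0 : 0 < (1 - p - q) ^ 2 - 4 * (p * q) := by
      have : (2 * (√p * √q)) ^ 2 < (1 - p - q) ^ 2 := by gcongr
      nlinarith
    -- To solve X(1-Y) = p, Y(1-X) = q, note X - Y = p - q and (1-X-Y)² = (1-p-q)² - 4pq. The
    -- preimage in the chamber is the solution with 1 - X - Y = D > 0.
    set D := √((1 - p - q) ^ 2 - 4 * (p * q)) with hDd
    have hD : 0 < D := Real.sqrt_pos.2 hD0
    have hD2 : D ^ 2 = (1 - p - q) ^ 2 - 4 * (p * q) := Real.sq_sqrt hD0.le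
    have hpq' : 0 < 1 - p - q := lt_trans (by positivity) hpq
    obtain ⟨X, hX⟩ : ∃ X, X = (1 + p - q - D) / 2 := ⟨_, rfl⟩
    obtain ⟨Y, hY⟩ : ∃ Y, Y = (1 - p + q - D) / 2 := ⟨_, rfl⟩
    have e1 : X * (1 - Y) = p := by rw [hX, hY]; nlinarith
    have e2 : Y * (1 - X) = q := by rw [hX, hY]; nlinarith
    have y1 : 0 < 1 - Y := by rw [hY]; linarith
    have y2 : 0 < 1 - X := by rw [hX]; linarith
    have hX0 : 0 < X := pos_of_mul_pos_left (by rw [e1]; exact hp) y1.le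
    have hY0 : 0 < Y := pos_of_mul_pos_left (by rw [e2]; exact hq) y2.le
    -- This puts the solution on the correct side of the dividing line: since X + Y < 1, (XY)² <
    -- XY(1-X)(1-Y) = pq < x₁x₂.
    have hXY : X * Y < √x₁ * √x₂ := by
      have h5 : (X * Y) ^ 2 < (√x₁ * √x₂) ^ 2 := by
        rw [mul_pow (√x₁), Real.sq_sqrt hx₁.le, Real.sq_sqrt hx₂.le]
        have h6 : X * Y < (1 - X) * (1 - Y) := by
          have : X + Y < 1 := by rw [hX, hY]; linarith
          nlinarith
        calc (X * Y) ^ 2 = (X * Y) * (X * Y) := by ring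
          _ < (X * Y) * ((1 - X) * (1 - Y)) := by gcongr
          _ = p * q := by rw [← e1, ← e2]; ring
          _ < x₁ * x₂ := by gcongr
      exact lt_of_pow_lt_pow_left₀ 2 (by positivity) h5
    refine ⟨(X, x₂ / Y), ⟨⟨hX0, by positivity, ?_, ?_⟩, ?_⟩, ?_⟩
    · simp only
      have : 1 - X < x₂ / Y := by rw [lt_div_iff₀ hY0]; linarith
      linarith
    · simp only
      rw [div_div_cancel₀ hx₂.ne']
      have : 1 - Y < x₁ / X := by rw [lt_div_iff₀ hX0]; linarith
      linarith
    · simp only [Set.mem_ofPred_eq]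
      rw [mul_div_assoc', lt_div_iff₀ hY0]
      have := mul_lt_mul_of_pos_left hXY (Real.sqrt_pos.2 hx₂)
      calc √x₂ * X * Y = √x₂ * (X * Y) := mul_assoc _ _ _
        _ < √x₂ * (√x₁ * √x₂) := this
        _ = √x₁ * (√x₂ ^ 2) := by ring
        _ = √x₁ * x₂ := by rw [Real.sq_sqrt hx₂.le]
    · simp only [straighten]
      rw [div_div_cancel₀ hx₂.ne']
      ext
      · simp only
        rw [div_mul_eq_mul_div, e1, hpd]
        field_simp
      · simp only
        rw [div_div_eq_mul_div, mul_comm, e2, hqd]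
        field_simp

/-- The image determines X - Y and (1-X-Y)², and on the chamber 1 - X - Y is the positive root. -/
theorem injOn_straighten (hx₁ : 0 < x₁) (hx₂ : 0 < x₂) (hx : √x₁ + √x₂ < 1) :
    Set.InjOn (straighten x₁ x₂) (chamber x₁ x₂) := by
  intro p hp p' hp' h
  obtain ⟨h1, h2, -, -, h5⟩ := chamber_bounds hx₁ hx₂ hx hp
  obtain ⟨h1', h2', -, -, h5'⟩ := chamber_bounds hx₁ hx₂ hx hp'
  simp only [straighten, Prod.mk.injEq] at h
  obtain ⟨e1, e2⟩ := h
  have f1 : p.1 * (1 - x₂ / p.2) = p'.1 * (1 - x₂ / p'.2) := by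
    rw [div_mul_eq_mul_div, div_mul_eq_mul_div, div_left_inj' hx₁.ne'] at e1
    exact e1
  have f2 : x₂ / p.2 * (1 - p.1) = x₂ / p'.2 * (1 - p'.1) := by
    rw [div_mul_eq_mul_div, div_mul_eq_mul_div, mul_div_assoc, mul_div_assoc, e2]
  have hY : 0 < x₂ / p.2 := by positivity
  have hY' : 0 < x₂ / p'.2 := by positivity
  have g1 : p.1 + x₂ / p.2 = p'.1 + x₂ / p'.2 := by
    have h6 : (1 - p.1 - x₂ / p.2) ^ 2 = (1 - p'.1 - x₂ / p'.2) ^ 2 := by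
      have i1 : ∀ X Y : ℝ, (1 - X - Y) ^ 2 =
        (1 - X * (1 - Y) - Y * (1 - X)) ^ 2 - 4 * (X * (1 - Y) * (Y * (1 - X))) := by
        intro X Y; ring
      rw [i1, i1 p'.1, f1, f2]
    have h7 := (sq_eq_sq₀ (by linarith) (by linarith)).1 h6
    linarith
  have g2 : p.1 - x₂ / p.2 = p'.1 - x₂ / p'.2 := by linarith
  have g3 : p.1 = p'.1 := by linarith
  have g4 : x₂ / p.2 = x₂ / p'.2 := by linarith
  rw [div_eq_div_iff h2.ne' h2'.ne'] at g4
  exact Prod.ext g3 (mul_left_cancel₀ hx₂.ne' g4).symm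

theorem ofReal_cpow_eq_exp {r : ℝ} (hr : 0 < r) (z : ℂ) : (r : ℂ) ^ z = exp (Real.log r * z) := by
  rw [cpow_def_of_ne_zero (ofReal_ne_zero.2 hr.ne'), ofReal_log hr.le]

theorem chamberCell_jac (D : Set (ℝ × ℝ)) (p : ℝ × ℝ) : (chamberCell x₁ x₂ D).jac p = 1 := by
  have h : ∀ s : ℝ, deriv (fun s : ℝ => (s : ℂ)) s = 1 := fun s =>
    (hasDerivAt_id s).ofReal_comp.deriv
  simp [LoadedCell.jac, chamberCell, h]

/-- Since 1-ξ = (t₁/x₁)|M| and 1-η = |L|/t₂, the beta densities carry the powers of M and L. The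
powers of 1-X and 1-Y in ξ and η cancel those of `F4_self_eq`, and the Jacobian cancels its
denominator; only the phase and x₁^{1-c₁} are left over. -/
theorem pullback_chamberCell {a b c₁ c₂ : ℂ} (hA : 0 < (a + 1 - c₁).re) (hB : 0 < (b + 1 - c₁).re)
    (hx₁ : 0 < x₁) (hx₂ : 0 < x₂) (hx : √x₁ + √x₂ < 1) (D : Set (ℝ × ℝ)) {p : ℝ × ℝ}
    (hp : p ∈ chamber x₁ x₂) :
    (chamberCell x₁ x₂ D).pullback a b c₁ c₂ p =
      (exp (-(Real.pi * I * (c₁ + c₂ - a - b))) * (x₁ : ℂ) ^ (1 - c₁)) *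
        (|(straightenDeriv x₁ x₂ p).det| •
        (((((straighten x₁ x₂ p).1 : ℂ) ^ (b + 1 - c₁ - 1) *
          (1 - (straighten x₁ x₂ p).1 : ℂ) ^ (1 - b - 1)) *
          (((straighten x₁ x₂ p).2 : ℂ) ^ (a + 1 - c₁ - 1) *
            (1 - (straighten x₁ x₂ p).2 : ℂ) ^ (c₁ + c₂ - a - 1 - 1))) *
          F4 (a + 1 - c₁) (b + 1 - c₁) (b + 1 - c₁) (a + 1 - c₁)
            (((x₁ * (straighten x₁ x₂ p).1 : ℝ) : ℂ), ((x₂ * (straighten x₁ x₂ p).2 : ℝ) : ℂ)))) := by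
  obtain ⟨h1, h2, h3, h4, h5⟩ := chamber_bounds hx₁ hx₂ hx hp
  have hL := hp.1.2.2.1
  have hM := hp.1.2.2.2
  have hY : 0 < x₂ / p.2 := by positivity
  have hY1 : 0 < 1 - x₂ / p.2 := by linarith
  have hX1 : 0 < 1 - p.1 := by linarith
  have hJ : 0 < 1 - p.1 - x₂ / p.2 := by linarith
  have hJ0 : ((1 - p.1 - x₂ / p.2 : ℝ) : ℂ) ≠ 0 := ofReal_ne_zero.2 hJ.ne'
  have e1 : x₁ * (straighten x₁ x₂ p).1 = p.1 * (1 - x₂ / p.2) := by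
    simp only [straighten]; field_simp
  have e2 : x₂ * (straighten x₁ x₂ p).2 = x₂ / p.2 * (1 - p.1) := by
    simp only [straighten]; field_simp
  have e3 : 1 - (straighten x₁ x₂ p).1 = p.1 / x₁ * |1 - x₁ / p.1 - x₂ / p.2| := by
    rw [abs_of_neg hM]; simp only [straighten]; field_simp; ring
  have e4 : 1 - (straighten x₁ x₂ p).2 = |1 - p.1 - p.2| / p.2 := by
    rw [abs_of_neg hL]; simp only [straighten]; field_simp; ring
  have hM' : 0 < |1 - x₁ / p.1 - x₂ / p.2| := abs_pos.2 hM.ne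
  have hL' : 0 < |1 - p.1 - p.2| := abs_pos.2 hL.ne
  rw [e1, e2, F4_self_eq _ _ (ne_neg_nat_of_re_pos hA) (ne_neg_nat_of_re_pos hB) h1 hY h5,
    det_straightenDeriv hx₁.ne' h2.ne', abs_neg, abs_of_pos (by positivity)]
  have e5 : (1 - (straighten x₁ x₂ p).1 : ℂ) =
      ((p.1 / x₁ * |1 - x₁ / p.1 - x₂ / p.2| : ℝ) : ℂ) := by
    rw [← e3]; push_cast; rfl
  have e6 : (1 - (straighten x₁ x₂ p).2 : ℂ) = ((|1 - p.1 - p.2| / p.2 : ℝ) : ℂ) := by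
    rw [← e4]; push_cast; rfl
  have e7 : (1 - ((x₂ / p.2 : ℝ) : ℂ)) = ((1 - x₂ / p.2 : ℝ) : ℂ) := by push_cast; rfl
  have e8 : (1 - (p.1 : ℂ)) = ((1 - p.1 : ℝ) : ℂ) := by push_cast; rfl
  have e9 : (1 - (p.1 : ℂ)) - ((x₂ / p.2 : ℝ) : ℂ) = ((1 - p.1 - x₂ / p.2 : ℝ) : ℂ) := by
    push_cast; rfl
  have e10 : (1 - p.1 - x₂ / p.2) / (x₁ * p.2 ^ 2) = (1 - p.1 - x₂ / p.2) *
      Real.exp (-Real.log x₁ - 2 * Real.log p.2) := by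
    rw [Real.exp_sub, Real.exp_neg, Real.exp_log hx₁, two_mul, Real.exp_add, Real.exp_log h2]
    field_simp
  rw [e5, e6, e7, e9, e8, e10, LoadedCell.pullback, chamberCell_jac, mul_one]
  simp only [chamberCell, straighten]
  rw [ofReal_cpow_eq_exp hx₁, ofReal_cpow_eq_exp (by positivity), ofReal_cpow_eq_exp (by positivity),
    ofReal_cpow_eq_exp (div_pos hX1 h2), ofReal_cpow_eq_exp (by positivity), ofReal_cpow_eq_exp hX1,
    ofReal_cpow_eq_exp hY1, Real.log_mul (by positivity) hY1.ne', Real.log_div h1.ne' hx₁.ne',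
    Real.log_mul (by positivity) hM'.ne', Real.log_div h1.ne' hx₁.ne', Real.log_div hX1.ne' h2.ne',
    Real.log_div hL'.ne' h2.ne', real_smul, ofReal_mul, ofReal_exp]
  -- J = 1 - X - Y, the only factor not written as an exponential, is cancelled first; the rest is a
  -- comparison of exponents.
  have key : ∀ E J u v w x y z K : ℂ, J ≠ 0 → E = K * u * (v * (w * x * (y * z))) →
      E = K * (J * u * ((w * x * (y * z)) * (v / J))) := by
    intro E J u v w x y z K hJ h
    rw [h]; field_simp
  refine (key _ _ _ _ _ _ _ _ _ hJ0 ?_)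
  simp only [← exp_add]
  rw [exp_eq_exp_iff_exists_int]
  -- Arguments -π of L and M give the exponent -πi(c₁+c₂-a-2-b), which is -πi(c₁+c₂-a-b) plus one
  -- full period 2πi.
  refine ⟨1, ?_⟩
  push_cast
  ring

theorem Delta₂_integral {a b c₁ c₂ : ℂ} (h₁ : 0 < (b - c₁ + 1).re) (h₂ : 0 < (c₁ + c₂ - a - 1).re)
    (h₃ : 0 < (1 - b).re) (h₄ : 0 < (a - c₁ + 1).re)
    (hx₁ : 0 < x₁) (hx₂ : 0 < x₂) (hx : √x₁ + √x₂ < 1) :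
    (Delta₂ x₁ x₂).Converges a b c₁ c₂ ∧
      (Delta₂ x₁ x₂).integral a b c₁ c₂ =
        Gamma (a + 1 - c₁) * Gamma (b + 1 - c₁) * Gamma (1 - b) * Gamma (c₁ + c₂ - a - 1) /
            (Gamma (2 - c₁) * Gamma c₂) *
          exp (-(Real.pi * I * (c₁ + c₂ - a - b))) * (x₁ : ℂ) ^ (1 - c₁) *
          F4 (a + 1 - c₁) (b + 1 - c₁) (2 - c₁) c₂ ((x₁ : ℂ), (x₂ : ℂ)) := by
  have hA : 0 < (a + 1 - c₁).re := by simp at h₄ ⊢; linarith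
  have hB : 0 < (b + 1 - c₁).re := by simp at h₁ ⊢; linarith
  obtain ⟨hi, hv⟩ := integral_beta_mul_F4 hA hB h₂ h₃ hx₁ hx₂ hx
  rw [← image_straighten hx₁ hx₂ hx] at hi hv
  have hm := measurableSet_chamber x₁ x₂
  have hd : ∀ p ∈ chamber x₁ x₂, HasFDerivWithinAt (straighten x₁ x₂) (straightenDeriv x₁ x₂ p)
      (chamber x₁ x₂) p := fun p hp =>
    (hasFDerivAt_straighten x₁ x₂ hp.1.2.1.ne').hasFDerivWithinAt
  have hj := injOn_straighten hx₁ hx₂ hx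
  rw [integrableOn_image_iff_integrableOn_abs_det_fderiv_smul volume hm hd hj] at hi
  rw [integral_image_eq_integral_abs_det_fderiv_smul volume hm hd hj] at hv
  have hpb := fun p (hp : p ∈ chamber x₁ x₂) =>
    pullback_chamberCell (a := a) (b := b) (c₁ := c₁) (c₂ := c₂) hA hB hx₁ hx₂ hx (chamber x₁ x₂) hp
  constructor
  · simp only [TwistedChain.Converges, Delta₂, List.mem_singleton, forall_eq]
    exact IntegrableOn.congr_fun (hi.const_mul _) (fun p hp => (hpb p hp).symm) hm
  · simp only [TwistedChain.integral, Delta₂, List.map_cons, List.map_nil, List.sum_cons,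
      List.sum_nil, add_zero, one_mul]
    have h5 := setIntegral_congr_fun (μ := volume) hm hpb
    refine h5.trans ?_
    rw [integral_const_mul, hv, betaIntegral_eq_Gamma_mul_div _ _ hB h₃,
      betaIntegral_eq_Gamma_mul_div _ _ hA h₂]
    have e1 : b + 1 - c₁ + (1 - b) = 2 - c₁ := by ring
    have e2 : a + 1 - c₁ + (c₁ + c₂ - a - 1) = c₂ := by ring
    rw [e1, e2]
    ring

end AppellF4

namespace AppellF4

/-! ### The third integral by symmetry -/

theorem pullback_chamberCell_swap (a b c₁ c₂ : ℂ) (x₁ x₂ : ℝ) (D D' : Set (ℝ × ℝ)) (p : ℝ × ℝ) :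
    (chamberCell x₁ x₂ D).pullback a b c₁ c₂ p =
      (chamberCell x₂ x₁ D').pullback a b c₂ c₁ p.swap := by
  rw [LoadedCell.pullback, LoadedCell.pullback, chamberCell_jac, chamberCell_jac]
  simp only [chamberCell, Prod.fst_swap, Prod.snd_swap]
  rw [sub_right_comm 1 p.2 p.1, sub_right_comm 1 (x₂ / p.2) (x₁ / p.1)]
  congr 2
  ring

/-- The coordinate swap produces no sign, since both chambers carry the standard orientation of the
plane. -/
theorem Delta₃_eq_swap (a b c₁ c₂ : ℂ) (x₁ x₂ : ℝ) :
    ((Delta₃ x₁ x₂).Converges a b c₁ c₂ ↔ (Delta₂ x₂ x₁).Converges a b c₂ c₁) ∧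
      (Delta₃ x₁ x₂).integral a b c₁ c₂ = (Delta₂ x₂ x₁).integral a b c₂ c₁ := by
  have hd : outerRegion x₁ x₂ ∩ {p | √x₁ * p.2 < √x₂ * p.1} = Prod.swap ⁻¹' chamber x₂ x₁ := by
    ext p
    simp only [outerRegion, chamber, Set.mem_inter_iff, Set.mem_ofPred_eq, Set.mem_preimage,
      Prod.fst_swap, Prod.snd_swap, sub_right_comm 1 p.2 p.1,
      sub_right_comm 1 (x₂ / p.2) (x₁ / p.1)]
    tauto
  have hmp : MeasurePreserving (Prod.swap : ℝ × ℝ → ℝ × ℝ) volume volume :=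
    Measure.measurePreserving_swap
  have hme : MeasurableEmbedding (Prod.swap : ℝ × ℝ → ℝ × ℝ) :=
    MeasurableEquiv.prodComm.measurableEmbedding
  have hp := fun p => pullback_chamberCell_swap a b c₁ c₂ x₁ x₂
    (outerRegion x₁ x₂ ∩ {p | √x₁ * p.2 < √x₂ * p.1}) (chamber x₂ x₁) p
  have hf : (chamberCell x₁ x₂
      (outerRegion x₁ x₂ ∩ {p | √x₁ * p.2 < √x₂ * p.1})).pullback a b c₁ c₂ =
      (chamberCell x₂ x₁ (chamber x₂ x₁)).pullback a b c₂ c₁ ∘ Prod.swap := funext hp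
  constructor
  · simp only [TwistedChain.Converges, Delta₂, Delta₃, List.mem_singleton, forall_eq]
    rw [hf]
    show IntegrableOn _ (outerRegion x₁ x₂ ∩ {p | √x₁ * p.2 < √x₂ * p.1}) ↔ _
    rw [hd]
    exact hmp.integrableOn_comp_preimage hme
  · simp only [TwistedChain.integral, Delta₂, Delta₃, List.map_cons, List.map_nil]
    rw [hf]
    congr 3
    show ∫ p in outerRegion x₁ x₂ ∩ {p | √x₁ * p.2 < √x₂ * p.1}, _ = _
    rw [hd]
    exact hmp.setIntegral_preimage_emb hme _ _

theorem Delta₃_integral {a b c₁ c₂ : ℂ} {x₁ x₂ : ℝ} (h₁ : 0 < (b - c₂ + 1).re)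
    (h₂ : 0 < (c₁ + c₂ - a - 1).re) (h₃ : 0 < (1 - b).re) (h₄ : 0 < (a - c₂ + 1).re)
    (hx₁ : 0 < x₁) (hx₂ : 0 < x₂) (hx : √x₁ + √x₂ < 1) :
    (Delta₃ x₁ x₂).Converges a b c₁ c₂ ∧
      (Delta₃ x₁ x₂).integral a b c₁ c₂ =
        Gamma (a + 1 - c₂) * Gamma (b + 1 - c₂) * Gamma (1 - b) * Gamma (c₁ + c₂ - a - 1) /
            (Gamma c₁ * Gamma (2 - c₂)) *
          exp (-(Real.pi * I * (c₁ + c₂ - a - b))) * (x₂ : ℂ) ^ (1 - c₂) *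
          F4 (a + 1 - c₂) (b + 1 - c₂) c₁ (2 - c₂) ((x₁ : ℂ), (x₂ : ℂ)) := by
  obtain ⟨e1, e2⟩ := Delta₃_eq_swap a b c₁ c₂ x₁ x₂
  obtain ⟨d1, d2⟩ := Delta₂_integral (c₁ := c₂) (c₂ := c₁) h₁ (by rwa [add_comm c₂ c₁]) h₃ h₄ hx₂ hx₁
    (by rwa [add_comm])
  refine ⟨e1.2 d1, ?_⟩
  rw [e2, d2, F4_swap _ _ c₁, add_comm c₂ c₁, mul_comm (Gamma c₁)]
  rfl

/-! ### Holomorphic continuation -/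

theorem frequently_ofReal_of_eventually {x : ℝ} {P : ℂ → Prop} (h : ∀ᶠ y : ℝ in 𝓝 x, P y) :
    ∃ᶠ z in 𝓝[≠] (x : ℂ), P z := by
  have ht : Tendsto (fun y : ℝ => (y : ℂ)) (𝓝[≠] x) (𝓝[≠] (x : ℂ)) :=
    tendsto_nhdsWithin_of_tendsto_nhds_of_eventually_within _
      (continuous_ofReal.continuousAt.mono_left nhdsWithin_le_nhds)
      (eventually_nhdsWithin_of_forall fun y hy => by simpa using hy)
  exact ht.frequently (h.filter_mono nhdsWithin_le_nhds).frequently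

/-- A holomorphic function on a connected open set of `ℂ²` which vanishes at the real points near
a real point is zero. -/
theorem eqOn_zero_of_eventually_real {U : Set (ℂ × ℂ)} (hUo : IsOpen U) (hUc : IsPreconnected U)
    {x₀ : ℝ × ℝ} (hx₀ : ((x₀.1 : ℂ), (x₀.2 : ℂ)) ∈ U) {h : ℂ × ℂ → ℂ} (hh : DifferentiableOn ℂ h U)
    (h0 : ∀ᶠ y : ℝ × ℝ in 𝓝 x₀, h ((y.1 : ℂ), (y.2 : ℂ)) = 0) : ∀ x ∈ U, h x = 0 := by
  have hloc : ∀ᶠ z in 𝓝 ((x₀.1 : ℂ), (x₀.2 : ℂ)), h z = 0 := by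
    obtain ⟨r, hr, hU⟩ := Metric.isOpen_iff.1 hUo _ hx₀
    obtain ⟨s, hs, hz⟩ := Metric.eventually_nhds_iff.1 h0
    set δ := min r s
    have hδ : 0 < δ := lt_min hr hs
    have hmem : ∀ z w : ℂ, z ∈ Metric.ball (x₀.1 : ℂ) δ → w ∈ Metric.ball (x₀.2 : ℂ) δ →
        (z, w) ∈ U := fun z w hz hw => hU (by
      rw [Metric.mem_ball, Prod.dist_eq]
      exact max_lt (lt_of_lt_of_le hz (min_le_left _ _)) (lt_of_lt_of_le hw (min_le_left _ _)))
    -- The one-variable identity theorem is applied twice: in the second coordinate over a real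
    -- first one, then in the first coordinate over an arbitrary second one.
    have step1 : ∀ y : ℝ, dist y x₀.1 < δ → ∀ w ∈ Metric.ball (x₀.2 : ℂ) δ, h (y, w) = 0 := by
      intro y hy
      have hy' : (y : ℂ) ∈ Metric.ball (x₀.1 : ℂ) δ := by
        rw [Metric.mem_ball, Complex.dist_eq, ← ofReal_sub, norm_real]; exact hy
      have hd : DifferentiableOn ℂ (fun w : ℂ => h (y, w)) (Metric.ball (x₀.2 : ℂ) δ) :=
        hh.comp (by fun_prop) fun w hw => hmem _ _ hy' hw
      refine (hd.analyticOnNhd Metric.isOpen_ball).eqOn_zero_of_preconnected_of_frequently_eq_zero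
        (convex_ball _ _).isPreconnected (Metric.mem_ball_self hδ)
        (frequently_ofReal_of_eventually ?_)
      filter_upwards [Metric.ball_mem_nhds x₀.2 hδ] with w hw
      refine hz (y := (y, w)) ?_
      rw [Prod.dist_eq]
      exact max_lt (lt_of_lt_of_le hy (min_le_right _ _)) (lt_of_lt_of_le hw (min_le_right _ _))
    refine Metric.eventually_nhds_iff.2 ⟨δ, hδ, fun z hz' => ?_⟩
    rw [Prod.dist_eq, max_lt_iff] at hz'
    have hd : DifferentiableOn ℂ (fun w : ℂ => h (w, z.2)) (Metric.ball (x₀.1 : ℂ) δ) :=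
      hh.comp (by fun_prop) fun w hw => hmem _ _ hw hz'.2
    refine (hd.analyticOnNhd Metric.isOpen_ball).eqOn_zero_of_preconnected_of_frequently_eq_zero
      (convex_ball _ _).isPreconnected (Metric.mem_ball_self hδ)
      (frequently_ofReal_of_eventually ?_) hz'.1
    filter_upwards [Metric.ball_mem_nhds x₀.1 hδ] with y hy
    exact step1 y hy _ hz'.2
  -- The set where h vanishes locally is open. It is closed in U: in a ball of U every z lies on a
  -- complex line through a point y near which h vanishes, and the line meets the ball in a convex
  -- set.
  have hsub : U ⊆ {x | ∀ᶠ z in 𝓝 x, h z = 0} := by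
    refine hUc.subset_of_closure_inter_subset isOpen_setOfPred_eventually_nhds ⟨_, hx₀, hloc⟩ ?_
    rintro x ⟨hxc, hxU⟩
    obtain ⟨r, hr, hU⟩ := Metric.isOpen_iff.1 hUo _ hxU
    obtain ⟨y, hy, hxy⟩ := Metric.mem_closure_iff.1 hxc r hr
    refine Metric.eventually_nhds_iff.2 ⟨r, hr, fun z hz => ?_⟩
    let γ : ℂ → ℂ × ℂ := fun s => y + s • (z - y)
    have hγ0 : γ 0 = y := by simp [γ]
    have hγ1 : γ 1 = z := by simp [γ]
    have hγd : Differentiable ℂ γ := by fun_prop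
    have hconv : Convex ℝ (γ ⁻¹' Metric.ball x r) := by
      have e : γ ⁻¹' Metric.ball x r =
          ((LinearMap.toSpanSingleton ℂ (ℂ × ℂ) (z - y)).restrictScalars ℝ) ⁻¹'
            Metric.ball (x - y) r := by
        ext s
        simp [γ, dist_eq_norm, sub_sub_eq_add_sub, add_comm]
      rw [e]
      exact (convex_ball (x - y) r).linear_preimage _
    have hd : DifferentiableOn ℂ (h ∘ γ) (γ ⁻¹' Metric.ball x r) :=
      hh.comp hγd.differentiableOn fun s hs => hU hs
    have h00 : (0 : ℂ) ∈ γ ⁻¹' Metric.ball x r := by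
      rw [Set.mem_preimage, hγ0, Metric.mem_ball, dist_comm]
      exact hxy
    have hev : ∀ᶠ s in 𝓝 (0 : ℂ), (h ∘ γ) s = 0 := by
      have ht : Tendsto γ (𝓝 0) (𝓝 y) := by
        have := hγd.continuous.tendsto 0
        rwa [hγ0] at this
      exact ht.eventually hy
    have hz1 := (hd.analyticOnNhd (Metric.isOpen_ball.preimage hγd.continuous)
      ).eqOn_zero_of_preconnected_of_frequently_eq_zero hconv.isPreconnected h00
      (hev.filter_mono nhdsWithin_le_nhds).frequently (x := 1)
      (by rw [Set.mem_preimage, hγ1]; exact hz)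
    simpa [hγ1] using hz1
  exact fun x hx => (hsub hx).self_of_nhds

/-- By continuity nearby values of l differ by less than π in imaginary part, so their difference is
the principal logarithm of the quotient. Both holomorphy of l and its reality at real points near x₀
follow from this. -/
theorem IsLogBranch.eventually_eq {U : Set (ℂ × ℂ)} (hUo : IsOpen U) {x₀ : ℂ × ℂ} {l₀ : ℝ}
    {ξ l : ℂ × ℂ → ℂ} (hl : IsLogBranch U x₀ l₀ ξ l) {x : ℂ × ℂ} (hx : x ∈ U) :
    ∀ᶠ y in 𝓝 x, l y = l x + log (ξ y / ξ x) := by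
  have hc : ContinuousAt l x := hl.cont.continuousAt (hUo.mem_nhds hx)
  have h1 := hc.eventually (Metric.ball_mem_nhds (l x) Real.pi_pos)
  filter_upwards [h1, hUo.mem_nhds hx] with y hy hyU
  have h2 : |(l y - l x).im| < Real.pi :=
    (abs_im_le_norm _).trans_lt (by simpa [Complex.dist_eq] using hy)
  rw [← hl.exp_eq y hyU, ← hl.exp_eq x hx, ← exp_sub, log_exp (abs_lt.1 h2).1 (abs_lt.1 h2).2.le]
  ring

theorem IsLogBranch.differentiableOn {U : Set (ℂ × ℂ)} (hUo : IsOpen U) {x₀ : ℂ × ℂ} {l₀ : ℝ}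
    {ξ l : ℂ × ℂ → ℂ} (hl : IsLogBranch U x₀ l₀ ξ l) (hξ : Differentiable ℂ ξ) :
    DifferentiableOn ℂ l U := by
  intro x hx
  have hξx : ξ x ≠ 0 := by rw [← hl.exp_eq x hx]; exact exp_ne_zero _
  have h1 : DifferentiableAt ℂ (fun y => l x + log (ξ y / ξ x)) x :=
    (differentiableAt_const _).add
      ((differentiableAt_log (by rw [div_self hξx]; exact one_mem_slitPlane)).comp x
        ((hξ x).mul_const (ξ x)⁻¹))
  exact (h1.congr_of_eventuallyEq (hl.eventually_eq hUo hx)).differentiableWithinAt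

theorem IsLogBranch.eventually_real {U : Set (ℂ × ℂ)} (hUo : IsOpen U) {x₀ : ℝ × ℝ} {r : ℝ × ℝ → ℝ}
    {ξ l : ℂ × ℂ → ℂ} (hx₀ : ((x₀.1 : ℂ), (x₀.2 : ℂ)) ∈ U)
    (hl : IsLogBranch U ((x₀.1 : ℂ), (x₀.2 : ℂ)) (Real.log (r x₀)) ξ l) (hr : Continuous r)
    (hr0 : 0 < r x₀) (hξ : ∀ y : ℝ × ℝ, ξ ((y.1 : ℂ), (y.2 : ℂ)) = r y) :
    ∀ᶠ y : ℝ × ℝ in 𝓝 x₀, l ((y.1 : ℂ), (y.2 : ℂ)) = Real.log (r y) := by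
  have hc : Continuous fun y : ℝ × ℝ => ((y.1 : ℂ), (y.2 : ℂ)) := by fun_prop
  have h1 := (hc.tendsto x₀).eventually (hl.eventually_eq hUo hx₀)
  filter_upwards [h1, hr.continuousAt.eventually (lt_mem_nhds hr0)] with y hy hry
  rw [hy, hl.base, hξ, hξ, ← ofReal_div, ← ofReal_log (div_pos hry hr0).le,
    Real.log_div hry.ne' hr0.ne']
  push_cast
  ring

theorem isContinuation_iff_eqOn {J : ℝ → ℝ → ℂ} {U : Set (ℂ × ℂ)} (hUo : IsOpen U)
    (hUc : IsPreconnected U) {x₀ : ℝ × ℝ} (hx₀ : ((x₀.1 : ℂ), (x₀.2 : ℂ)) ∈ U) {g : ℂ × ℂ → ℂ}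
    (hg : DifferentiableOn ℂ g U)
    (hgJ : ∀ᶠ y : ℝ × ℝ in 𝓝 x₀, g ((y.1 : ℂ), (y.2 : ℂ)) = J y.1 y.2) :
    (∃ f, IsContinuation J U x₀ f) ∧ ∀ f, IsContinuation J U x₀ f → ∀ x ∈ U, f x = g x := by
  refine ⟨⟨g, hg, hgJ⟩, fun f hf x hx => ?_⟩
  refine sub_eq_zero.1 (eqOn_zero_of_eventually_real hUo hUc hx₀ (h := fun x => f x - g x)
    (hf.holo.sub hg) ?_ x hx)
  filter_upwards [hf.eq_near, hgJ] with y h1 h2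
  rw [h1, h2, sub_self]

theorem eventually_real_mem_domain {U : Set (ℂ × ℂ)} (hUo : IsOpen U) (hUD : U ⊆ convDomain)
    {x₀ : ℝ × ℝ} (hx₀₁ : 0 < x₀.1) (hx₀₂ : 0 < x₀.2) (hx₀ : ((x₀.1 : ℂ), (x₀.2 : ℂ)) ∈ U) :
    ∀ᶠ y : ℝ × ℝ in 𝓝 x₀, 0 < y.1 ∧ 0 < y.2 ∧ √y.1 + √y.2 < 1 := by
  have hc : Continuous fun y : ℝ × ℝ => ((y.1 : ℂ), (y.2 : ℂ)) := by fun_prop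
  filter_upwards [(hc.tendsto x₀).eventually (hUo.mem_nhds hx₀),
    continuous_fst.continuousAt.eventually (lt_mem_nhds hx₀₁),
    continuous_snd.continuousAt.eventually (lt_mem_nhds hx₀₂)] with y h1 h2 h3
  refine ⟨h2, h3, ?_⟩
  simpa [convDomain, abs_of_pos h2, abs_of_pos h3] using hUD h1

end AppellF4

/-! ### Contraction of loaded circles, tubes and tori -/

namespace AppellF4

theorem continuous_circ (ε : ℝ) : Continuous (circ ε) := by unfold circ; fun_prop

theorem continuous_logCirc (ε : ℝ) : Continuous (logCirc ε) := by unfold logCirc; fun_prop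

theorem norm_circ {ε : ℝ} (hε : 0 < ε) (θ : ℝ) : ‖circ ε θ‖ = ε := by
  rw [circ, norm_mul, norm_exp_ofReal_mul_I, mul_one, norm_real, Real.norm_of_nonneg hε.le]

theorem exp_logCirc {ε : ℝ} (hε : 0 < ε) (θ : ℝ) : exp (logCirc ε θ) = circ ε θ := by
  rw [logCirc, exp_add, ← ofReal_exp, Real.exp_log hε, circ]

theorem eq_of_forall_norm_sub_le {z w : ℂ} {K δ₀ : ℝ} (hδ₀ : 0 < δ₀)
    (h : ∀ δ, 0 < δ → δ < δ₀ → ‖z - w‖ ≤ K * δ) : z = w := by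
  have ht : Tendsto (fun δ : ℝ => K * δ) (𝓝[>] 0) (𝓝 0) := by
    have : Tendsto (fun δ : ℝ => K * δ) (𝓝 0) (𝓝 (K * 0)) := by
      exact (continuous_const.mul continuous_id).tendsto 0
    rw [mul_zero] at this
    exact this.mono_left nhdsWithin_le_nhds
  have h1 : ‖z - w‖ ≤ 0 := by
    refine ge_of_tendsto ht ?_
    filter_upwards [Ioo_mem_nhdsGT hδ₀] with δ hδ
    exact h δ hδ.1 hδ.2
  exact sub_eq_zero.1 (norm_le_zero_iff.1 h1)

/-- Contracting a loaded circle to the origin. -/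
theorem integral_circ_eq {P : ℂ} (hP : 1 < P.re) {ε : ℝ} (hε : 0 < ε) {g : ℂ → ℂ}
    (hg : ∀ s, ‖s‖ ≤ ε → DifferentiableAt ℂ g s) :
    ∫ θ in (0 : ℝ)..2 * Real.pi, exp (P * logCirc ε θ) * (I * g (circ ε θ)) =
      (e2pi P - 1) * ∫ s in (0 : ℝ)..ε, (s : ℂ) ^ (P - 1) * g s := by
  have hgc : ContinuousOn g (Metric.closedBall 0 ε) := fun s hs =>
    (hg s (by simpa using hs)).continuousAt.continuousWithinAt
  obtain ⟨C, hC⟩ := (isCompact_closedBall (0 : ℂ) ε).exists_bound_of_continuousOn hgc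
  have hC' : ∀ s : ℂ, ‖s‖ ≤ ε → ‖g s‖ ≤ C := fun s hs => hC s (by simpa using hs)
  have hC0 : 0 ≤ C := (norm_nonneg _).trans (hC' 0 (by simpa using hε.le))
  let φ : ℝ → ℂ := fun s => (s : ℂ) ^ (P - 1) * g s
  have hφc : ContinuousOn φ (Set.Icc 0 ε) := by
    refine ContinuousOn.mul ?_ (hgc.comp (by fun_prop) fun s hs => ?_)
    · exact (continuous_ofReal_cpow_const (by simp; linarith)).continuousOn
    · simpa [abs_of_nonneg hs.1] using hs.2
  have hφi : ∀ {s t : ℝ}, 0 ≤ s → s ≤ ε → 0 ≤ t → t ≤ ε → IntervalIntegrable φ volume s t :=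
    fun h1 h2 h3 h4 => (hφc.mono (Set.uIcc_subset_Icc ⟨h1, h2⟩ ⟨h3, h4⟩)).intervalIntegrable
  -- Under w = log s the slit annulus δ ≤ |s| ≤ ε becomes a rectangle of height 2π and s^{P-1} g(s)
  -- ds becomes f(w) dw; f on the top side is e2pi P times f on the bottom side.
  let f : ℂ → ℂ := fun w => exp (P * w) * g (exp w)
  set E := Real.exp (2 * Real.pi * |P.im|)
  -- The two summands of K bound the inner circle of radius δ and the missing segment [0, δ]; both
  -- are O(δ) since δ < 1 < Re P. The constant E bounds the growth of s^P caused by Im P along the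
  -- circle.
  refine eq_of_forall_norm_sub_le (δ₀ := min ε 1) (K := E * C * (2 * Real.pi) + ‖e2pi P - 1‖ * C)
    (lt_min hε one_pos) fun δ hδ hδε => ?_
  have hδ1 : δ < 1 := hδε.trans_le (min_le_right _ _)
  have hδε : δ < ε := hδε.trans_le (min_le_left _ _)
  have hlog : Real.log δ ≤ Real.log ε := Real.log_le_log hδ hδε.le
  have hrect := integral_boundary_rect_eq_zero_of_differentiableOn f (Real.log δ : ℂ)
    (Real.log ε + (2 * Real.pi : ℝ) * I) ?_
  · have r1 : ((Real.log δ : ℂ)).re = Real.log δ := ofReal_re _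
    have r2 : ((Real.log δ : ℂ)).im = 0 := ofReal_im _
    have r3 : ((Real.log ε : ℂ) + (2 * Real.pi : ℝ) * I).re = Real.log ε := by simp
    have r4 : ((Real.log ε : ℂ) + (2 * Real.pi : ℝ) * I).im = 2 * Real.pi := by simp
    rw [r1, r2, r3, r4] at hrect
    have h2pi : ∀ x : ℝ, f (x + (2 * Real.pi : ℝ) * I) = e2pi P * f (x + (0 : ℝ) * I) := by
      intro x
      have : exp ((x : ℂ) + (2 * Real.pi : ℝ) * I) = exp x := by
        push_cast
        exact exp_periodic x
      simp only [f, this, e2pi, ofReal_zero, zero_mul, add_zero]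
      rw [← mul_assoc, ← exp_add]
      congr 2
      push_cast
      ring
    simp only [h2pi, intervalIntegral.integral_const_mul] at hrect
    have hsub : ∫ x in Real.log δ..Real.log ε, f (x + (0 : ℝ) * I) = ∫ s in δ..ε, φ s := by
      have h := intervalIntegral.integral_deriv_smul_comp'' (a := δ) (b := ε) (f := Real.log)
        (f' := fun s => s⁻¹) (g := fun x : ℝ => f (x + (0 : ℝ) * I)) ?_ ?_ ?_ ?_
      · rw [← h]
        refine intervalIntegral.integral_congr fun s hs => ?_
        rw [Set.uIcc_of_le hδε.le] at hs
        have hs0 : 0 < s := hδ.trans_le hs.1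
        have hs1 : (s : ℂ) ≠ 0 := ofReal_ne_zero.2 hs0.ne'
        simp only [f, φ, Function.comp, ofReal_zero, zero_mul, add_zero]
        rw [← ofReal_exp, Real.exp_log hs0, cpow_sub _ _ hs1, cpow_one, ofReal_cpow_eq_exp hs0,
          real_smul, ofReal_inv, mul_comm P]
        ring
      · rw [Set.uIcc_of_le hδε.le]
        exact fun s hs => (Real.continuousAt_log (hδ.trans_le hs.1).ne').continuousWithinAt
      · rw [min_eq_left hδε.le, max_eq_right hδε.le]
        exact fun s hs => (Real.hasDerivAt_log (hδ.trans hs.1).ne').hasDerivWithinAt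
      · rw [Set.uIcc_of_le hδε.le]
        exact fun s hs => (continuousAt_inv₀ (hδ.trans_le hs.1).ne').continuousWithinAt
      · rw [Set.uIcc_of_le hδε.le]
        rintro _ ⟨s, hs, rfl⟩
        have hs0 : 0 < s := hδ.trans_le hs.1
        have h1 : DifferentiableAt ℂ f (((Real.log s : ℝ) : ℂ) + (0 : ℝ) * I) := by
          have := hg (exp (((Real.log s : ℝ) : ℂ) + (0 : ℝ) * I)) (by
            rw [ofReal_zero, zero_mul, add_zero, ← ofReal_exp, Real.exp_log hs0, norm_real,
              Real.norm_of_nonneg hs0.le]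
            exact hs.2)
          exact DifferentiableAt.mul (by fun_prop) (this.comp _ (by fun_prop))
        exact (ContinuousAt.comp (f := fun x : ℝ => (x : ℂ) + (0 : ℝ) * I) h1.continuousAt
          (by fun_prop)).continuousWithinAt
    rw [hsub] at hrect
    have hcirc : I • ∫ y in (0 : ℝ)..2 * Real.pi, f (Real.log ε + y * I) =
        ∫ θ in (0 : ℝ)..2 * Real.pi, exp (P * logCirc ε θ) * (I * g (circ ε θ)) := by
      rw [smul_eq_mul, ← intervalIntegral.integral_const_mul]
      refine intervalIntegral.integral_congr fun θ _ => ?_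
      show I * (exp (P * logCirc ε θ) * g (exp (logCirc ε θ))) = _
      rw [exp_logCirc hε]
      ring
    rw [hcirc] at hrect
    have hadd : ∫ s in δ..ε, φ s = (∫ s in (0 : ℝ)..ε, φ s) - ∫ s in (0 : ℝ)..δ, φ s := by
      rw [eq_sub_iff_add_eq', intervalIntegral.integral_add_adjacent_intervals
        (hφi le_rfl hε.le hδ.le hδε.le) (hφi hδ.le hδε.le hε.le le_rfl)]
    rw [hadd] at hrect
    have hEq : (∫ θ in (0 : ℝ)..2 * Real.pi, exp (P * logCirc ε θ) * (I * g (circ ε θ))) -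
        (e2pi P - 1) * ∫ s in (0 : ℝ)..ε, (s : ℂ) ^ (P - 1) * g s =
        I • (∫ y in (0 : ℝ)..2 * Real.pi, f (Real.log δ + y * I)) -
          (e2pi P - 1) * ∫ s in (0 : ℝ)..δ, φ s := by
      linear_combination hrect
    rw [hEq]
    have b1 : ‖∫ y in (0 : ℝ)..2 * Real.pi, f (Real.log δ + y * I)‖ ≤
        E * δ * C * |2 * Real.pi - 0| := by
      refine intervalIntegral.norm_integral_le_of_norm_le_const fun y hy => ?_
      rw [Set.uIoc_of_le Real.two_pi_pos.le] at hy
      simp only [f]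
      rw [norm_mul]
      have hexp : exp ((Real.log δ : ℂ) + y * I) = circ δ y := exp_logCirc hδ y
      rw [hexp]
      refine mul_le_mul ?_ (hC' _ (by rw [norm_circ hδ]; exact hδε.le)) (norm_nonneg _)
        (by positivity)
      rw [norm_exp, ← Real.exp_log hδ, ← Real.exp_add]
      refine Real.exp_le_exp.2 ?_
      rw [Real.exp_log hδ]
      have i1 : (P * ((Real.log δ : ℂ) + y * I)).re = P.re * Real.log δ - P.im * y := by
        simp [mul_re]
      rw [i1]
      have i2 : Real.log δ ≤ 0 := Real.log_nonpos hδ.le hδ1.le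
      have i3 : -(P.im * y) ≤ 2 * Real.pi * |P.im| := by
        calc -(P.im * y) ≤ |P.im * y| := neg_le_abs _
          _ = |P.im| * y := by rw [abs_mul, abs_of_pos hy.1]
          _ ≤ |P.im| * (2 * Real.pi) := by gcongr; exact hy.2
          _ = _ := by ring
      nlinarith
    have b2 : ‖∫ s in (0 : ℝ)..δ, φ s‖ ≤ C * |δ - 0| := by
      refine intervalIntegral.norm_integral_le_of_norm_le_const fun s hs => ?_
      rw [Set.uIoc_of_le hδ.le] at hs
      simp only [φ]
      rw [norm_mul, norm_cpow_eq_rpow_re_of_pos hs.1]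
      have i1 : s ^ (P - 1).re ≤ 1 := Real.rpow_le_one hs.1.le (hs.2.trans hδ1.le)
        (by simp; linarith)
      have i2 : ‖g s‖ ≤ C := hC' _ (by
        rw [norm_real, Real.norm_of_nonneg hs.1.le]; exact hs.2.trans hδε.le)
      calc _ ≤ 1 * C := mul_le_mul i1 i2 (norm_nonneg _) zero_le_one
        _ = C := one_mul C
    rw [sub_zero, abs_of_pos (by positivity)] at b1 b2
    calc _ ≤ ‖I • ∫ y in (0 : ℝ)..2 * Real.pi, f (Real.log δ + y * I)‖ +
          ‖(e2pi P - 1) * ∫ s in (0 : ℝ)..δ, φ s‖ := norm_sub_le _ _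
      _ ≤ E * δ * C * (2 * Real.pi) + ‖e2pi P - 1‖ * (C * δ) := by
        rw [norm_smul, norm_I, one_mul, norm_mul]
        gcongr
      _ = _ := by ring
  · intro w hw
    have hre : w.re ≤ Real.log ε := by
      have h1 := hw.1
      simp only [Set.mem_preimage] at h1
      simp only [ofReal_re, add_re, mul_re, I_re, mul_zero, ofReal_im, I_im, mul_one, sub_self,
        add_zero] at h1
      rw [Set.uIcc_of_le hlog] at h1
      exact h1.2
    have h2 := hg (exp w) (by
      rw [norm_exp, ← Real.exp_log hε]
      exact Real.exp_le_exp.2 hre)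
    exact (DifferentiableAt.mul (by fun_prop) (h2.comp _ (by fun_prop))).differentiableWithinAt

theorem setIntegral_Icc_prod {F : ℝ × ℝ → ℂ} {a b c d : ℝ} (hab : a ≤ b) (hcd : c ≤ d)
    (hF : ContinuousOn F (Set.Icc a b ×ˢ Set.Icc c d)) :
    ∫ p in Set.Icc a b ×ˢ Set.Icc c d, F p = ∫ x in a..b, ∫ y in c..d, F (x, y) := by
  have hi : IntegrableOn F (Set.Icc a b ×ˢ Set.Icc c d) :=
    hF.integrableOn_compact (isCompact_Icc.prod isCompact_Icc)
  rw [Measure.volume_eq_prod] at hi ⊢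
  rw [setIntegral_prod _ hi, intervalIntegral.integral_of_le hab, integral_Icc_eq_integral_Ioc]
  simp only [intervalIntegral.integral_of_le hcd, integral_Icc_eq_integral_Ioc]

theorem intervalIntegral_swap {F : ℝ × ℝ → ℂ} {a b c d : ℝ} (hab : a ≤ b) (hcd : c ≤ d)
    (hF : ContinuousOn F (Set.Icc a b ×ˢ Set.Icc c d)) :
    ∫ x in a..b, ∫ y in c..d, F (x, y) = ∫ y in c..d, ∫ x in a..b, F (x, y) := by
  have hsw : ContinuousOn (F ∘ Prod.swap) (Set.Icc c d ×ˢ Set.Icc a b) :=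
    hF.comp continuous_swap.continuousOn fun p hp => ⟨hp.2, hp.1⟩
  rw [← setIntegral_Icc_prod hab hcd hF]
  have h := setIntegral_Icc_prod hcd hab hsw
  simp only [Function.comp, Prod.swap_prod_mk] at h
  rw [← h]
  have hmp : MeasurePreserving (Prod.swap : ℝ × ℝ → ℝ × ℝ) volume volume :=
    Measure.measurePreserving_swap
  rw [← hmp.setIntegral_preimage_emb MeasurableEquiv.prodComm.measurableEmbedding,
    Set.preimage_swap_prod]

/-- The integrand of the Dirichlet integral. -/
noncomputable def dirichletKernel (P Q R : ℂ) (p : ℝ × ℝ) : ℂ :=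
  (p.1 : ℂ) ^ (P - 1) * (p.2 : ℂ) ^ (Q - 1) * ((1 - p.1 - p.2 : ℝ) : ℂ) ^ (R - 1)

theorem continuous_dirichletKernel {P Q R : ℂ} (hP : 1 < P.re) (hQ : 1 < Q.re) (hR : 1 < R.re) :
    Continuous (dirichletKernel P Q R) := by
  have h : ∀ {z : ℂ}, 1 < z.re → Continuous fun s : ℝ => (s : ℂ) ^ (z - 1) := fun hz =>
    continuous_ofReal_cpow_const (by simp; linarith)
  exact (((h hP).comp continuous_fst).mul ((h hQ).comp continuous_snd)).mul
    ((h hR).comp (by fun_prop : Continuous fun p : ℝ × ℝ => 1 - p.1 - p.2))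

theorem re_seg (z w : ℂ) (τ : ℝ) : (seg z w τ).re = (1 - τ) * z.re + τ * w.re := by
  simp [seg]

theorem le_re_seg {z w : ℂ} {τ m : ℝ} (hτ : τ ∈ Set.Icc (0 : ℝ) 1) (hz : m ≤ z.re) (hw : m ≤ w.re) :
    m ≤ (seg z w τ).re := by
  rw [re_seg]
  nlinarith [mul_le_mul_of_nonneg_left hz (sub_nonneg.2 hτ.2), mul_le_mul_of_nonneg_left hw hτ.1]

theorem mem_slitPlane_of_re_pos {z : ℂ} (h : 0 < z.re) : z ∈ slitPlane := Or.inl h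

theorem tube_integral_aux {P : ℂ} (hP : 1 < P.re) {e₁ : ℝ} (h₁ : 0 < e₁) {G : ℂ → ℝ → ℂ}
    (hGc : ContinuousOn (fun q : ℂ × ℝ => G q.1 q.2) (Metric.closedBall 0 e₁ ×ˢ Set.Icc (0 : ℝ) 1))
    (hGd : ∀ τ ∈ Set.Icc (0 : ℝ) 1, ∀ s : ℂ, ‖s‖ ≤ e₁ → DifferentiableAt ℂ (fun s => G s τ) s) :
    ∫ p in tubeDom, exp (P * logCirc e₁ p.1) * (I * G (circ e₁ p.1) p.2) =
      (e2pi P - 1) * ∫ s in (0 : ℝ)..e₁, ∫ τ in (0 : ℝ)..1, (s : ℂ) ^ (P - 1) * G s τ := by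
  have hF : ContinuousOn (fun p : ℝ × ℝ => exp (P * logCirc e₁ p.1) *
      (I * G (circ e₁ p.1) p.2)) (Set.Icc 0 (2 * Real.pi) ×ˢ Set.Icc 0 1) := by
    have c1 : Continuous fun p : ℝ × ℝ => exp (P * logCirc e₁ p.1) :=
      (continuous_const.mul ((continuous_logCirc e₁).comp continuous_fst)).cexp
    have c2 : Continuous fun p : ℝ × ℝ => (circ e₁ p.1, p.2) :=
      ((continuous_circ e₁).comp continuous_fst).prodMk continuous_snd
    have c3 : ContinuousOn (fun p : ℝ × ℝ => G (circ e₁ p.1) p.2)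
        (Set.Icc 0 (2 * Real.pi) ×ˢ Set.Icc 0 1) :=
      hGc.comp c2.continuousOn fun p hp => ⟨by simp [norm_circ h₁], hp.2⟩
    exact c1.continuousOn.mul (continuousOn_const.mul c3)
  have hK : ContinuousOn (fun p : ℝ × ℝ => (p.1 : ℂ) ^ (P - 1) * G p.1 p.2)
      (Set.Icc 0 e₁ ×ˢ Set.Icc 0 1) := by
    have c1 : Continuous fun p : ℝ × ℝ => (p.1 : ℂ) ^ (P - 1) :=
      (continuous_ofReal_cpow_const (by simp; linarith)).comp continuous_fst
    have c2 : Continuous fun p : ℝ × ℝ => ((p.1 : ℂ), p.2) := by fun_prop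
    have c3 : ContinuousOn (fun p : ℝ × ℝ => G p.1 p.2) (Set.Icc 0 e₁ ×ˢ Set.Icc 0 1) :=
      hGc.comp c2.continuousOn fun p hp =>
        ⟨by simpa [abs_of_nonneg hp.1.1] using hp.1.2, hp.2⟩
    exact c1.continuousOn.mul c3
  rw [tubeDom, setIntegral_Icc_prod Real.two_pi_pos.le zero_le_one hF,
    intervalIntegral_swap Real.two_pi_pos.le zero_le_one hF]
  have e1 : ∫ τ in (0 : ℝ)..1, ∫ θ in (0 : ℝ)..2 * Real.pi,
      exp (P * logCirc e₁ θ) * (I * G (circ e₁ θ) τ) =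
      ∫ τ in (0 : ℝ)..1, (e2pi P - 1) * ∫ s in (0 : ℝ)..e₁, (s : ℂ) ^ (P - 1) * G s τ := by
    refine intervalIntegral.integral_congr fun τ hτ => ?_
    rw [Set.uIcc_of_le zero_le_one] at hτ
    exact integral_circ_eq hP h₁ (hGd τ hτ)
  rw [e1, intervalIntegral.integral_const_mul, ← intervalIntegral_swap h₁.le zero_le_one hK]

/-- The integral over a tube in terms of an integral over a real region. -/
theorem tube_integral {P Q R : ℂ} (hP : 1 < P.re) {e₁ e₂ e₃ : ℝ} (h₁ : 0 < e₁) (h₂ : 0 < e₂)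
    (h₃ : 0 < e₃) (h : e₁ + e₂ + e₃ < 1) :
    ∫ p in tubeDom, exp (P * logCirc e₁ p.1) * (I *
      (exp ((Q - 1) * log (seg e₂ (1 - e₃ - circ e₁ p.1) p.2) +
        (R - 1) * log (seg (1 - e₂ - circ e₁ p.1) e₃ p.2)) * (1 - e₂ - e₃ - circ e₁ p.1))) =
    (e2pi P - 1) * ∫ s in (0 : ℝ)..e₁, ∫ y in e₂..(1 - e₃ - s), dirichletKernel P Q R (s, y) := by
  -- On the whole disc |s| ≤ e₁ the two remaining functions have real parts at least e₂ and e₃, so G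
  -- is holomorphic in s and the circle can be contracted for each τ.
  let G : ℂ → ℝ → ℂ := fun s τ => exp ((Q - 1) * log (seg e₂ (1 - e₃ - s) τ) +
        (R - 1) * log (seg (1 - e₂ - s) e₃ τ)) * (1 - e₂ - e₃ - s)
  have hslit : ∀ s : ℂ, ‖s‖ ≤ e₁ → ∀ τ ∈ Set.Icc (0 : ℝ) 1,
      seg e₂ (1 - e₃ - s) τ ∈ slitPlane ∧ seg (1 - e₂ - s) e₃ τ ∈ slitPlane := by
    intro s hs τ hτ
    have h4 : s.re ≤ e₁ := (re_le_norm s).trans hs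
    constructor
    · exact mem_slitPlane_of_re_pos (h₂.trans_le (le_re_seg hτ (by simp) (by simp; linarith)))
    · exact mem_slitPlane_of_re_pos (h₃.trans_le (le_re_seg hτ (by simp; linarith) (by simp)))
  have hGc : ContinuousOn (fun q : ℂ × ℝ => G q.1 q.2)
      (Metric.closedBall 0 e₁ ×ˢ Set.Icc (0 : ℝ) 1) := by
    have c1 : ContinuousOn (fun q : ℂ × ℝ => log (seg e₂ (1 - e₃ - q.1) q.2))
        (Metric.closedBall 0 e₁ ×ˢ Set.Icc (0 : ℝ) 1) :=
      ContinuousOn.clog (by unfold seg; fun_prop)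
        fun q hq => (hslit q.1 (by simpa using hq.1) q.2 hq.2).1
    have c2 : ContinuousOn (fun q : ℂ × ℝ => log (seg (1 - e₂ - q.1) e₃ q.2))
        (Metric.closedBall 0 e₁ ×ˢ Set.Icc (0 : ℝ) 1) :=
      ContinuousOn.clog (by unfold seg; fun_prop)
        fun q hq => (hslit q.1 (by simpa using hq.1) q.2 hq.2).2
    exact ((continuousOn_const.mul c1).add (continuousOn_const.mul c2)).cexp.mul (by fun_prop)
  have hGd : ∀ τ ∈ Set.Icc (0 : ℝ) 1, ∀ s : ℂ, ‖s‖ ≤ e₁ →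
      DifferentiableAt ℂ (fun s => G s τ) s := by
    intro τ hτ s hs
    obtain ⟨s1, s2⟩ := hslit s hs τ hτ
    have d1 : DifferentiableAt ℂ (fun s : ℂ => log (seg e₂ (1 - e₃ - s) τ)) s :=
      DifferentiableAt.clog (by unfold seg; fun_prop) s1
    have d2 : DifferentiableAt ℂ (fun s : ℂ => log (seg (1 - e₂ - s) e₃ τ)) s :=
      DifferentiableAt.clog (by unfold seg; fun_prop) s2
    exact ((d1.const_mul _).add (d2.const_mul _)).cexp.mul (by fun_prop)
  refine (tube_integral_aux hP h₁ hGc hGd).trans ?_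
  congr 1
  refine intervalIntegral.integral_congr fun s hs => ?_
  rw [Set.uIcc_of_le h₁.le] at hs
  obtain ⟨hs0, hs1⟩ := hs
  -- Affine substitution y = e₂ + (1-e₃-s-e₂)τ; its derivative is the last factor of G.
  have e2 := intervalIntegral.smul_integral_comp_add_mul (a := 0) (b := 1)
    (fun y : ℝ => dirichletKernel P Q R (s, y)) (1 - e₃ - s - e₂) e₂
  rw [mul_zero, add_zero, mul_one, add_sub_cancel] at e2
  rw [← e2, ← intervalIntegral.integral_smul]
  refine intervalIntegral.integral_congr fun τ hτ => ?_
  rw [Set.uIcc_of_le zero_le_one] at hτ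
  obtain ⟨hτ0, hτ1⟩ := hτ
  have p1 : 0 < e₂ + (1 - e₃ - s - e₂) * τ := by nlinarith
  have p2 : 0 < 1 - s - (e₂ + (1 - e₃ - s - e₂) * τ) := by nlinarith
  have s1 : seg e₂ (1 - e₃ - s) τ = ((e₂ + (1 - e₃ - s - e₂) * τ : ℝ) : ℂ) := by
    simp only [seg]; push_cast; ring
  have s2 : seg (1 - e₂ - s) e₃ τ = ((1 - s - (e₂ + (1 - e₃ - s - e₂) * τ) : ℝ) : ℂ) := by
    simp only [seg]; push_cast; ring
  simp only [G, dirichletKernel]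
  rw [s1, s2, ofReal_cpow_eq_exp p1, ofReal_cpow_eq_exp p2, ← ofReal_log p1.le, ← ofReal_log p2.le,
    exp_add, real_smul, mul_comm (Q - 1), mul_comm (R - 1)]
  push_cast
  ring

/-- The second circle is contracted with the first variable still on its circle; after Fubini the
first is contracted with y real. -/
theorem torus_integral_aux {P Q : ℂ} (hP : 1 < P.re) (hQ : 1 < Q.re) {e₁ e₂ : ℝ} (h₁ : 0 < e₁)
    (h₂ : 0 < e₂) {G : ℂ → ℂ → ℂ}
    (hGc : ContinuousOn (fun q : ℂ × ℂ => G q.1 q.2)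
      (Metric.closedBall 0 e₁ ×ˢ Metric.closedBall 0 e₂))
    (hGd₁ : ∀ s y : ℂ, ‖s‖ ≤ e₁ → ‖y‖ ≤ e₂ → DifferentiableAt ℂ (fun s => G s y) s)
    (hGd₂ : ∀ s y : ℂ, ‖s‖ ≤ e₁ → ‖y‖ ≤ e₂ → DifferentiableAt ℂ (fun y => G s y) y) :
    ∫ p in torusDom, exp (P * logCirc e₁ p.1) * (I * (exp (Q * logCirc e₂ p.2) * (I *
      G (circ e₁ p.1) (circ e₂ p.2)))) =
    (e2pi P - 1) * ((e2pi Q - 1) *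
      ∫ s in (0 : ℝ)..e₁, ∫ y in (0 : ℝ)..e₂, (s : ℂ) ^ (P - 1) * ((y : ℂ) ^ (Q - 1) * G s y)) := by
  have hcE : ∀ (z : ℂ) (e : ℝ), Continuous fun θ : ℝ => exp (z * logCirc e θ) := fun z e =>
    (continuous_const.mul (continuous_logCirc e)).cexp
  have hpow : ∀ {z : ℂ}, 1 < z.re → Continuous fun s : ℝ => (s : ℂ) ^ (z - 1) := fun hz =>
    continuous_ofReal_cpow_const (by simp; linarith)
  have hF : ContinuousOn (fun p : ℝ × ℝ => exp (P * logCirc e₁ p.1) *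
      (I * (exp (Q * logCirc e₂ p.2) * (I * G (circ e₁ p.1) (circ e₂ p.2)))))
      (Set.Icc 0 (2 * Real.pi) ×ˢ Set.Icc 0 (2 * Real.pi)) := by
    have c : Continuous fun p : ℝ × ℝ => (circ e₁ p.1, circ e₂ p.2) :=
      ((continuous_circ e₁).comp continuous_fst).prodMk ((continuous_circ e₂).comp continuous_snd)
    have cG : ContinuousOn (fun p : ℝ × ℝ => G (circ e₁ p.1) (circ e₂ p.2))
        (Set.Icc 0 (2 * Real.pi) ×ˢ Set.Icc 0 (2 * Real.pi)) :=
      hGc.comp c.continuousOn fun p _ => ⟨by simp [norm_circ h₁], by simp [norm_circ h₂]⟩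
    exact ((hcE P e₁).comp continuous_fst).continuousOn.mul (continuousOn_const.mul
      (((hcE Q e₂).comp continuous_snd).continuousOn.mul (continuousOn_const.mul cG)))
  have hK : ContinuousOn (fun p : ℝ × ℝ => exp (P * logCirc e₁ p.1) *
      (I * ((p.2 : ℂ) ^ (Q - 1) * G (circ e₁ p.1) p.2)))
      (Set.Icc 0 (2 * Real.pi) ×ˢ Set.Icc 0 e₂) := by
    have c : Continuous fun p : ℝ × ℝ => (circ e₁ p.1, (p.2 : ℂ)) :=
      ((continuous_circ e₁).comp continuous_fst).prodMk (continuous_ofReal.comp continuous_snd)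
    have cG : ContinuousOn (fun p : ℝ × ℝ => G (circ e₁ p.1) p.2)
        (Set.Icc 0 (2 * Real.pi) ×ˢ Set.Icc 0 e₂) :=
      hGc.comp c.continuousOn fun p hp =>
        ⟨by simp [norm_circ h₁], by simpa [abs_of_nonneg hp.2.1] using hp.2.2⟩
    exact ((hcE P e₁).comp continuous_fst).continuousOn.mul (continuousOn_const.mul
      (((hpow hQ).comp continuous_snd).continuousOn.mul cG))
  have hK' : ContinuousOn (fun p : ℝ × ℝ => (p.1 : ℂ) ^ (P - 1) *
      ((p.2 : ℂ) ^ (Q - 1) * G p.1 p.2)) (Set.Icc 0 e₁ ×ˢ Set.Icc 0 e₂) := by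
    have c : Continuous fun p : ℝ × ℝ => ((p.1 : ℂ), (p.2 : ℂ)) := by fun_prop
    have cG : ContinuousOn (fun p : ℝ × ℝ => G p.1 p.2) (Set.Icc 0 e₁ ×ˢ Set.Icc 0 e₂) :=
      hGc.comp c.continuousOn fun p hp => ⟨by simpa [abs_of_nonneg hp.1.1] using hp.1.2,
        by simpa [abs_of_nonneg hp.2.1] using hp.2.2⟩
    exact ((hpow hP).comp continuous_fst).continuousOn.mul
      (((hpow hQ).comp continuous_snd).continuousOn.mul cG)
  rw [torusDom, setIntegral_Icc_prod Real.two_pi_pos.le Real.two_pi_pos.le hF]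
  have e1 : ∫ θ in (0 : ℝ)..2 * Real.pi, ∫ φ in (0 : ℝ)..2 * Real.pi,
      exp (P * logCirc e₁ θ) * (I * (exp (Q * logCirc e₂ φ) * (I * G (circ e₁ θ) (circ e₂ φ)))) =
      (e2pi Q - 1) * ∫ θ in (0 : ℝ)..2 * Real.pi, ∫ y in (0 : ℝ)..e₂,
        exp (P * logCirc e₁ θ) * (I * ((y : ℂ) ^ (Q - 1) * G (circ e₁ θ) y)) := by
    rw [← intervalIntegral.integral_const_mul]
    refine intervalIntegral.integral_congr fun θ _ => ?_
    simp only [intervalIntegral.integral_const_mul]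
    rw [integral_circ_eq hQ h₂ fun y hy => hGd₂ _ y (norm_circ h₁ θ).le hy]
    ring
  have e2 : ∫ y in (0 : ℝ)..e₂, ∫ θ in (0 : ℝ)..2 * Real.pi,
      exp (P * logCirc e₁ θ) * (I * ((y : ℂ) ^ (Q - 1) * G (circ e₁ θ) y)) =
      (e2pi P - 1) * ∫ y in (0 : ℝ)..e₂, ∫ s in (0 : ℝ)..e₁,
        (s : ℂ) ^ (P - 1) * ((y : ℂ) ^ (Q - 1) * G s y) := by
    rw [← intervalIntegral.integral_const_mul]
    refine intervalIntegral.integral_congr fun y hy => ?_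
    rw [Set.uIcc_of_le h₂.le] at hy
    refine integral_circ_eq hP h₁ (g := fun s => (y : ℂ) ^ (Q - 1) * G s y) fun s hs => ?_
    exact (hGd₁ s y hs (by simpa [abs_of_nonneg hy.1] using hy.2)).const_mul _
  rw [e1, intervalIntegral_swap Real.two_pi_pos.le h₂.le hK, e2,
    ← intervalIntegral_swap h₁.le h₂.le hK', mul_left_comm]

/-- The integral over a torus in terms of an integral over a real rectangle. -/
theorem torus_integral {P Q R : ℂ} (hP : 1 < P.re) (hQ : 1 < Q.re) {e₁ e₂ : ℝ} (h₁ : 0 < e₁)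
    (h₂ : 0 < e₂) (h : e₁ + e₂ < 1) :
    ∫ p in torusDom, exp (P * logCirc e₁ p.1) * (I * (exp (Q * logCirc e₂ p.2) * (I *
      exp ((R - 1) * log (1 - circ e₁ p.1 - circ e₂ p.2))))) =
    (e2pi P - 1) * ((e2pi Q - 1) *
      ∫ s in (0 : ℝ)..e₁, ∫ y in (0 : ℝ)..e₂, dirichletKernel P Q R (s, y)) := by
  let G : ℂ → ℂ → ℂ := fun s y => exp ((R - 1) * log (1 - s - y))
  have hslit : ∀ s y : ℂ, ‖s‖ ≤ e₁ → ‖y‖ ≤ e₂ → 1 - s - y ∈ slitPlane := by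
    intro s y hs hy
    refine mem_slitPlane_of_re_pos ?_
    have := (re_le_norm s).trans hs
    have := (re_le_norm y).trans hy
    simp
    linarith
  have hGc : ContinuousOn (fun q : ℂ × ℂ => G q.1 q.2)
      (Metric.closedBall 0 e₁ ×ˢ Metric.closedBall 0 e₂) := by
    refine (continuousOn_const.mul (ContinuousOn.clog (by fun_prop) ?_)).cexp
    exact fun q hq => hslit _ _ (by simpa using hq.1) (by simpa using hq.2)
  have hGd₁ : ∀ s y : ℂ, ‖s‖ ≤ e₁ → ‖y‖ ≤ e₂ → DifferentiableAt ℂ (fun s => G s y) s := by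
    intro s y hs hy
    have d : DifferentiableAt ℂ (fun s : ℂ => log (1 - s - y)) s :=
      DifferentiableAt.clog (by fun_prop) (hslit s y hs hy)
    exact (d.const_mul _).cexp
  have hGd₂ : ∀ s y : ℂ, ‖s‖ ≤ e₁ → ‖y‖ ≤ e₂ → DifferentiableAt ℂ (fun y => G s y) y := by
    intro s y hs hy
    have d : DifferentiableAt ℂ (fun y : ℂ => log (1 - s - y)) y :=
      DifferentiableAt.clog (by fun_prop) (hslit s y hs hy)
    exact (d.const_mul _).cexp
  refine (torus_integral_aux hP hQ h₁ h₂ hGc hGd₁ hGd₂).trans ?_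
  congr 2
  refine intervalIntegral.integral_congr fun s hs => ?_
  refine intervalIntegral.integral_congr fun y hy => ?_
  rw [Set.uIcc_of_le h₁.le] at hs
  rw [Set.uIcc_of_le h₂.le] at hy
  have p1 : 0 < 1 - s - y := by linarith [hs.2, hy.2]
  have s1 : (1 - s - y : ℂ) = ((1 - s - y : ℝ) : ℂ) := by push_cast; ring
  simp only [G, dirichletKernel]
  rw [s1, ofReal_cpow_eq_exp p1, ← ofReal_log p1.le, mul_comm (R - 1), mul_assoc]

end AppellF4

/-! ### Dirichlet's integral and the tiling of the simplex -/

namespace AppellF4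

theorem setIntegral_region {Φ : ℝ × ℝ → ℂ} (hΦ : Continuous Φ) {A : Set ℝ} (hA : MeasurableSet A)
    (hA1 : A ⊆ Set.Icc 0 1) {f g : ℝ → ℝ} (hf : Measurable f) (hg : Measurable g)
    (hfg : ∀ s ∈ A, 0 ≤ f s ∧ f s ≤ g s ∧ g s ≤ 1) :
    ∫ p in {p : ℝ × ℝ | p.1 ∈ A ∧ p.2 ∈ Set.Icc (f p.1) (g p.1)}, Φ p =
      ∫ s in A, ∫ y in f s..g s, Φ (s, y) := by
  set T : Set (ℝ × ℝ) := {p : ℝ × ℝ | p.1 ∈ A ∧ p.2 ∈ Set.Icc (f p.1) (g p.1)}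
  have hT : MeasurableSet T := by
    have h1 : MeasurableSet {p : ℝ × ℝ | p.1 ∈ A} := measurable_fst hA
    have h2 : MeasurableSet {p : ℝ × ℝ | f p.1 ≤ p.2} :=
      measurableSet_le (hf.comp measurable_fst) measurable_snd
    have h3 : MeasurableSet {p : ℝ × ℝ | p.2 ≤ g p.1} :=
      measurableSet_le measurable_snd (hg.comp measurable_fst)
    exact h1.inter (h2.inter h3)
  have hTi : IntegrableOn Φ T := by
    refine (hΦ.continuousOn.integrableOn_compact
      (isCompact_Icc.prod isCompact_Icc : IsCompact (Set.Icc (0 : ℝ) 1 ×ˢ Set.Icc (0 : ℝ) 1))).mono_set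
      fun p hp => ⟨hA1 hp.1, ?_⟩
    obtain ⟨h1, h2, h3⟩ := hfg p.1 hp.1
    exact ⟨h1.trans hp.2.1, hp.2.2.trans h3⟩
  rw [← integral_indicator hT, ← integral_indicator hA]
  rw [← integrable_indicator_iff hT, Measure.volume_eq_prod] at hTi
  rw [Measure.volume_eq_prod, integral_prod _ hTi]
  refine integral_congr_ae (.of_forall fun s => ?_)
  by_cases hs : s ∈ A
  · simp only [Set.indicator_of_mem hs]
    rw [intervalIntegral.integral_of_le (hfg s hs).2.1, ← integral_Icc_eq_integral_Ioc,
      ← integral_indicator measurableSet_Icc]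
    refine integral_congr_ae (.of_forall fun y => ?_)
    simp only [Set.indicator, T, Set.mem_ofPred_eq, hs, true_and]
  · simp [Set.indicator, T, hs]

/-- The standard simplex in the plane. -/
def simplex : Set (ℝ × ℝ) := {p | p.1 ∈ Set.Icc (0 : ℝ) 1 ∧ p.2 ∈ Set.Icc 0 (1 - p.1)}

/-- The part of the simplex near the side where the first coordinate vanishes. -/
def sideTile (e₁ e₂ e₃ : ℝ) : Set (ℝ × ℝ) :=
  {p | p.1 ∈ Set.Ico (0 : ℝ) e₁ ∧ p.2 ∈ Set.Icc e₂ (1 - e₃ - p.1)}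

/-- The part of the simplex near the vertex where both coordinates vanish. -/
def cornerTile (e₁ e₂ : ℝ) : Set (ℝ × ℝ) := Set.Ico (0 : ℝ) e₁ ×ˢ Set.Ico (0 : ℝ) e₂

theorem setIntegral_sideTile {Φ : ℝ × ℝ → ℂ} (hΦ : Continuous Φ) {e₁ e₂ e₃ : ℝ} (h₁ : 0 < e₁)
    (h₂ : 0 < e₂) (h₃ : 0 < e₃) (h : e₁ + e₂ + e₃ < 1) :
    ∫ p in sideTile e₁ e₂ e₃, Φ p = ∫ s in (0 : ℝ)..e₁, ∫ y in e₂..(1 - e₃ - s), Φ (s, y) := by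
  rw [intervalIntegral.integral_of_le h₁.le, ← integral_Ico_eq_integral_Ioc]
  refine setIntegral_region hΦ measurableSet_Ico (fun s hs => ⟨hs.1, by linarith [hs.2]⟩)
    measurable_const (by fun_prop) fun s hs => ⟨h₂.le, ?_, ?_⟩
  · linarith [hs.2]
  · linarith [hs.1]

theorem setIntegral_cornerTile {Φ : ℝ × ℝ → ℂ} (hΦ : Continuous Φ) {e₁ e₂ : ℝ} (h₁ : 0 < e₁)
    (h₂ : 0 < e₂) :
    ∫ p in cornerTile e₁ e₂, Φ p = ∫ s in (0 : ℝ)..e₁, ∫ y in (0 : ℝ)..e₂, Φ (s, y) := by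
  have hi : IntegrableOn Φ (cornerTile e₁ e₂) :=
    (hΦ.continuousOn.integrableOn_compact (isCompact_Icc.prod isCompact_Icc)).mono_set
      (Set.prod_mono Set.Ico_subset_Icc_self Set.Ico_subset_Icc_self)
  rw [cornerTile, Measure.volume_eq_prod] at hi ⊢
  rw [setIntegral_prod _ hi, intervalIntegral.integral_of_le h₁.le, integral_Ico_eq_integral_Ioc]
  simp only [intervalIntegral.integral_of_le h₂.le, integral_Ico_eq_integral_Ioc]

/-- Dirichlet's integral. -/
theorem setIntegral_simplex {P Q R : ℂ} (hP : 1 < P.re) (hQ : 1 < Q.re) (hR : 1 < R.re) :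
    ∫ p in simplex, dirichletKernel P Q R p = Gamma P * Gamma Q * Gamma R / Gamma (P + Q + R) := by
  have h1 := setIntegral_region (continuous_dirichletKernel hP hQ hR)
    (A := Set.Icc (0 : ℝ) 1) measurableSet_Icc subset_rfl (f := fun _ => 0) (g := fun s => 1 - s)
    measurable_const (by fun_prop) fun s hs => ⟨le_rfl, by linarith [hs.2], by linarith [hs.1]⟩
  refine h1.trans ?_
  rw [integral_Icc_eq_integral_Ioc, ← intervalIntegral.integral_of_le zero_le_one]
  have h2 : ∀ s ∈ Set.uIcc (0 : ℝ) 1, ∫ y in (0 : ℝ)..1 - s, dirichletKernel P Q R (s, y) =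
      betaIntegral Q R * ((s : ℂ) ^ (P - 1) * (1 - s : ℂ) ^ (Q + R - 1)) := by
    intro s hs
    rw [Set.uIcc_of_le zero_le_one] at hs
    -- At s = 1 the scaled beta formula is unavailable, but both sides vanish because Q + R - 1 ≠ 0.
    rcases hs.2.eq_or_lt with rfl | hs1
    · have : Q + R - 1 ≠ 0 := fun h0 => by
        have := congrArg Complex.re h0
        simp at this
        linarith
      simp [zero_cpow this]
    · have h3 := betaIntegral_scaled Q R (sub_pos.2 hs1)
      simp only [dirichletKernel, mul_assoc, intervalIntegral.integral_const_mul]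
      push_cast at h3 ⊢
      rw [h3]
      ring
  rw [intervalIntegral.integral_congr h2, intervalIntegral.integral_const_mul]
  have h3 : ∫ s in (0 : ℝ)..1, (s : ℂ) ^ (P - 1) * (1 - s : ℂ) ^ (Q + R - 1) =
    betaIntegral P (Q + R) := rfl
  have hQR : 0 < (Q + R).re := by simp; linarith
  rw [h3, betaIntegral_eq_Gamma_mul_div _ _ (by linarith) (by linarith : 0 < R.re),
    betaIntegral_eq_Gamma_mul_div _ _ (by linarith : 0 < P.re) hQR, ← add_assoc]
  have := Gamma_ne_zero_of_re_pos hQR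
  field_simp

theorem setIntegral_comp_eq {m : ℝ × ℝ → ℝ × ℝ} (hm : MeasurePreserving m volume volume)
    (hme : MeasurableEmbedding m) {Φ Φ' : ℝ × ℝ → ℂ} (h : ∀ p, Φ (m p) = Φ' p) (S : Set (ℝ × ℝ)) :
    ∫ p in S, Φ p = ∫ p in m ⁻¹' S, Φ' p := by
  rw [← hm.setIntegral_preimage_emb hme]
  simp only [h]

/-- Exchange of the second and the third barycentric coordinate. -/
def flip₂₃ (p : ℝ × ℝ) : ℝ × ℝ := (p.1, 1 - p.1 - p.2)

theorem measurePreserving_flip₂₃ : MeasurePreserving flip₂₃ volume volume := by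
  refine (MeasurePreserving.id (volume : Measure ℝ)).skew_product (g := fun s y => 1 - s - y)
    (by fun_prop) (.of_forall fun s => ?_)
  exact (Measure.measurePreserving_sub_left (volume : Measure ℝ) (1 - s)).map_eq

theorem measurableEmbedding_flip₂₃ : MeasurableEmbedding flip₂₃ :=
  (MeasurableEquiv.ofInvolutive flip₂₃ (fun p => by simp [flip₂₃])
    measurePreserving_flip₂₃.measurable).measurableEmbedding

theorem measurePreserving_swap_real :
    MeasurePreserving (Prod.swap : ℝ × ℝ → ℝ × ℝ) volume volume :=
  Measure.measurePreserving_swap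

theorem measurableEmbedding_swap_real : MeasurableEmbedding (Prod.swap : ℝ × ℝ → ℝ × ℝ) :=
  MeasurableEquiv.prodComm.measurableEmbedding

theorem dirichletKernel_flip₂₃ (P Q R : ℂ) (p : ℝ × ℝ) :
    dirichletKernel P R Q (flip₂₃ p) = dirichletKernel P Q R p := by
  have h : 1 - p.1 - (1 - p.1 - p.2) = p.2 := by ring
  simp only [dirichletKernel, flip₂₃, h]
  ring

theorem dirichletKernel_swap (P Q R : ℂ) (p : ℝ × ℝ) :
    dirichletKernel Q P R p.swap = dirichletKernel P Q R p := by
  have h : 1 - p.2 - p.1 = 1 - p.1 - p.2 := by ring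
  simp only [dirichletKernel, Prod.fst_swap, Prod.snd_swap, h]
  ring

/-- The real triangle that is left after removing strips along the sides of the simplex. -/
def innerTile (ε₁ ε₂ ε₃ : ℝ) : Set (ℝ × ℝ) := {p | ε₁ ≤ p.1 ∧ ε₂ ≤ p.2 ∧ ε₃ ≤ 1 - p.1 - p.2}

/-- The simplex is tiled by a triangle, three strips along the sides and three parallelograms at
the vertices. -/
theorem setIntegral_simplex_tiling {Φ : ℝ × ℝ → ℂ} (hΦ : Continuous Φ) {ε₁ ε₂ ε₃ : ℝ} (h₁ : 0 < ε₁)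
    (h₂ : 0 < ε₂) (h₃ : 0 < ε₃) (h : ε₁ + ε₂ + ε₃ < 1) :
    ∫ p in simplex, Φ p = (∫ p in innerTile ε₁ ε₂ ε₃, Φ p) +
      (∫ p in flip₂₃ ⁻¹' sideTile ε₁ ε₃ ε₂, Φ p) + (∫ p in Prod.swap ⁻¹' sideTile ε₂ ε₁ ε₃, Φ p) +
      (∫ p in Prod.swap ⁻¹' (flip₂₃ ⁻¹' (Prod.swap ⁻¹' sideTile ε₃ ε₂ ε₁)), Φ p) +
      (∫ p in cornerTile ε₁ ε₂, Φ p) +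
      (∫ p in Prod.swap ⁻¹' (flip₂₃ ⁻¹' cornerTile ε₂ ε₃), Φ p) +
      (∫ p in flip₂₃ ⁻¹' (Prod.swap ⁻¹' cornerTile ε₃ ε₁), Φ p) := by
  have hi : IntegrableOn Φ simplex := by
    refine (hΦ.continuousOn.integrableOn_compact
      (isCompact_Icc.prod isCompact_Icc : IsCompact (Set.Icc (0 : ℝ) 1 ×ˢ Set.Icc (0 : ℝ) 1))).mono_set
      fun p hp => ⟨hp.1, hp.2.1, ?_⟩
    linarith [hp.2.2, hp.1.1]
  set A₁ : Set (ℝ × ℝ) := {p | p.1 < ε₁} with hA₁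
  set A₂ : Set (ℝ × ℝ) := {p | p.2 < ε₂} with hA₂
  set A₃ : Set (ℝ × ℝ) := {p | 1 - p.1 - p.2 < ε₃} with hA₃
  have m₁ : MeasurableSet A₁ := measurableSet_lt (by fun_prop) (by fun_prop)
  have m₂ : MeasurableSet A₂ := measurableSet_lt (by fun_prop) (by fun_prop)
  have m₃ : MeasurableSet A₃ := measurableSet_lt (by fun_prop) (by fun_prop)
  have i1 := hi.mono_set (Set.inter_subset_left : simplex ∩ A₁ ⊆ simplex)
  have i2 := hi.mono_set (Set.sdiff_subset : simplex \ A₁ ⊆ simplex)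
  have i3 := i1.mono_set (Set.sdiff_subset : (simplex ∩ A₁) \ A₂ ⊆ _)
  have i4 := i2.mono_set (Set.inter_subset_left : (simplex \ A₁) ∩ A₂ ⊆ _)
  have i5 := i2.mono_set (Set.sdiff_subset : (simplex \ A₁) \ A₂ ⊆ _)
  -- The piece inside both A₁ and A₂ is not cut by A₃: there the third coordinate exceeds 1 - ε₁ -
  -- ε₂ > ε₃. Hence seven pieces and not eight.
  rw [← integral_inter_add_sdiff m₁ hi, ← integral_inter_add_sdiff m₂ i1,
    ← integral_inter_add_sdiff m₂ i2, ← integral_inter_add_sdiff m₃ i3,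
    ← integral_inter_add_sdiff m₃ i4, ← integral_inter_add_sdiff m₃ i5]
  have s1 : ((simplex \ A₁) \ A₂) \ A₃ = innerTile ε₁ ε₂ ε₃ := by
    ext p
    simp only [simplex, innerTile, hA₁, hA₂, hA₃, Set.mem_sdiff, Set.mem_ofPred_eq, Set.mem_Icc,
      not_lt]
    grind
  have s2 : ((simplex ∩ A₁) \ A₂) \ A₃ = flip₂₃ ⁻¹' sideTile ε₁ ε₃ ε₂ := by
    ext p
    simp only [simplex, sideTile, flip₂₃, hA₁, hA₂, hA₃, Set.mem_sdiff, Set.mem_inter_iff,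
      Set.mem_ofPred_eq, Set.mem_Icc, Set.mem_Ico, Set.mem_preimage, not_lt]
    grind
  have s3 : ((simplex \ A₁) ∩ A₂) \ A₃ = Prod.swap ⁻¹' sideTile ε₂ ε₁ ε₃ := by
    ext p
    simp only [simplex, sideTile, hA₁, hA₂, hA₃, Set.mem_sdiff, Set.mem_inter_iff,
      Set.mem_ofPred_eq, Set.mem_Icc, Set.mem_Ico, Set.mem_preimage, not_lt, Prod.fst_swap,
      Prod.snd_swap]
    grind
  have s4 : ((simplex \ A₁) \ A₂) ∩ A₃ =
      Prod.swap ⁻¹' (flip₂₃ ⁻¹' (Prod.swap ⁻¹' sideTile ε₃ ε₂ ε₁)) := by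
    ext p
    simp only [simplex, sideTile, flip₂₃, hA₁, hA₂, hA₃, Set.mem_sdiff, Set.mem_inter_iff,
      Set.mem_ofPred_eq, Set.mem_Icc, Set.mem_Ico, Set.mem_preimage, not_lt, Prod.fst_swap,
      Prod.snd_swap]
    grind
  have s5 : (simplex ∩ A₁) ∩ A₂ = cornerTile ε₁ ε₂ := by
    ext p
    simp only [simplex, cornerTile, hA₁, hA₂, Set.mem_inter_iff, Set.mem_prod,
      Set.mem_ofPred_eq, Set.mem_Icc, Set.mem_Ico]
    grind
  have s6 : ((simplex \ A₁) ∩ A₂) ∩ A₃ = Prod.swap ⁻¹' (flip₂₃ ⁻¹' cornerTile ε₂ ε₃) := by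
    ext p
    simp only [simplex, cornerTile, flip₂₃, hA₁, hA₂, hA₃, Set.mem_sdiff, Set.mem_inter_iff,
      Set.mem_prod, Set.mem_ofPred_eq, Set.mem_Icc, Set.mem_Ico, Set.mem_preimage, not_lt,
      Prod.fst_swap, Prod.snd_swap]
    grind
  have s7 : ((simplex ∩ A₁) \ A₂) ∩ A₃ = flip₂₃ ⁻¹' (Prod.swap ⁻¹' cornerTile ε₃ ε₁) := by
    ext p
    simp only [simplex, cornerTile, flip₂₃, hA₁, hA₂, hA₃, Set.mem_sdiff, Set.mem_inter_iff,
      Set.mem_prod, Set.mem_ofPred_eq, Set.mem_Icc, Set.mem_Ico, Set.mem_preimage, not_lt,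
      Prod.fst_swap, Prod.snd_swap]
    grind
  rw [s1, s2, s3, s4, s5, s6, s7]
  ring

end AppellF4

/-! ### Jacobians of the cells -/

namespace AppellF4

theorem hasDerivAt_circ (ε θ : ℝ) : HasDerivAt (circ ε) (circ ε θ * I) θ := by
  have h1 : HasDerivAt (fun s : ℝ => (s : ℂ) * I) I θ := by
    simpa using (hasDerivAt_id θ).ofReal_comp.mul_const I
  have h2 := (h1.cexp.const_mul (ε : ℂ))
  rwa [← mul_assoc] at h2

theorem hasDerivAt_seg (z w : ℂ) (τ : ℝ) : HasDerivAt (seg z w) (w - z) τ := by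
  have h1 : HasDerivAt (fun s : ℝ => (s : ℂ)) 1 τ := by simpa using (hasDerivAt_id τ).ofReal_comp
  have h2 := ((h1.const_sub 1).mul_const z).add (h1.mul_const w)
  have h3 : w - z = -1 * z + 1 * w := by ring
  rw [h3]
  exact h2

theorem LoadedCell.jac_eq {σ : LoadedCell} {p : ℝ × ℝ} {d₁₁ d₁₂ d₂₁ d₂₂ : ℂ}
    (h₁₁ : HasDerivAt (fun s : ℝ => σ.t₁ (s, p.2)) d₁₁ p.1)
    (h₁₂ : HasDerivAt (fun s : ℝ => σ.t₁ (p.1, s)) d₁₂ p.2)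
    (h₂₁ : HasDerivAt (fun s : ℝ => σ.t₂ (s, p.2)) d₂₁ p.1)
    (h₂₂ : HasDerivAt (fun s : ℝ => σ.t₂ (p.1, s)) d₂₂ p.2) :
    σ.jac p = d₁₁ * d₂₂ - d₁₂ * d₂₁ := by
  rw [LoadedCell.jac, h₁₁.deriv, h₁₂.deriv, h₂₁.deriv, h₂₂.deriv]

variable (ε₁ ε₂ ε₃ : ℝ) (x : ℂ × ℂ) (p : ℝ × ℝ)

theorem jac_triangle : (triangle ε₁ ε₂ ε₃ x).jac p = 1 := by
  have h (s : ℝ) : HasDerivAt (fun s : ℝ => (s : ℂ)) 1 s := by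
    simpa using (hasDerivAt_id s).ofReal_comp
  rw [LoadedCell.jac_eq (h p.1) (hasDerivAt_const p.2 (p.1 : ℂ)) (hasDerivAt_const p.1 (p.2 : ℂ))
    (h p.2)]
  ring

theorem hasDerivAt_seg_circ_left (ε : ℝ) (z w : ℂ) (τ θ : ℝ) :
    HasDerivAt (fun s : ℝ => seg (z - circ ε s) w τ) (-((1 - τ) * (circ ε θ * I))) θ := by
  have := (((hasDerivAt_circ ε θ).const_sub z).const_mul (1 - τ : ℂ)).add_const (τ * w)
  rwa [mul_neg] at this

theorem hasDerivAt_seg_circ_right (ε : ℝ) (z w : ℂ) (τ θ : ℝ) :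
    HasDerivAt (fun s : ℝ => seg w (z - circ ε s) τ) (-(τ * (circ ε θ * I))) θ := by
  have := (((hasDerivAt_circ ε θ).const_sub z).const_mul (τ : ℂ)).const_add ((1 - τ) * w)
  rwa [mul_neg] at this

/-- The minus sign comes from the boundary direction of the side, along which t₂ decreases. It turns
the factor e2pi P - 1 of the contraction into the 1 - m₁ by which the chain divides; the other two
tubes behave alike. -/
theorem jac_tube₁ : (tube₁ ε₁ ε₂ ε₃ x).jac p =
    -(circ ε₁ p.1 * I * (1 - ε₂ - ε₃ - circ ε₁ p.1)) := by
  rw [LoadedCell.jac_eq (σ := tube₁ ε₁ ε₂ ε₃ x) (hasDerivAt_circ ε₁ p.1)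
    (hasDerivAt_const p.2 (circ ε₁ p.1))
    (hasDerivAt_seg_circ_left ε₁ (1 - ε₃) ε₂ p.2 p.1)
    (hasDerivAt_seg (1 - ε₃ - circ ε₁ p.1) ε₂ p.2)]
  ring

theorem jac_tube₂ : (tube₂ ε₁ ε₂ ε₃ x).jac p =
    -(circ ε₂ p.1 * I * (1 - ε₁ - ε₃ - circ ε₂ p.1)) := by
  rw [LoadedCell.jac_eq (σ := tube₂ ε₁ ε₂ ε₃ x) (hasDerivAt_seg_circ_right ε₂ (1 - ε₃) ε₁ p.2 p.1)
    (hasDerivAt_seg ε₁ (1 - ε₃ - circ ε₂ p.1) p.2) (hasDerivAt_circ ε₂ p.1) (hasDerivAt_const p.2 (circ ε₂ p.1))]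
  ring

theorem jac_tube₃ : (tube₃ ε₁ ε₂ ε₃ x).jac p =
    -(circ ε₃ p.1 * I * (1 - ε₂ - ε₁ - circ ε₃ p.1)) := by
  have h1 := hasDerivAt_seg_circ_left ε₃ (1 - ε₂) ε₁ p.2 p.1
  have h2 := hasDerivAt_seg (1 - ε₂ - circ ε₃ p.1) ε₁ p.2
  rw [LoadedCell.jac_eq (σ := tube₃ ε₁ ε₂ ε₃ x) h1 h2
    (((hasDerivAt_circ ε₃ p.1).const_sub 1).sub h1) (h2.const_sub (1 - circ ε₃ p.1))]
  ring

theorem jac_torus₁₂ : (torus₁₂ ε₁ ε₂ x).jac p = circ ε₁ p.1 * I * (circ ε₂ p.2 * I) := by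
  rw [LoadedCell.jac_eq (σ := torus₁₂ ε₁ ε₂ x) (hasDerivAt_circ ε₁ p.1)
    (hasDerivAt_const p.2 (circ ε₁ p.1)) (hasDerivAt_const p.1 (circ ε₂ p.2))
    (hasDerivAt_circ ε₂ p.2)]
  ring

theorem jac_torus₂₃ : (torus₂₃ ε₂ ε₃ x).jac p = circ ε₂ p.1 * I * (circ ε₃ p.2 * I) := by
  rw [LoadedCell.jac_eq (σ := torus₂₃ ε₂ ε₃ x)
    (((hasDerivAt_circ ε₂ p.1).const_sub 1).sub_const (circ ε₃ p.2))
    ((hasDerivAt_circ ε₃ p.2).const_sub (1 - circ ε₂ p.1))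
    (hasDerivAt_circ ε₂ p.1) (hasDerivAt_const p.2 (circ ε₂ p.1))]
  ring

theorem jac_torus₃₁ : (torus₃₁ ε₁ ε₃ x).jac p = circ ε₃ p.1 * I * (circ ε₁ p.2 * I) := by
  rw [LoadedCell.jac_eq (σ := torus₃₁ ε₁ ε₃ x) (hasDerivAt_const p.1 (circ ε₁ p.2))
    (hasDerivAt_circ ε₁ p.2)
    (((hasDerivAt_circ ε₃ p.1).const_sub 1).sub_const (circ ε₁ p.2))
    ((hasDerivAt_circ ε₁ p.2).const_sub (1 - circ ε₃ p.1))]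
  ring

/-- The integral of `t₁^{p-1} t₂^{q-1} L^{r-1} dt₁ ∧ dt₂` over a loaded cell. -/
noncomputable def LoadedCell.moment (σ : LoadedCell) (p q r : ℂ) : ℂ :=
  ∫ z in σ.dom, exp ((p - 1) * σ.logt₁ z + (q - 1) * σ.logt₂ z + (r - 1) * σ.logL z) * σ.jac z

/-- The integral of `t₁^{p-1} t₂^{q-1} L^{r-1} dt₁ ∧ dt₂` over a twisted chain. -/
noncomputable def TwistedChain.moment (Δ : TwistedChain) (p q r : ℂ) : ℂ :=
  (Δ.map fun σ => σ.1 * σ.2.moment p q r).sum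

end AppellF4

/-! ### Moments of the regularized triangle for exponents of real part > 1 -/

namespace AppellF4

variable {ε₁ ε₂ ε₃ : ℝ} {x : ℂ × ℂ} {p q r : ℂ}

theorem exp_sub_one_mul_logCirc_mul {ε : ℝ} (hε : 0 < ε) (P w : ℂ) (θ : ℝ) :
    exp ((P - 1) * logCirc ε θ + w) * circ ε θ = exp (P * logCirc ε θ) * exp w := by
  rw [← exp_logCirc hε θ, ← exp_add, ← exp_add]
  ring_nf

theorem moment_triangle (h₁ : 0 < ε₁) (h₂ : 0 < ε₂) (h₃ : 0 < ε₃) :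
    (triangle ε₁ ε₂ ε₃ x).moment p q r =
      ∫ z in innerTile ε₁ ε₂ ε₃, dirichletKernel p q r z := by
  have m1 : MeasurableSet {z : ℝ × ℝ | ε₁ ≤ z.1} := measurableSet_le (by fun_prop) (by fun_prop)
  have m2 : MeasurableSet {z : ℝ × ℝ | ε₂ ≤ z.2} := measurableSet_le (by fun_prop) (by fun_prop)
  have m3 : MeasurableSet {z : ℝ × ℝ | ε₃ ≤ 1 - z.1 - z.2} :=
    measurableSet_le (by fun_prop) (by fun_prop)
  have hm : MeasurableSet (innerTile ε₁ ε₂ ε₃) := m1.inter (m2.inter m3)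
  refine setIntegral_congr_fun hm fun z hz => ?_
  have z1 : 0 < z.1 := h₁.trans_le hz.1
  have z2 : 0 < z.2 := h₂.trans_le hz.2.1
  have z3 : 0 < 1 - z.1 - z.2 := h₃.trans_le hz.2.2
  simp only [jac_triangle, mul_one, dirichletKernel]
  rw [ofReal_cpow_eq_exp z1, ofReal_cpow_eq_exp z2, ofReal_cpow_eq_exp z3, ← exp_add, ← exp_add]
  simp only [triangle, cellM]
  ring_nf

/-- Along I₁ it is L that grows, from ε₃, so `tube_integral` is used with (t₁, L, t₂) in place of
its three functions, and `flip₂₃` returns to the coordinates (t₁, t₂). -/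
theorem moment_tube₁ (hp : 1 < p.re) (hq : 1 < q.re) (hr : 1 < r.re) (h₁ : 0 < ε₁) (h₂ : 0 < ε₂)
    (h₃ : 0 < ε₃) (h : ε₁ + ε₂ + ε₃ < 1) :
    (tube₁ ε₁ ε₂ ε₃ x).moment p q r =
      (1 - e2pi p) * ∫ z in flip₂₃ ⁻¹' sideTile ε₁ ε₃ ε₂, dirichletKernel p q r z := by
  have e1 := tube_integral (P := p) (Q := r) (R := q) hp h₁ h₃ h₂ (by linarith)
  rw [← setIntegral_sideTile (continuous_dirichletKernel hp hr hq) h₁ h₃ h₂ (by linarith),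
    setIntegral_comp_eq measurePreserving_flip₂₃ measurableEmbedding_flip₂₃
      (dirichletKernel_flip₂₃ p q r)] at e1
  rw [← neg_sub, neg_mul, ← e1, ← integral_neg]
  refine integral_congr_ae (.of_forall fun z => ?_)
  have hL : 1 - circ ε₁ z.1 - seg (1 - ε₃ - circ ε₁ z.1) ε₂ z.2 =
      seg ε₃ (1 - ε₂ - circ ε₁ z.1) z.2 := by
    simp only [seg]
    ring
  simp only [jac_tube₁]
  simp only [tube₁, cellM, hL]
  rw [add_assoc]
  linear_combination (-I * (1 - ε₂ - ε₃ - circ ε₁ z.1)) *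
    exp_sub_one_mul_logCirc_mul h₁ p ((q - 1) * log (seg (1 - ε₃ - circ ε₁ z.1) ε₂ z.2) +
      (r - 1) * log (seg ε₃ (1 - ε₂ - circ ε₁ z.1) z.2)) z.1 +
    exp (p * logCirc ε₁ z.1) * I * (1 - ε₂ - ε₃ - circ ε₁ z.1) * congrArg exp
      (add_comm ((r - 1) * log (seg ε₃ (1 - ε₂ - circ ε₁ z.1) z.2))
        ((q - 1) * log (seg (1 - ε₃ - circ ε₁ z.1) ε₂ z.2)))

theorem moment_tube₂ (hp : 1 < p.re) (hq : 1 < q.re) (hr : 1 < r.re) (h₁ : 0 < ε₁) (h₂ : 0 < ε₂)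
    (h₃ : 0 < ε₃) (h : ε₁ + ε₂ + ε₃ < 1) :
    (tube₂ ε₁ ε₂ ε₃ x).moment p q r =
      (1 - e2pi q) * ∫ z in Prod.swap ⁻¹' sideTile ε₂ ε₁ ε₃, dirichletKernel p q r z := by
  have e1 := tube_integral (P := q) (Q := p) (R := r) hq h₂ h₁ h₃ (by linarith)
  rw [← setIntegral_sideTile (continuous_dirichletKernel hq hp hr) h₂ h₁ h₃ (by linarith),
    setIntegral_comp_eq measurePreserving_swap_real measurableEmbedding_swap_real
      (dirichletKernel_swap p q r)] at e1
  rw [← neg_sub, neg_mul, ← e1, ← integral_neg]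
  refine integral_congr_ae (.of_forall fun z => ?_)
  have hL : 1 - seg ε₁ (1 - ε₃ - circ ε₂ z.1) z.2 - circ ε₂ z.1 =
      seg (1 - ε₁ - circ ε₂ z.1) ε₃ z.2 := by
    simp only [seg]
    ring
  simp only [jac_tube₂]
  simp only [tube₂, cellM, hL]
  rw [add_comm ((p - 1) * _), add_assoc]
  linear_combination (-I * (1 - ε₁ - ε₃ - circ ε₂ z.1)) *
    exp_sub_one_mul_logCirc_mul h₂ q ((p - 1) * log (seg ε₁ (1 - ε₃ - circ ε₂ z.1) z.2) +
      (r - 1) * log (seg (1 - ε₁ - circ ε₂ z.1) ε₃ z.2)) z.1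

/-- Here the three functions are (L, t₂, t₁); the transposition of the outer barycentric coordinates
is swap, `flip₂₃`, swap. -/
theorem moment_tube₃ (hp : 1 < p.re) (hq : 1 < q.re) (hr : 1 < r.re) (h₁ : 0 < ε₁) (h₂ : 0 < ε₂)
    (h₃ : 0 < ε₃) (h : ε₁ + ε₂ + ε₃ < 1) :
    (tube₃ ε₁ ε₂ ε₃ x).moment p q r =
      (1 - e2pi r) * ∫ z in Prod.swap ⁻¹' (flip₂₃ ⁻¹' (Prod.swap ⁻¹' sideTile ε₃ ε₂ ε₁)),
        dirichletKernel p q r z := by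
  have e1 := tube_integral (P := r) (Q := q) (R := p) hr h₃ h₂ h₁ (by linarith)
  rw [← setIntegral_sideTile (continuous_dirichletKernel hr hq hp) h₃ h₂ h₁ (by linarith),
    setIntegral_comp_eq measurePreserving_swap_real measurableEmbedding_swap_real
      (dirichletKernel_swap q r p),
    setIntegral_comp_eq measurePreserving_flip₂₃ measurableEmbedding_flip₂₃
      (dirichletKernel_flip₂₃ q p r),
    setIntegral_comp_eq measurePreserving_swap_real measurableEmbedding_swap_real
      (dirichletKernel_swap p q r)] at e1
  rw [← neg_sub, neg_mul, ← e1, ← integral_neg]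
  refine integral_congr_ae (.of_forall fun z => ?_)
  have hL : 1 - circ ε₃ z.1 - seg (1 - ε₂ - circ ε₃ z.1) ε₁ z.2 =
      seg ε₂ (1 - ε₁ - circ ε₃ z.1) z.2 := by
    simp only [seg]
    ring
  simp only [jac_tube₃]
  simp only [tube₃, cellM, hL]
  rw [add_comm _ ((r - 1) * _), add_comm ((p - 1) * _)]
  linear_combination (-I * (1 - ε₂ - ε₁ - circ ε₃ z.1)) *
    exp_sub_one_mul_logCirc_mul h₃ r ((q - 1) * log (seg ε₂ (1 - ε₁ - circ ε₃ z.1) z.2) +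
      (p - 1) * log (seg (1 - ε₂ - circ ε₃ z.1) ε₁ z.2)) z.1

theorem torus_integrand_eq {e₁ e₂ : ℝ} (h₁ : 0 < e₁) (h₂ : 0 < e₂) (P Q w : ℂ) (θ φ : ℝ) :
    exp ((P - 1) * logCirc e₁ θ + (Q - 1) * logCirc e₂ φ + w) * (circ e₁ θ * I * (circ e₂ φ * I)) =
      exp (P * logCirc e₁ θ) * (I * (exp (Q * logCirc e₂ φ) * (I * exp w))) := by
  rw [add_assoc]
  linear_combination I * circ e₂ φ * I * exp_sub_one_mul_logCirc_mul h₁ P ((Q - 1) * logCirc e₂ φ + w) θ +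
    exp (P * logCirc e₁ θ) * I * I * exp_sub_one_mul_logCirc_mul h₂ Q w φ

theorem moment_torus₁₂ (hp : 1 < p.re) (hq : 1 < q.re) (hr : 1 < r.re) (h₁ : 0 < ε₁) (h₂ : 0 < ε₂)
    (h : ε₁ + ε₂ < 1) :
    (torus₁₂ ε₁ ε₂ x).moment p q r =
      (1 - e2pi p) * (1 - e2pi q) * ∫ z in cornerTile ε₁ ε₂, dirichletKernel p q r z := by
  have e1 := torus_integral (P := p) (Q := q) (R := r) hp hq h₁ h₂ h
  rw [← setIntegral_cornerTile (continuous_dirichletKernel hp hq hr) h₁ h₂] at e1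
  trans (e2pi p - 1) * ((e2pi q - 1) * ∫ z in cornerTile ε₁ ε₂, dirichletKernel p q r z)
  · rw [← e1]
    refine integral_congr_ae (.of_forall fun z => ?_)
    simp only [jac_torus₁₂]
    exact torus_integrand_eq h₁ h₂ p q _ z.1 z.2
  · ring

theorem moment_torus₂₃ (hp : 1 < p.re) (hq : 1 < q.re) (hr : 1 < r.re) (h₂ : 0 < ε₂) (h₃ : 0 < ε₃)
    (h : ε₂ + ε₃ < 1) :
    (torus₂₃ ε₂ ε₃ x).moment p q r =
      (1 - e2pi q) * (1 - e2pi r) *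
        ∫ z in Prod.swap ⁻¹' (flip₂₃ ⁻¹' cornerTile ε₂ ε₃), dirichletKernel p q r z := by
  have e1 := torus_integral (P := q) (Q := r) (R := p) hq hr h₂ h₃ h
  rw [← setIntegral_cornerTile (continuous_dirichletKernel hq hr hp) h₂ h₃,
    setIntegral_comp_eq measurePreserving_flip₂₃ measurableEmbedding_flip₂₃
      (dirichletKernel_flip₂₃ q p r),
    setIntegral_comp_eq measurePreserving_swap_real measurableEmbedding_swap_real
      (dirichletKernel_swap p q r)] at e1
  rw [← neg_sub, ← neg_sub (e2pi r), neg_mul_neg, mul_assoc, ← e1]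
  refine integral_congr_ae (.of_forall fun z => ?_)
  simp only [jac_torus₂₃]
  rw [← torus_integrand_eq h₂ h₃]
  simp only [torus₂₃, cellM]
  ring_nf

theorem moment_torus₃₁ (hp : 1 < p.re) (hq : 1 < q.re) (hr : 1 < r.re) (h₁ : 0 < ε₁) (h₃ : 0 < ε₃)
    (h : ε₁ + ε₃ < 1) :
    (torus₃₁ ε₁ ε₃ x).moment p q r =
      (1 - e2pi r) * (1 - e2pi p) *
        ∫ z in flip₂₃ ⁻¹' (Prod.swap ⁻¹' cornerTile ε₃ ε₁), dirichletKernel p q r z := by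
  have e1 := torus_integral (P := r) (Q := p) (R := q) hr hp h₃ h₁ (by linarith)
  rw [← setIntegral_cornerTile (continuous_dirichletKernel hr hp hq) h₃ h₁,
    setIntegral_comp_eq measurePreserving_swap_real measurableEmbedding_swap_real
      (dirichletKernel_swap p r q),
    setIntegral_comp_eq measurePreserving_flip₂₃ measurableEmbedding_flip₂₃
      (dirichletKernel_flip₂₃ p q r)] at e1
  rw [← neg_sub, ← neg_sub (e2pi p), neg_mul_neg, mul_assoc, ← e1]
  refine integral_congr_ae (.of_forall fun z => ?_)
  simp only [jac_torus₃₁]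
  rw [← torus_integrand_eq h₃ h₁]
  simp only [torus₃₁, cellM]
  ring_nf

/-- The coefficients of the chain cancel the factors 1 - e2pi of the tubes and tori, leaving the
seven tiles of the simplex, each with weight one. -/
theorem moment_regTriangle_of_one_lt_re (hp : 1 < p.re) (hq : 1 < q.re) (hr : 1 < r.re)
    (hp1 : e2pi p ≠ 1) (hq1 : e2pi q ≠ 1) (hr1 : e2pi r ≠ 1)
    (h₁ : 0 < ε₁) (h₂ : 0 < ε₂) (h₃ : 0 < ε₃) (h : ε₁ + ε₂ + ε₃ < 1) :
    (regTriangle (e2pi p) (e2pi q) (e2pi r) ε₁ ε₂ ε₃ x).moment p q r =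
      Gamma p * Gamma q * Gamma r / Gamma (p + q + r) := by
  rw [← setIntegral_simplex hp hq hr,
    setIntegral_simplex_tiling (continuous_dirichletKernel hp hq hr) h₁ h₂ h₃ h]
  simp only [TwistedChain.moment, regTriangle, List.map_cons, List.map_nil, List.sum_cons,
    List.sum_nil]
  rw [moment_triangle h₁ h₂ h₃, moment_tube₁ hp hq hr h₁ h₂ h₃ h, moment_tube₂ hp hq hr h₁ h₂ h₃ h,
    moment_tube₃ hp hq hr h₁ h₂ h₃ h, moment_torus₁₂ hp hq hr h₁ h₂ (by linarith),
    moment_torus₂₃ hp hq hr h₂ h₃ (by linarith), moment_torus₃₁ hp hq hr h₁ h₃ (by linarith)]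
  have n1 := sub_ne_zero.2 hp1.symm
  have n2 := sub_ne_zero.2 hq1.symm
  have n3 := sub_ne_zero.2 hr1.symm
  field_simp
  ring

end AppellF4

/-! ### Regular cells and holomorphy of the moments in the exponents -/

namespace AppellF4

theorem isCompact_tubeDom : IsCompact tubeDom := isCompact_Icc.prod isCompact_Icc

theorem isCompact_torusDom : IsCompact torusDom := isCompact_Icc.prod isCompact_Icc

theorem isCompact_innerTile (ε₁ ε₂ ε₃ : ℝ) : IsCompact (innerTile ε₁ ε₂ ε₃) := by
  have h1 : IsClosed {z : ℝ × ℝ | ε₁ ≤ z.1} := isClosed_le (by fun_prop) (by fun_prop)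
  have h2 : IsClosed {z : ℝ × ℝ | ε₂ ≤ z.2} := isClosed_le (by fun_prop) (by fun_prop)
  have h3 : IsClosed {z : ℝ × ℝ | ε₃ ≤ 1 - z.1 - z.2} := isClosed_le (by fun_prop) (by fun_prop)
  refine (isCompact_Icc.prod isCompact_Icc :
    IsCompact (Set.Icc ε₁ (1 - ε₂ - ε₃) ×ˢ Set.Icc ε₂ (1 - ε₁ - ε₃))).of_isClosed_subset
    (h1.inter (h2.inter h3)) fun z hz => ?_
  obtain ⟨z1, z2, z3⟩ := hz
  exact ⟨⟨z1, by linarith⟩, z2, by linarith⟩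

/-- A cell with compact parameter region, smooth parametrization and continuous logarithms, which
stays away from the lines `t₁ = 0` and `t₂ = 0` and on which `log M` is the principal
logarithm. -/
structure LoadedCell.IsRegular (σ : LoadedCell) (ε₁ ε₂ : ℝ) (x : ℂ × ℂ) : Prop where
  isCompact : IsCompact σ.dom
  diff₁ : Differentiable ℝ σ.t₁
  diff₂ : Differentiable ℝ σ.t₂
  cont_log₁ : ContinuousOn σ.logt₁ σ.dom
  cont_log₂ : ContinuousOn σ.logt₂ σ.dom
  cont_logL : ContinuousOn σ.logL σ.dom
  exp_log₁ : ∀ p ∈ σ.dom, exp (σ.logt₁ p) = σ.t₁ p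
  exp_log₂ : ∀ p ∈ σ.dom, exp (σ.logt₂ p) = σ.t₂ p
  le₁ : ∀ p ∈ σ.dom, ε₁ ≤ ‖σ.t₁ p‖
  le₂ : ∀ p ∈ σ.dom, ε₂ ≤ ‖σ.t₂ p‖
  cont_jac : Continuous σ.jac
  logM_eq : ∀ p, σ.logM p = log (1 - x.1 / σ.t₁ p - x.2 / σ.t₂ p)

theorem differentiable_ofReal_fst : Differentiable ℝ fun p : ℝ × ℝ => (p.1 : ℂ) :=
  ofRealCLM.differentiable.comp differentiable_fst

theorem differentiable_ofReal_snd : Differentiable ℝ fun p : ℝ × ℝ => (p.2 : ℂ) :=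
  ofRealCLM.differentiable.comp differentiable_snd

theorem differentiable_circ (ε : ℝ) : Differentiable ℝ (circ ε) := fun θ =>
  (hasDerivAt_circ ε θ).differentiableAt

theorem differentiable_circ_fst (ε : ℝ) : Differentiable ℝ fun p : ℝ × ℝ => circ ε p.1 :=
  (differentiable_circ ε).comp differentiable_fst

theorem differentiable_circ_snd (ε : ℝ) : Differentiable ℝ fun p : ℝ × ℝ => circ ε p.2 :=
  (differentiable_circ ε).comp differentiable_snd

theorem re_circ_le {ε : ℝ} (hε : 0 < ε) (θ : ℝ) : (circ ε θ).re ≤ ε :=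
  (re_le_norm _).trans (norm_circ hε θ).le

theorem le_norm_of_le_re {m : ℝ} {z : ℂ} (h : m ≤ z.re) : m ≤ ‖z‖ := h.trans (re_le_norm z)

theorem ContinuousOn.clog_of_re {S : Set (ℝ × ℝ)} {f : ℝ × ℝ → ℂ} {m : ℝ} (hm : 0 < m)
    (hf : Differentiable ℝ f) (h : ∀ p ∈ S, m ≤ (f p).re) : ContinuousOn (fun p => log (f p)) S :=
  hf.continuous.continuousOn.clog fun p hp => mem_slitPlane_of_re_pos (hm.trans_le (h p hp))

theorem exp_log_of_re {m : ℝ} (hm : 0 < m) {z : ℂ} (h : m ≤ z.re) : exp (log z) = z :=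
  exp_log fun h0 => by
    rw [h0, zero_re] at h
    linarith

variable {ε₁ ε₂ ε₃ : ℝ} {x : ℂ × ℂ}

theorem isRegular_triangle (h₁ : 0 < ε₁) (h₂ : 0 < ε₂) (h₃ : 0 < ε₃) :
    (triangle ε₁ ε₂ ε₃ x).IsRegular ε₁ ε₂ x where
  isCompact := isCompact_innerTile ε₁ ε₂ ε₃
  diff₁ := differentiable_ofReal_fst
  diff₂ := differentiable_ofReal_snd
  cont_log₁ := continuous_ofReal.comp_continuousOn
    (continuous_fst.continuousOn.log fun p hp => (h₁.trans_le hp.1).ne')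
  cont_log₂ := continuous_ofReal.comp_continuousOn
    (continuous_snd.continuousOn.log fun p hp => (h₂.trans_le hp.2.1).ne')
  cont_logL := continuous_ofReal.comp_continuousOn
    ((by fun_prop : Continuous fun p : ℝ × ℝ => 1 - p.1 - p.2).continuousOn.log
      fun p hp => (h₃.trans_le hp.2.2).ne')
  exp_log₁ p hp := by
    change exp (Real.log p.1 : ℂ) = p.1
    rw [← ofReal_exp, Real.exp_log (h₁.trans_le hp.1)]
  exp_log₂ p hp := by
    change exp (Real.log p.2 : ℂ) = p.2
    rw [← ofReal_exp, Real.exp_log (h₂.trans_le hp.2.1)]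
  le₁ p hp := le_norm_of_le_re hp.1
  le₂ p hp := le_norm_of_le_re hp.2.1
  cont_jac := (continuous_const (y := (1 : ℂ))).congr fun p => (jac_triangle ε₁ ε₂ ε₃ x p).symm
  logM_eq p := rfl

theorem isRegular_tube₁ (h₁ : 0 < ε₁) (h₂ : 0 < ε₂) (h₃ : 0 < ε₃) (h : ε₁ + ε₂ + ε₃ < 1) :
    (tube₁ ε₁ ε₂ ε₃ x).IsRegular ε₁ ε₂ x := by
  have d1 := differentiable_circ_fst ε₁
  have d2 : Differentiable ℝ fun p : ℝ × ℝ => seg (1 - ε₃ - circ ε₁ p.1) ε₂ p.2 := by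
    have := differentiable_ofReal_snd
    unfold seg
    fun_prop
  have r2 : ∀ p ∈ tubeDom, ε₂ ≤ (seg (1 - ε₃ - circ ε₁ p.1) ε₂ p.2).re := fun p hp => by
    refine le_re_seg hp.2 ?_ (by simp)
    have := re_circ_le h₁ p.1
    simp
    linarith
  have r3 : ∀ p ∈ tubeDom,
      ε₃ ≤ (1 - circ ε₁ p.1 - seg (1 - ε₃ - circ ε₁ p.1) ε₂ p.2).re := fun p hp => by
    have hL : 1 - circ ε₁ p.1 - seg (1 - ε₃ - circ ε₁ p.1) ε₂ p.2 =
        seg ε₃ (1 - ε₂ - circ ε₁ p.1) p.2 := by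
      simp only [seg]
      ring
    rw [hL]
    refine le_re_seg hp.2 (by simp) ?_
    have := re_circ_le h₁ p.1
    simp
    linarith
  exact
  { isCompact := isCompact_tubeDom
    diff₁ := d1
    diff₂ := d2
    cont_log₁ := ((continuous_logCirc ε₁).comp continuous_fst).continuousOn
    cont_log₂ := ContinuousOn.clog_of_re h₂ d2 r2
    cont_logL := ContinuousOn.clog_of_re h₃ ((d1.const_sub 1).sub d2) r3
    exp_log₁ := fun p _ => exp_logCirc h₁ p.1
    exp_log₂ := fun p hp => exp_log_of_re h₂ (r2 p hp)
    le₁ := fun p _ => (norm_circ h₁ p.1).ge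
    le₂ := fun p hp => le_norm_of_le_re (r2 p hp)
    cont_jac := by
      rw [funext (jac_tube₁ ε₁ ε₂ ε₃ x)]
      have := d1.continuous
      fun_prop
    logM_eq := fun p => rfl }

theorem isRegular_tube₂ (h₁ : 0 < ε₁) (h₂ : 0 < ε₂) (h₃ : 0 < ε₃) (h : ε₁ + ε₂ + ε₃ < 1) :
    (tube₂ ε₁ ε₂ ε₃ x).IsRegular ε₁ ε₂ x := by
  have d2 := differentiable_circ_fst ε₂
  have d1 : Differentiable ℝ fun p : ℝ × ℝ => seg ε₁ (1 - ε₃ - circ ε₂ p.1) p.2 := by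
    have := differentiable_ofReal_snd
    unfold seg
    fun_prop
  have r1 : ∀ p ∈ tubeDom, ε₁ ≤ (seg ε₁ (1 - ε₃ - circ ε₂ p.1) p.2).re := fun p hp => by
    refine le_re_seg hp.2 (by simp) ?_
    have := re_circ_le h₂ p.1
    simp
    linarith
  have r3 : ∀ p ∈ tubeDom,
      ε₃ ≤ (1 - seg ε₁ (1 - ε₃ - circ ε₂ p.1) p.2 - circ ε₂ p.1).re := fun p hp => by
    have hL : 1 - seg ε₁ (1 - ε₃ - circ ε₂ p.1) p.2 - circ ε₂ p.1 =
        seg (1 - ε₁ - circ ε₂ p.1) ε₃ p.2 := by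
      simp only [seg]
      ring
    rw [hL]
    refine le_re_seg hp.2 ?_ (by simp)
    have := re_circ_le h₂ p.1
    simp
    linarith
  exact
  { isCompact := isCompact_tubeDom
    diff₁ := d1
    diff₂ := d2
    cont_log₁ := ContinuousOn.clog_of_re h₁ d1 r1
    cont_log₂ := ((continuous_logCirc ε₂).comp continuous_fst).continuousOn
    cont_logL := ContinuousOn.clog_of_re h₃ ((d1.const_sub 1).sub d2) r3
    exp_log₁ := fun p hp => exp_log_of_re h₁ (r1 p hp)
    exp_log₂ := fun p _ => exp_logCirc h₂ p.1
    le₁ := fun p hp => le_norm_of_le_re (r1 p hp)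
    le₂ := fun p _ => (norm_circ h₂ p.1).ge
    cont_jac := by
      rw [funext (jac_tube₂ ε₁ ε₂ ε₃ x)]
      have := d2.continuous
      fun_prop
    logM_eq := fun p => rfl }

theorem isRegular_tube₃ (h₁ : 0 < ε₁) (h₂ : 0 < ε₂) (h₃ : 0 < ε₃) (h : ε₁ + ε₂ + ε₃ < 1) :
    (tube₃ ε₁ ε₂ ε₃ x).IsRegular ε₁ ε₂ x := by
  have d3 := differentiable_circ_fst ε₃
  have d1 : Differentiable ℝ fun p : ℝ × ℝ => seg (1 - ε₂ - circ ε₃ p.1) ε₁ p.2 := by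
    have := differentiable_ofReal_snd
    unfold seg
    fun_prop
  have d2 := (d3.const_sub 1).sub d1
  have r1 : ∀ p ∈ tubeDom, ε₁ ≤ (seg (1 - ε₂ - circ ε₃ p.1) ε₁ p.2).re := fun p hp => by
    refine le_re_seg hp.2 ?_ (by simp)
    have := re_circ_le h₃ p.1
    simp
    linarith
  have r2 : ∀ p ∈ tubeDom,
      ε₂ ≤ (1 - circ ε₃ p.1 - seg (1 - ε₂ - circ ε₃ p.1) ε₁ p.2).re := fun p hp => by
    have hL : 1 - circ ε₃ p.1 - seg (1 - ε₂ - circ ε₃ p.1) ε₁ p.2 =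
        seg ε₂ (1 - ε₁ - circ ε₃ p.1) p.2 := by
      simp only [seg]
      ring
    rw [hL]
    refine le_re_seg hp.2 (by simp) ?_
    have := re_circ_le h₃ p.1
    simp
    linarith
  exact
  { isCompact := isCompact_tubeDom
    diff₁ := d1
    diff₂ := d2
    cont_log₁ := ContinuousOn.clog_of_re h₁ d1 r1
    cont_log₂ := ContinuousOn.clog_of_re h₂ d2 r2
    cont_logL := ((continuous_logCirc ε₃).comp continuous_fst).continuousOn
    exp_log₁ := fun p hp => exp_log_of_re h₁ (r1 p hp)
    exp_log₂ := fun p hp => exp_log_of_re h₂ (r2 p hp)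
    le₁ := fun p hp => le_norm_of_le_re (r1 p hp)
    le₂ := fun p hp => le_norm_of_le_re (r2 p hp)
    cont_jac := by
      rw [funext (jac_tube₃ ε₁ ε₂ ε₃ x)]
      have := d3.continuous
      fun_prop
    logM_eq := fun p => rfl }

theorem le_re_one_sub_circ_sub_circ {e₁ e₂ : ℝ} (h₁ : 0 < e₁) (h₂ : 0 < e₂) (θ φ : ℝ) :
    1 - e₁ - e₂ ≤ (1 - circ e₁ θ - circ e₂ φ).re := by
  have := re_circ_le h₁ θ
  have := re_circ_le h₂ φ
  simp
  linarith

theorem isRegular_torus₁₂ (h₁ : 0 < ε₁) (h₂ : 0 < ε₂) (h : ε₁ + ε₂ < 1) :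
    (torus₁₂ ε₁ ε₂ x).IsRegular ε₁ ε₂ x where
  isCompact := isCompact_torusDom
  diff₁ := differentiable_circ_fst ε₁
  diff₂ := differentiable_circ_snd ε₂
  cont_log₁ := ((continuous_logCirc ε₁).comp continuous_fst).continuousOn
  cont_log₂ := ((continuous_logCirc ε₂).comp continuous_snd).continuousOn
  cont_logL := ContinuousOn.clog_of_re (by linarith : 0 < 1 - ε₁ - ε₂)
    (((differentiable_circ_fst ε₁).const_sub 1).sub (differentiable_circ_snd ε₂))
    fun p _ => le_re_one_sub_circ_sub_circ h₁ h₂ p.1 p.2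
  exp_log₁ p _ := exp_logCirc h₁ p.1
  exp_log₂ p _ := exp_logCirc h₂ p.2
  le₁ p _ := (norm_circ h₁ p.1).ge
  le₂ p _ := (norm_circ h₂ p.2).ge
  cont_jac := by
    rw [funext (jac_torus₁₂ ε₁ ε₂ x)]
    have := (differentiable_circ_fst ε₁).continuous
    have := (differentiable_circ_snd ε₂).continuous
    fun_prop
  logM_eq p := rfl

theorem isRegular_torus₂₃ (h₂ : 0 < ε₂) (h₃ : 0 < ε₃) (h₁ : 0 < ε₁) (h : ε₁ + ε₂ + ε₃ < 1) :
    (torus₂₃ ε₂ ε₃ x).IsRegular ε₁ ε₂ x := by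
  have d2 := differentiable_circ_fst ε₂
  have d3 := differentiable_circ_snd ε₃
  have d1 := (d2.const_sub 1).sub d3
  have r1 : ∀ p ∈ torusDom, ε₁ ≤ (1 - circ ε₂ p.1 - circ ε₃ p.2).re := fun p _ =>
    (by linarith : ε₁ ≤ 1 - ε₂ - ε₃).trans (le_re_one_sub_circ_sub_circ h₂ h₃ p.1 p.2)
  exact
  { isCompact := isCompact_torusDom
    diff₁ := d1
    diff₂ := d2
    cont_log₁ := ContinuousOn.clog_of_re h₁ d1 r1
    cont_log₂ := ((continuous_logCirc ε₂).comp continuous_fst).continuousOn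
    cont_logL := ((continuous_logCirc ε₃).comp continuous_snd).continuousOn
    exp_log₁ := fun p hp => exp_log_of_re h₁ (r1 p hp)
    exp_log₂ := fun p _ => exp_logCirc h₂ p.1
    le₁ := fun p hp => le_norm_of_le_re (r1 p hp)
    le₂ := fun p _ => (norm_circ h₂ p.1).ge
    cont_jac := by
      rw [funext (jac_torus₂₃ ε₂ ε₃ x)]
      have := d2.continuous
      have := d3.continuous
      fun_prop
    logM_eq := fun p => rfl }

theorem isRegular_torus₃₁ (h₁ : 0 < ε₁) (h₃ : 0 < ε₃) (h₂ : 0 < ε₂) (h : ε₁ + ε₂ + ε₃ < 1) :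
    (torus₃₁ ε₁ ε₃ x).IsRegular ε₁ ε₂ x := by
  have d1 := differentiable_circ_snd ε₁
  have d3 := differentiable_circ_fst ε₃
  have d2 := (d3.const_sub 1).sub d1
  have r2 : ∀ p ∈ torusDom, ε₂ ≤ (1 - circ ε₃ p.1 - circ ε₁ p.2).re := fun p _ =>
    (by linarith : ε₂ ≤ 1 - ε₃ - ε₁).trans (le_re_one_sub_circ_sub_circ h₃ h₁ p.1 p.2)
  exact
  { isCompact := isCompact_torusDom
    diff₁ := d1
    diff₂ := d2
    cont_log₁ := ((continuous_logCirc ε₁).comp continuous_snd).continuousOn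
    cont_log₂ := ContinuousOn.clog_of_re h₂ d2 r2
    cont_logL := ((continuous_logCirc ε₃).comp continuous_fst).continuousOn
    exp_log₁ := fun p _ => exp_logCirc h₁ p.2
    exp_log₂ := fun p hp => exp_log_of_re h₂ (r2 p hp)
    le₁ := fun p _ => (norm_circ h₁ p.2).ge
    le₂ := fun p hp => le_norm_of_le_re (r2 p hp)
    cont_jac := by
      rw [funext (jac_torus₃₁ ε₁ ε₃ x)]
      have := d1.continuous
      have := d3.continuous
      fun_prop
    logM_eq := fun p => rfl }

theorem isRegular_regTriangle (h₁ : 0 < ε₁) (h₂ : 0 < ε₂) (h₃ : 0 < ε₃) (h : ε₁ + ε₂ + ε₃ < 1)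
    (m₁ m₂ m₃ : ℂ) : ∀ q ∈ regTriangle m₁ m₂ m₃ ε₁ ε₂ ε₃ x, q.2.IsRegular ε₁ ε₂ x := by
  simp only [regTriangle, List.forall_mem_cons, List.not_mem_nil, false_imp_iff, implies_true,
    and_true]
  exact ⟨isRegular_triangle h₁ h₂ h₃, isRegular_tube₁ h₁ h₂ h₃ h, isRegular_tube₂ h₁ h₂ h₃ h,
    isRegular_tube₃ h₁ h₂ h₃ h, isRegular_torus₁₂ h₁ h₂ (by linarith),
    isRegular_torus₂₃ h₂ h₃ h₁ h, isRegular_torus₃₁ h₁ h₃ h₂ h⟩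

/-- Differentiation under the integral: on a compact K the s-derivative is bounded uniformly for s
in the unit ball about s₀, where ‖s - 1‖ ≤ ‖s₀‖ + 2. -/
theorem differentiable_integral_exp {K : Set (ℝ × ℝ)} (hK : IsCompact K) {u w J : ℝ × ℝ → ℂ}
    (hu : ContinuousOn u K) (hw : ContinuousOn w K) (hJ : ContinuousOn J K) :
    Differentiable ℂ fun s : ℂ => ∫ z in K, exp ((s - 1) * u z + w z) * J z := by
  intro s₀
  obtain ⟨B, hB⟩ := hK.exists_bound_of_continuousOn hu
  obtain ⟨W, hW⟩ := hK.exists_bound_of_continuousOn hw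
  obtain ⟨C, hC⟩ := hK.exists_bound_of_continuousOn hJ
  have hKm := hK.measurableSet
  have hF (s : ℂ) : ContinuousOn (fun z => exp ((s - 1) * u z + w z) * J z) K := by fun_prop
  have hF' (s : ℂ) : ContinuousOn (fun z => exp ((s - 1) * u z + w z) * u z * J z) K := by fun_prop
  have key := hasDerivAt_integral_of_dominated_loc_of_deriv_le (𝕜 := ℂ) (μ := volume.restrict K)
    (F := fun s z => exp ((s - 1) * u z + w z) * J z)
    (F' := fun s z => exp ((s - 1) * u z + w z) * u z * J z) (x₀ := s₀)
    (bound := fun _ => Real.exp ((‖s₀‖ + 2) * B + W) * B * C)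
    (Metric.ball_mem_nhds s₀ one_pos)
    (.of_forall fun s => (hF s).aestronglyMeasurable hKm)
    ((hF s₀).integrableOn_compact hK)
    ((hF' s₀).aestronglyMeasurable hKm) ?_ ?_ ?_
  · exact key.2.differentiableAt
  · refine (ae_restrict_iff' hKm).2 (.of_forall fun z hz s hs => ?_)
    have hs1 : ‖s - 1‖ ≤ ‖s₀‖ + 2 := by
      have h1 : ‖s - s₀‖ < 1 := by simpa [dist_eq_norm] using hs
      calc ‖s - 1‖ = ‖(s - s₀) + s₀ - 1‖ := by ring_nf
        _ ≤ ‖s - s₀‖ + ‖s₀‖ + ‖(1 : ℂ)‖ := (norm_sub_le _ _).trans (by gcongr; exact norm_add_le _ _)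
        _ ≤ _ := by
          rw [norm_one]
          linarith
    have hB0 : 0 ≤ B := (norm_nonneg _).trans (hB z hz)
    rw [norm_mul, norm_mul, norm_exp]
    have h2 : ((s - 1) * u z + w z).re ≤ (‖s₀‖ + 2) * B + W := by
      refine (re_le_norm _).trans ((norm_add_le _ _).trans ?_)
      rw [norm_mul]
      gcongr
      · exact hB z hz
      · exact hW z hz
    gcongr
    · exact hB z hz
    · exact hC z hz
  · exact continuousOn_const.integrableOn_compact hK
  · refine .of_forall fun z s _ => ?_
    have h1 : HasDerivAt (fun s : ℂ => (s - 1) * u z + w z) (u z) s := by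
      simpa using (((hasDerivAt_id s).sub_const 1).mul_const (u z)).add_const (w z)
    exact h1.cexp.mul_const (J z)

variable {σ : LoadedCell}

theorem LoadedCell.IsRegular.differentiable_moment₁ (hσ : σ.IsRegular ε₁ ε₂ x) (q r : ℂ) :
    Differentiable ℂ fun p => σ.moment p q r := by
  have h1 := hσ.cont_log₂
  have h2 := hσ.cont_logL
  have := differentiable_integral_exp hσ.isCompact hσ.cont_log₁
    (w := fun z => (q - 1) * σ.logt₂ z + (r - 1) * σ.logL z) (by fun_prop) hσ.cont_jac.continuousOn
  simpa only [LoadedCell.moment, add_assoc] using this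

theorem LoadedCell.IsRegular.differentiable_moment₂ (hσ : σ.IsRegular ε₁ ε₂ x) (p r : ℂ) :
    Differentiable ℂ fun q => σ.moment p q r := by
  have h1 := hσ.cont_log₁
  have h2 := hσ.cont_logL
  have := differentiable_integral_exp hσ.isCompact hσ.cont_log₂
    (w := fun z => (p - 1) * σ.logt₁ z + (r - 1) * σ.logL z) (by fun_prop) hσ.cont_jac.continuousOn
  simpa only [LoadedCell.moment, add_assoc, add_left_comm] using this

theorem LoadedCell.IsRegular.differentiable_moment₃ (hσ : σ.IsRegular ε₁ ε₂ x) (p q : ℂ) :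
    Differentiable ℂ fun r => σ.moment p q r := by
  have h1 := hσ.cont_log₁
  have h2 := hσ.cont_log₂
  have := differentiable_integral_exp hσ.isCompact hσ.cont_logL
    (w := fun z => (p - 1) * σ.logt₁ z + (q - 1) * σ.logt₂ z) (by fun_prop) hσ.cont_jac.continuousOn
  simpa only [LoadedCell.moment, add_comm] using this

theorem differentiable_e2pi : Differentiable ℂ e2pi := by
  unfold e2pi
  fun_prop

theorem e2pi_eq_one_iff {z : ℂ} : e2pi z = 1 ↔ ∃ k : ℤ, z = k := by
  rw [e2pi, exp_eq_one_iff]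
  refine exists_congr fun k => ?_
  rw [mul_comm (k : ℂ)]
  exact mul_right_inj' two_pi_I_ne_zero

/-- The complement of ℤ in ℂ is open, and connected because ℤ is countable, so the identity theorem
applies from a neighbourhood of 2 + i. -/
theorem eq_of_eq_of_one_lt_re {f g : ℂ → ℂ} (hf : ∀ s : ℂ, (∀ k : ℤ, s ≠ k) → DifferentiableAt ℂ f s)
    (hg : ∀ s : ℂ, (∀ k : ℤ, s ≠ k) → DifferentiableAt ℂ g s)
    (h : ∀ s : ℂ, (∀ k : ℤ, s ≠ k) → 1 < s.re → f s = g s) {s : ℂ} (hs : ∀ k : ℤ, s ≠ k) :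
    f s = g s := by
  have hS : (Set.range ((↑) : ℤ → ℂ))ᶜ = {s : ℂ | ∀ k : ℤ, s ≠ k} := by
    ext z
    simp [eq_comm]
  have hSo : IsOpen {s : ℂ | ∀ k : ℤ, s ≠ k} := by
    rw [← hS]
    exact isClosed_range_intCast.isOpen_compl
  have hSc : IsPreconnected {s : ℂ | ∀ k : ℤ, s ≠ k} := by
    rw [← hS]
    refine ((Set.countable_range _).isPathConnected_compl_of_one_lt_rank ?_).isConnected.isPreconnected
    rw [rank_real_complex]
    exact Cardinal.one_lt_two
  have fa : AnalyticOnNhd ℂ f {s : ℂ | ∀ k : ℤ, s ≠ k} :=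
    DifferentiableOn.analyticOnNhd (fun s hs => (hf s hs).differentiableWithinAt) hSo
  have ga : AnalyticOnNhd ℂ g {s : ℂ | ∀ k : ℤ, s ≠ k} :=
    DifferentiableOn.analyticOnNhd (fun s hs => (hg s hs).differentiableWithinAt) hSo
  have h2 : (2 + I : ℂ) ∈ {s : ℂ | ∀ k : ℤ, s ≠ k} := fun k hk => by
    simpa using congrArg Complex.im hk
  refine fa.eqOn_of_preconnected_of_eventuallyEq ga hSc h2 ?_ hs
  have h3 : {s : ℂ | 1 < s.re} ∈ 𝓝 (2 + I : ℂ) :=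
    (isOpen_lt continuous_const continuous_re).mem_nhds (by simp)
  filter_upwards [h3, hSo.mem_nhds h2] with s hs1 hs2 using h s hs2 hs1

end AppellF4

/-! ### Continuation of Dirichlet's formula to non-integral exponents -/

namespace AppellF4

variable {ε₁ ε₂ ε₃ : ℝ} {x : ℂ × ℂ}

theorem differentiableAt_Gamma_of_ne_int {s : ℂ} (hs : ∀ k : ℤ, s ≠ k) : DifferentiableAt ℂ Gamma s :=
  differentiableAt_Gamma s fun m h => hs (-m) (by simp [h])

theorem one_sub_e2pi_ne_zero {s : ℂ} (hs : ∀ k : ℤ, s ≠ k) : 1 - e2pi s ≠ 0 := by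
  rw [sub_ne_zero, ne_comm, Ne, e2pi_eq_one_iff]
  exact fun ⟨k, hk⟩ => hs k hk

/-- Only p is freed here, with q and r kept in the half-plane Re > 1; q and then r follow in the
next two results, so the one-variable identity theorem suffices. -/
theorem moment_regTriangle_continuation₁ (h₁ : 0 < ε₁) (h₂ : 0 < ε₂) (h₃ : 0 < ε₃)
    (h : ε₁ + ε₂ + ε₃ < 1) {p q r : ℂ} (hp : ∀ k : ℤ, p ≠ k) (hq1 : 1 < q.re) (hr1 : 1 < r.re)
    (hq : ∀ k : ℤ, q ≠ k) (hr : ∀ k : ℤ, r ≠ k) :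
    (regTriangle (e2pi p) (e2pi q) (e2pi r) ε₁ ε₂ ε₃ x).moment p q r =
      Gamma p * Gamma q * Gamma r / Gamma (p + q + r) := by
  -- The cells do not depend on the multipliers, so any values, here 0, give their regularity.
  have hreg := isRegular_regTriangle (x := x) h₁ h₂ h₃ h 0 0 0
  simp only [regTriangle, List.forall_mem_cons, List.not_mem_nil, false_imp_iff, implies_true,
    and_true] at hreg
  obtain ⟨d1, d2, d3, d4, d5, d6, d7⟩ := hreg
  refine eq_of_eq_of_one_lt_re
    (f := fun p => (regTriangle (e2pi p) (e2pi q) (e2pi r) ε₁ ε₂ ε₃ x).moment p q r)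
    (g := fun p => Gamma p * Gamma q * Gamma r / Gamma (p + q + r)) (fun s hs => ?_)
    (fun s hs => ?_) (fun s hs hs1 => ?_) hp
  · have n1 := one_sub_e2pi_ne_zero hs
    have n2 := one_sub_e2pi_ne_zero hq
    have n3 := one_sub_e2pi_ne_zero hr
    have := (d1.differentiable_moment₁ q r s)
    have := (d2.differentiable_moment₁ q r s)
    have := (d3.differentiable_moment₁ q r s)
    have := (d4.differentiable_moment₁ q r s)
    have := (d5.differentiable_moment₁ q r s)
    have := (d6.differentiable_moment₁ q r s)
    have := (d7.differentiable_moment₁ q r s)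
    have := differentiable_e2pi s
    simp only [TwistedChain.moment, regTriangle, List.map_cons, List.map_nil, List.sum_cons,
      List.sum_nil]
    fun_prop (disch := simp_all)
  · have e1 := differentiableAt_Gamma_of_ne_int hs
    -- Since 1/Γ is entire, no condition on p + q + r is needed.
    have e2 := differentiable_one_div_Gamma.comp
      (by fun_prop : Differentiable ℂ fun p => p + q + r) s
    simp only [div_eq_mul_inv]
    exact ((e1.mul_const _).mul_const _).mul e2
  · exact moment_regTriangle_of_one_lt_re hs1 hq1 hr1 (sub_ne_zero.1 (one_sub_e2pi_ne_zero hs)).symm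
      (sub_ne_zero.1 (one_sub_e2pi_ne_zero hq)).symm (sub_ne_zero.1 (one_sub_e2pi_ne_zero hr)).symm
      h₁ h₂ h₃ h

theorem moment_regTriangle_continuation₂ (h₁ : 0 < ε₁) (h₂ : 0 < ε₂) (h₃ : 0 < ε₃)
    (h : ε₁ + ε₂ + ε₃ < 1) {p q r : ℂ} (hr1 : 1 < r.re) (hp : ∀ k : ℤ, p ≠ k)
    (hq : ∀ k : ℤ, q ≠ k) (hr : ∀ k : ℤ, r ≠ k) :
    (regTriangle (e2pi p) (e2pi q) (e2pi r) ε₁ ε₂ ε₃ x).moment p q r =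
      Gamma p * Gamma q * Gamma r / Gamma (p + q + r) := by
  have hreg := isRegular_regTriangle (x := x) h₁ h₂ h₃ h 0 0 0
  simp only [regTriangle, List.forall_mem_cons, List.not_mem_nil, false_imp_iff, implies_true,
    and_true] at hreg
  obtain ⟨d1, d2, d3, d4, d5, d6, d7⟩ := hreg
  refine eq_of_eq_of_one_lt_re
    (f := fun q => (regTriangle (e2pi p) (e2pi q) (e2pi r) ε₁ ε₂ ε₃ x).moment p q r)
    (g := fun q => Gamma p * Gamma q * Gamma r / Gamma (p + q + r)) (fun s hs => ?_)
    (fun s hs => ?_) (fun s hs hs1 => ?_) hq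
  · have n1 := one_sub_e2pi_ne_zero hp
    have n2 := one_sub_e2pi_ne_zero hs
    have n3 := one_sub_e2pi_ne_zero hr
    have := (d1.differentiable_moment₂ p r s)
    have := (d2.differentiable_moment₂ p r s)
    have := (d3.differentiable_moment₂ p r s)
    have := (d4.differentiable_moment₂ p r s)
    have := (d5.differentiable_moment₂ p r s)
    have := (d6.differentiable_moment₂ p r s)
    have := (d7.differentiable_moment₂ p r s)
    have := differentiable_e2pi s
    simp only [TwistedChain.moment, regTriangle, List.map_cons, List.map_nil, List.sum_cons,
      List.sum_nil]
    fun_prop (disch := simp_all)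
  · have e1 := differentiableAt_Gamma_of_ne_int hs
    have e2 := differentiable_one_div_Gamma.comp
      (by fun_prop : Differentiable ℂ fun q => p + q + r) s
    simp only [div_eq_mul_inv]
    exact ((e1.const_mul _).mul_const _).mul e2
  · exact moment_regTriangle_continuation₁ h₁ h₂ h₃ h hp hs1 hr1 hs hr

/-- The integral of `t₁^{p-1} t₂^{q-1} L^{r-1} dt₁ ∧ dt₂` over the regularized triangle. -/
theorem moment_regTriangle (h₁ : 0 < ε₁) (h₂ : 0 < ε₂) (h₃ : 0 < ε₃)
    (h : ε₁ + ε₂ + ε₃ < 1) {p q r : ℂ} (hp : ∀ k : ℤ, p ≠ k)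
    (hq : ∀ k : ℤ, q ≠ k) (hr : ∀ k : ℤ, r ≠ k) :
    (regTriangle (e2pi p) (e2pi q) (e2pi r) ε₁ ε₂ ε₃ x).moment p q r =
      Gamma p * Gamma q * Gamma r / Gamma (p + q + r) := by
  have hreg := isRegular_regTriangle (x := x) h₁ h₂ h₃ h 0 0 0
  simp only [regTriangle, List.forall_mem_cons, List.not_mem_nil, false_imp_iff, implies_true,
    and_true] at hreg
  obtain ⟨d1, d2, d3, d4, d5, d6, d7⟩ := hreg
  refine eq_of_eq_of_one_lt_re
    (f := fun r => (regTriangle (e2pi p) (e2pi q) (e2pi r) ε₁ ε₂ ε₃ x).moment p q r)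
    (g := fun r => Gamma p * Gamma q * Gamma r / Gamma (p + q + r)) (fun s hs => ?_)
    (fun s hs => ?_) (fun s hs hs1 => ?_) hr
  · have n1 := one_sub_e2pi_ne_zero hp
    have n2 := one_sub_e2pi_ne_zero hq
    have n3 := one_sub_e2pi_ne_zero hs
    have := (d1.differentiable_moment₃ p q s)
    have := (d2.differentiable_moment₃ p q s)
    have := (d3.differentiable_moment₃ p q s)
    have := (d4.differentiable_moment₃ p q s)
    have := (d5.differentiable_moment₃ p q s)
    have := (d6.differentiable_moment₃ p q s)
    have := (d7.differentiable_moment₃ p q s)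
    have := differentiable_e2pi s
    simp only [TwistedChain.moment, regTriangle, List.map_cons, List.map_nil, List.sum_cons,
      List.sum_nil]
    fun_prop (disch := simp_all)
  · have e1 := differentiableAt_Gamma_of_ne_int hs
    have e2 := differentiable_one_div_Gamma.comp
      (by fun_prop : Differentiable ℂ fun r => p + q + r) s
    simp only [div_eq_mul_inv]
    exact (e1.const_mul _).mul e2
  · exact moment_regTriangle_continuation₂ h₁ h₂ h₃ h hs1 hp hq hs

end AppellF4

/-! ### Termwise integration over Δ₁, and Δ₄ by the involution -/

namespace AppellF4

theorem Gamma_one_sub_sub_natCast {c : ℂ} (hc : ∀ k : ℤ, c ≠ k) (n : ℕ) :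
    Gamma (1 - c - n) * poch c n = (-1) ^ n * Gamma (1 - c) := by
  induction n with
  | zero => simp [poch_zero]
  | succ n ih =>
    have h1 : -c - n ≠ 0 := fun h0 => hc (-n) (by push_cast; linear_combination -h0)
    have h2 := Gamma_add_one (-c - n) h1
    have h3 : -c - n + 1 = 1 - c - n := by ring
    have h4 : 1 - c - ((n + 1 : ℕ) : ℂ) = -c - n := by push_cast; ring
    rw [h3] at h2
    rw [h4, poch_succ, pow_succ]
    linear_combination -ih + poch c n * h2

/-- Stated for the reciprocal, the iterated functional equation holds for every a, including the
poles of Γ where both sides are read as zero values of 1/Γ. -/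
theorem inv_Gamma_one_sub_sub_natCast (a : ℂ) (n : ℕ) :
    (Gamma (1 - a - n))⁻¹ = (-1) ^ n * poch a n * (Gamma (1 - a))⁻¹ := by
  induction n with
  | zero => simp [poch_zero]
  | succ n ih =>
    have h2 := one_div_Gamma_eq_self_mul_one_div_Gamma_add_one (-a - n)
    have h3 : -a - n + 1 = 1 - a - n := by ring
    have h4 : 1 - a - ((n + 1 : ℕ) : ℂ) = -a - n := by push_cast; ring
    rw [h3, ih] at h2
    rw [h4, h2, poch_succ, pow_succ]
    ring

namespace LoadedCell.IsRegular

variable {σ : LoadedCell} {ε₁ ε₂ ε₃ : ℝ} {x : ℂ × ℂ}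

theorem norm_add_norm_lt_one (hσ : σ.IsRegular ε₁ ε₂ x) (hx : Admissible ε₁ ε₂ ε₃ x) {p : ℝ × ℝ}
    (hp : p ∈ σ.dom) : ‖x.1 / σ.t₁ p‖ + ‖x.2 / σ.t₂ p‖ < 1 := by
  have h₁ := hx.pos₁
  have h₂ := hx.pos₂
  refine lt_of_le_of_lt ?_ hx.enclose
  rw [norm_div, norm_div]
  gcongr
  · exact hσ.le₁ p hp
  · exact hσ.le₂ p hp

theorem re_one_sub_sub_pos (hσ : σ.IsRegular ε₁ ε₂ x) (hx : Admissible ε₁ ε₂ ε₃ x) {p : ℝ × ℝ}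
    (hp : p ∈ σ.dom) : 0 < (1 - x.1 / σ.t₁ p - x.2 / σ.t₂ p).re := by
  have h := hσ.norm_add_norm_lt_one hx hp
  have h1 := re_le_norm (x.1 / σ.t₁ p)
  have h2 := re_le_norm (x.2 / σ.t₂ p)
  simp only [sub_re, one_re]
  linarith

theorem t₁_ne_zero (hσ : σ.IsRegular ε₁ ε₂ x) {p : ℝ × ℝ} (hp : p ∈ σ.dom) : σ.t₁ p ≠ 0 := by
  rw [← hσ.exp_log₁ p hp]
  exact exp_ne_zero _

theorem t₂_ne_zero (hσ : σ.IsRegular ε₁ ε₂ x) {p : ℝ × ℝ} (hp : p ∈ σ.dom) : σ.t₂ p ≠ 0 := by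
  rw [← hσ.exp_log₂ p hp]
  exact exp_ne_zero _

theorem continuousOn_div₁ (hσ : σ.IsRegular ε₁ ε₂ x) :
    ContinuousOn (fun p => x.1 / σ.t₁ p) σ.dom :=
  continuousOn_const.div hσ.diff₁.continuous.continuousOn fun _ hp => hσ.t₁_ne_zero hp

theorem continuousOn_div₂ (hσ : σ.IsRegular ε₁ ε₂ x) :
    ContinuousOn (fun p => x.2 / σ.t₂ p) σ.dom :=
  continuousOn_const.div hσ.diff₂.continuous.continuousOn fun _ hp => hσ.t₂_ne_zero hp

theorem continuousOn_logM (hσ : σ.IsRegular ε₁ ε₂ x) (hx : Admissible ε₁ ε₂ ε₃ x) :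
    ContinuousOn σ.logM σ.dom := by
  rw [funext hσ.logM_eq]
  exact ((continuousOn_const.sub hσ.continuousOn_div₁).sub hσ.continuousOn_div₂).clog
    fun p hp => mem_slitPlane_of_re_pos (hσ.re_one_sub_sub_pos hx hp)

theorem continuousOn_pullback (hσ : σ.IsRegular ε₁ ε₂ x) (hx : Admissible ε₁ ε₂ ε₃ x)
    (a b c₁ c₂ : ℂ) : ContinuousOn (σ.pullback a b c₁ c₂) σ.dom := by
  have h1 := hσ.cont_log₁
  have h2 := hσ.cont_log₂
  have h3 := hσ.cont_logL
  have h4 := hσ.continuousOn_logM hx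
  have h5 := hσ.cont_jac.continuousOn (s := σ.dom)
  unfold LoadedCell.pullback
  fun_prop

theorem integrableOn_pullback (hσ : σ.IsRegular ε₁ ε₂ x) (hx : Admissible ε₁ ε₂ ε₃ x)
    (a b c₁ c₂ : ℂ) : IntegrableOn (σ.pullback a b c₁ c₂) σ.dom :=
  (hσ.continuousOn_pullback hx a b c₁ c₂).integrableOn_compact hσ.isCompact

/-- Admissibility gives |x₁/t₁| + |x₂/t₂| < 1 on the cell, and the chosen logarithm of M is the
principal one, so M^{-b} is the sum of its binomial series. -/
theorem hasSum_pullback (hσ : σ.IsRegular ε₁ ε₂ x) (hx : Admissible ε₁ ε₂ ε₃ x)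
    (a b c₁ c₂ : ℂ) {p : ℝ × ℝ} (hp : p ∈ σ.dom) :
    HasSum (fun n : ℕ × ℕ => poch b (n.1 + n.2) / (n.1.factorial * n.2.factorial) *
        ((x.1 / σ.t₁ p) ^ n.1 * (x.2 / σ.t₂ p) ^ n.2) *
        (exp (-c₁ * σ.logt₁ p - c₂ * σ.logt₂ p + (c₁ + c₂ - a - 2) * σ.logL p) * σ.jac p))
      (σ.pullback a b c₁ c₂ p) := by
  have h1 := (hasSum_binomial₂ b (hσ.norm_add_norm_lt_one hx hp)).mul_right
    (exp (-c₁ * σ.logt₁ p - c₂ * σ.logt₂ p + (c₁ + c₂ - a - 2) * σ.logL p) * σ.jac p)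
  have h2 : (1 - x.1 / σ.t₁ p - x.2 / σ.t₂ p) ≠ 0 := fun h0 => by
    have := hσ.re_one_sub_sub_pos hx hp
    rw [h0, zero_re] at this
    exact this.false
  have h3 : (1 - x.1 / σ.t₁ p - x.2 / σ.t₂ p) ^ (-b) *
      (exp (-c₁ * σ.logt₁ p - c₂ * σ.logt₂ p + (c₁ + c₂ - a - 2) * σ.logL p) * σ.jac p) =
      σ.pullback a b c₁ c₂ p := by
    rw [cpow_def_of_ne_zero h2, ← hσ.logM_eq, ← mul_assoc, ← exp_add, LoadedCell.pullback]
    ring_nf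
  rwa [h3] at h1

theorem integral_term (hσ : σ.IsRegular ε₁ ε₂ x) (a c₁ c₂ A : ℂ) (n : ℕ × ℕ) :
    ∫ p in σ.dom, A * ((x.1 / σ.t₁ p) ^ n.1 * (x.2 / σ.t₂ p) ^ n.2) *
        (exp (-c₁ * σ.logt₁ p - c₂ * σ.logt₂ p + (c₁ + c₂ - a - 2) * σ.logL p) * σ.jac p) =
      A * (x.1 ^ n.1 * x.2 ^ n.2) *
        σ.moment (1 - c₁ - n.1) (1 - c₂ - n.2) (c₁ + c₂ - a - 1) := by
  rw [LoadedCell.moment, ← integral_const_mul]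
  refine setIntegral_congr_fun hσ.isCompact.measurableSet fun p hp => ?_
  have e1 : (x.1 / σ.t₁ p) ^ n.1 = x.1 ^ n.1 * exp (-(n.1 * σ.logt₁ p)) := by
    rw [← hσ.exp_log₁ p hp, div_pow, exp_neg, exp_nat_mul, div_eq_mul_inv]
  have e2 : (x.2 / σ.t₂ p) ^ n.2 = x.2 ^ n.2 * exp (-(n.2 * σ.logt₂ p)) := by
    rw [← hσ.exp_log₂ p hp, div_pow, exp_neg, exp_nat_mul, div_eq_mul_inv]
  have e3 : exp ((1 - c₁ - n.1 - 1) * σ.logt₁ p + (1 - c₂ - n.2 - 1) * σ.logt₂ p +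
      (c₁ + c₂ - a - 1 - 1) * σ.logL p) = exp (-(n.1 * σ.logt₁ p)) * exp (-(n.2 * σ.logt₂ p)) *
      exp (-c₁ * σ.logt₁ p - c₂ * σ.logt₂ p + (c₁ + c₂ - a - 2) * σ.logL p) := by
    rw [← exp_add, ← exp_add]
    ring_nf
  simp only [e1, e2, e3]
  ring

/-- The binomial series at the radii ‖x₁‖/ε₁, ‖x₂‖/ε₂, whose sum is < 1, dominates uniformly on the
cell and justifies integrating term by term. -/
theorem hasSum_integral (hσ : σ.IsRegular ε₁ ε₂ x) (hx : Admissible ε₁ ε₂ ε₃ x) (a b c₁ c₂ : ℂ) :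
    HasSum (fun n : ℕ × ℕ => poch b (n.1 + n.2) / (n.1.factorial * n.2.factorial) *
        (x.1 ^ n.1 * x.2 ^ n.2) * σ.moment (1 - c₁ - n.1) (1 - c₂ - n.2) (c₁ + c₂ - a - 1))
      (∫ p in σ.dom, σ.pullback a b c₁ c₂ p) := by
  have hK := hσ.isCompact
  have u1 := hσ.continuousOn_div₁
  have u2 := hσ.continuousOn_div₂
  have l1 := hσ.cont_log₁
  have l2 := hσ.cont_log₂
  have l3 := hσ.cont_logL
  have l4 := hσ.cont_jac.continuousOn (s := σ.dom)
  have p1 := hx.pos₁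
  have p2 := hx.pos₂
  set G : ℝ × ℝ → ℂ := fun p =>
    exp (-c₁ * σ.logt₁ p - c₂ * σ.logt₂ p + (c₁ + c₂ - a - 2) * σ.logL p) * σ.jac p with hG
  have hGc : ContinuousOn G σ.dom := by fun_prop
  set F : ℕ × ℕ → ℝ × ℝ → ℂ := fun n p => poch b (n.1 + n.2) / (n.1.factorial * n.2.factorial) *
    ((x.1 / σ.t₁ p) ^ n.1 * (x.2 / σ.t₂ p) ^ n.2) * G p with hF
  have hFc (n : ℕ × ℕ) : ContinuousOn (F n) σ.dom := by fun_prop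
  have hFi (n : ℕ × ℕ) : IntegrableOn (F n) σ.dom := (hFc n).integrableOn_compact hK
  have hGi : IntegrableOn G σ.dom := hGc.integrableOn_compact hK
  have hb (n : ℕ × ℕ) : ∫ p in σ.dom, ‖F n p‖ ≤
      ‖poch b (n.1 + n.2) / (n.1.factorial * n.2.factorial)‖ *
        ((‖x.1‖ / ε₁) ^ n.1 * (‖x.2‖ / ε₂) ^ n.2) * ∫ p in σ.dom, ‖G p‖ := by
    rw [← integral_const_mul]
    refine setIntegral_mono_on (hFi n).norm (hGi.norm.const_mul _) hK.measurableSet fun p hp => ?_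
    simp only [hF, norm_mul, norm_pow]
    gcongr
    · rw [norm_div]
      gcongr
      exact hσ.le₁ p hp
    · rw [norm_div]
      gcongr
      exact hσ.le₂ p hp
  have hs : Summable fun n => ∫ p in σ.dom, ‖F n p‖ :=
    .of_nonneg_of_le (fun n => integral_nonneg fun p => norm_nonneg _) hb
      ((summable_binomial₂ b (div_nonneg (norm_nonneg _) p1.le) (div_nonneg (norm_nonneg _) p2.le)
        hx.enclose).mul_right _)
  have key := hasSum_integral_of_summable_integral_norm hFi hs
  have e1 : ∫ p in σ.dom, ∑' n, F n p = ∫ p in σ.dom, σ.pullback a b c₁ c₂ p :=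
    setIntegral_congr_fun hK.measurableSet fun p hp => (hσ.hasSum_pullback hx a b c₁ c₂ hp).tsum_eq
  rw [e1] at key
  simpa only [hF, hG, hσ.integral_term a c₁ c₂] using key

theorem involution_jac (hσ : σ.IsRegular ε₁ ε₂ x) (l₁ l₂ : ℂ) {p : ℝ × ℝ} (hp : p ∈ σ.dom) :
    (σ.involution x l₁ l₂).jac p = x.1 * x.2 / (σ.t₁ p ^ 2 * σ.t₂ p ^ 2) * σ.jac p := by
  have n1 := hσ.t₁_ne_zero hp
  have n2 := hσ.t₂_ne_zero hp
  have g1 : Differentiable ℝ fun s : ℝ => ((s, p.2) : ℝ × ℝ) := by fun_prop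
  have g2 : Differentiable ℝ fun s : ℝ => ((p.1, s) : ℝ × ℝ) := by fun_prop
  have h11 : HasDerivAt (fun s : ℝ => σ.t₁ (s, p.2)) _ p.1 := (hσ.diff₁.comp g1 p.1).hasDerivAt
  have h12 : HasDerivAt (fun s : ℝ => σ.t₁ (p.1, s)) _ p.2 := (hσ.diff₁.comp g2 p.2).hasDerivAt
  have h21 : HasDerivAt (fun s : ℝ => σ.t₂ (s, p.2)) _ p.1 := (hσ.diff₂.comp g1 p.1).hasDerivAt
  have h22 : HasDerivAt (fun s : ℝ => σ.t₂ (p.1, s)) _ p.2 := (hσ.diff₂.comp g2 p.2).hasDerivAt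
  rw [LoadedCell.jac_eq h11 h12 h21 h22,
    LoadedCell.jac_eq (σ := σ.involution x l₁ l₂) ((h11.inv n1).const_mul x.1)
      ((h12.inv n1).const_mul x.1) ((h21.inv n2).const_mul x.2) ((h22.inv n2).const_mul x.2)]
  field_simp

/-- The Jacobian x₁x₂/(t₁t₂)² makes the exponent of t_j equal to c_j - 2 = -(2-c_j). The exponents
of L and M are exchanged, and solving for the parameters that produce them gives b+2-c₁-c₂ and
a+2-c₁-c₂ in the roles of a and b. -/
theorem involution_pullback (hσ : σ.IsRegular ε₁ ε₂ x) {l₁ l₂ : ℂ} (h₁ : exp l₁ = x.1)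
    (h₂ : exp l₂ = x.2) (a b c₁ c₂ : ℂ) {p : ℝ × ℝ} (hp : p ∈ σ.dom) :
    (σ.involution x l₁ l₂).pullback a b c₁ c₂ p =
      exp ((1 - c₁) * l₁) * exp ((1 - c₂) * l₂) *
        σ.pullback (b + 2 - c₁ - c₂) (a + 2 - c₁ - c₂) (2 - c₁) (2 - c₂) p := by
  have e1 : x.1 * x.2 / (σ.t₁ p ^ 2 * σ.t₂ p ^ 2) =
      exp (l₁ + l₂ - 2 * σ.logt₁ p - 2 * σ.logt₂ p) := by
    rw [← hσ.exp_log₁ p hp, ← hσ.exp_log₂ p hp, ← h₁, ← h₂, ← exp_nat_mul, ← exp_nat_mul, ← exp_add,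
      ← exp_add, ← exp_sub]
    push_cast
    ring_nf
  rw [LoadedCell.pullback, hσ.involution_jac l₁ l₂ hp, e1, LoadedCell.pullback, ← mul_assoc,
    ← mul_assoc, ← exp_add, ← exp_add, ← exp_add]
  simp only [LoadedCell.involution]
  ring_nf

end LoadedCell.IsRegular

namespace TwistedChain

variable {Δ : TwistedChain} {ε₁ ε₂ ε₃ : ℝ} {x : ℂ × ℂ}

theorem converges_of_isRegular (hΔ : ∀ q ∈ Δ, q.2.IsRegular ε₁ ε₂ x) (hx : Admissible ε₁ ε₂ ε₃ x)
    (a b c₁ c₂ : ℂ) : Δ.Converges a b c₁ c₂ := fun q hq =>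
  (hΔ q hq).integrableOn_pullback hx a b c₁ c₂

theorem hasSum_integral (hΔ : ∀ q ∈ Δ, q.2.IsRegular ε₁ ε₂ x) (hx : Admissible ε₁ ε₂ ε₃ x)
    (a b c₁ c₂ : ℂ) :
    HasSum (fun n : ℕ × ℕ => poch b (n.1 + n.2) / (n.1.factorial * n.2.factorial) *
        (x.1 ^ n.1 * x.2 ^ n.2) * Δ.moment (1 - c₁ - n.1) (1 - c₂ - n.2) (c₁ + c₂ - a - 1))
      (Δ.integral a b c₁ c₂) := by
  induction Δ with
  | nil => simp [TwistedChain.moment, TwistedChain.integral]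
  | cons q Δ ih =>
    rw [List.forall_mem_cons] at hΔ
    have h1 := ((hΔ.1.hasSum_integral hx a b c₁ c₂).mul_left q.1).add (ih hΔ.2)
    simp only [TwistedChain.moment, TwistedChain.integral, List.map_cons, List.sum_cons] at h1 ⊢
    refine h1.congr_fun fun n => ?_
    ring

theorem involution_converges (hΔ : ∀ q ∈ Δ, q.2.IsRegular ε₁ ε₂ x) (hx : Admissible ε₁ ε₂ ε₃ x)
    {l₁ l₂ : ℂ} (h₁ : exp l₁ = x.1) (h₂ : exp l₂ = x.2) (a b c₁ c₂ : ℂ) :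
    TwistedChain.Converges a b c₁ c₂ (Δ.map fun q => (q.1, q.2.involution x l₁ l₂)) := by
  intro q hq
  obtain ⟨q, hqΔ, rfl⟩ := List.mem_map.1 hq
  refine IntegrableOn.congr_fun (((hΔ q hqΔ).integrableOn_pullback hx (b + 2 - c₁ - c₂)
    (a + 2 - c₁ - c₂) (2 - c₁) (2 - c₂)).const_mul (exp ((1 - c₁) * l₁) * exp ((1 - c₂) * l₂)))
    (fun p hp => ((hΔ q hqΔ).involution_pullback h₁ h₂ a b c₁ c₂ hp).symm)
    (hΔ q hqΔ).isCompact.measurableSet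

theorem involution_integral (hΔ : ∀ q ∈ Δ, q.2.IsRegular ε₁ ε₂ x)
    {l₁ l₂ : ℂ} (h₁ : exp l₁ = x.1) (h₂ : exp l₂ = x.2) (a b c₁ c₂ : ℂ) :
    TwistedChain.integral a b c₁ c₂ (Δ.map fun q => (q.1, q.2.involution x l₁ l₂)) =
      exp ((1 - c₁) * l₁) * exp ((1 - c₂) * l₂) *
        Δ.integral (b + 2 - c₁ - c₂) (a + 2 - c₁ - c₂) (2 - c₁) (2 - c₂) := by
  rw [TwistedChain.integral, TwistedChain.integral, List.map_map, ← List.sum_map_mul_left]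
  refine congrArg List.sum (List.map_congr_left fun q hq => ?_)
  have h : ∫ p in q.2.dom, (q.2.involution x l₁ l₂).pullback a b c₁ c₂ p =
      exp ((1 - c₁) * l₁) * exp ((1 - c₂) * l₂) *
        ∫ p in q.2.dom, q.2.pullback (b + 2 - c₁ - c₂) (a + 2 - c₁ - c₂) (2 - c₁) (2 - c₂) p := by
    rw [← integral_const_mul]
    exact setIntegral_congr_fun (hΔ q hq).isCompact.measurableSet fun p hp =>
      (hΔ q hq).involution_pullback h₁ h₂ a b c₁ c₂ hp
  change q.1 * ∫ p in q.2.dom, (q.2.involution x l₁ l₂).pullback a b c₁ c₂ p = _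
  rw [h]
  ring

end TwistedChain

theorem e2pi_add (z w : ℂ) : e2pi (z + w) = e2pi z * e2pi w := by
  rw [e2pi, e2pi, e2pi, ← exp_add]
  ring_nf

theorem e2pi_neg (z : ℂ) : e2pi (-z) = (e2pi z)⁻¹ := by
  rw [e2pi, e2pi, ← exp_neg]
  ring_nf

theorem e2pi_add_intCast (z : ℂ) (k : ℤ) : e2pi (z + k) = e2pi z := by
  rw [e2pi_add, e2pi_eq_one_iff.2 ⟨k, rfl⟩, mul_one]

variable {ε₁ ε₂ ε₃ : ℝ} {x : ℂ × ℂ}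

theorem isRegular_Delta₁ (hx : Admissible ε₁ ε₂ ε₃ x) (a c₁ c₂ : ℂ) :
    ∀ q ∈ Delta₁ a c₁ c₂ ε₁ ε₂ ε₃ x, q.2.IsRegular ε₁ ε₂ x :=
  isRegular_regTriangle hx.pos₁ hx.pos₂ hx.pos₃ hx.sum_lt _ _ _

/-- Integer shifts of the exponents leave the multipliers unchanged, so the same chain Δ₁ is the
regularized triangle for all the moments in the expansion. -/
theorem Delta₁_moment {a c₁ c₂ : ℂ} (hc₁ : ∀ k : ℤ, c₁ ≠ k) (hc₂ : ∀ k : ℤ, c₂ ≠ k)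
    (ha : ∀ k : ℤ, a - c₁ - c₂ ≠ k) (hx : Admissible ε₁ ε₂ ε₃ x) (m n : ℕ) :
    (Delta₁ a c₁ c₂ ε₁ ε₂ ε₃ x).moment (1 - c₁ - m) (1 - c₂ - n) (c₁ + c₂ - a - 1) =
      Gamma (1 - c₁ - m) * Gamma (1 - c₂ - n) * Gamma (c₁ + c₂ - a - 1) /
        Gamma (1 - a - (m + n : ℕ)) := by
  have e1 : e2pi (1 - c₁ - m) = (e2pi c₁)⁻¹ := by
    rw [← e2pi_neg, ← e2pi_add_intCast (-c₁) (1 - m)]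
    push_cast
    ring_nf
  have e2 : e2pi (1 - c₂ - n) = (e2pi c₂)⁻¹ := by
    rw [← e2pi_neg, ← e2pi_add_intCast (-c₂) (1 - n)]
    push_cast
    ring_nf
  have e3 : e2pi (c₁ + c₂ - a - 1) = e2pi c₁ * e2pi c₂ * (e2pi a)⁻¹ := by
    rw [← e2pi_neg, ← e2pi_add, ← e2pi_add, ← e2pi_add_intCast (c₁ + c₂ + -a) (-1)]
    push_cast
    ring_nf
  have e4 : 1 - a - ((m + n : ℕ) : ℂ) = 1 - c₁ - m + (1 - c₂ - n) + (c₁ + c₂ - a - 1) := by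
    push_cast
    ring
  rw [Delta₁, ← e1, ← e2, ← e3, e4]
  refine moment_regTriangle hx.pos₁ hx.pos₂ hx.pos₃ hx.sum_lt (fun k hk => ?_) (fun k hk => ?_)
    fun k hk => ?_
  · refine hc₁ (1 - m - k) ?_
    push_cast
    linear_combination -hk
  · refine hc₂ (1 - n - k) ?_
    push_cast
    linear_combination -hk
  · refine ha (-1 - k) ?_
    push_cast
    linear_combination -hk

theorem Delta₁_integral {a b c₁ c₂ : ℂ} (hc₁ : ∀ k : ℤ, c₁ ≠ k) (hc₂ : ∀ k : ℤ, c₂ ≠ k)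
    (ha : ∀ k : ℤ, a - c₁ - c₂ ≠ k) (hx : Admissible ε₁ ε₂ ε₃ x) :
    (Delta₁ a c₁ c₂ ε₁ ε₂ ε₃ x).Converges a b c₁ c₂ ∧
      (Delta₁ a c₁ c₂ ε₁ ε₂ ε₃ x).integral a b c₁ c₂ =
        Gamma (1 - c₁) * Gamma (1 - c₂) * Gamma (c₁ + c₂ - a - 1) / Gamma (1 - a) *
          F4 a b c₁ c₂ x := by
  have hreg := isRegular_Delta₁ hx a c₁ c₂
  refine ⟨TwistedChain.converges_of_isRegular hreg hx a b c₁ c₂, ?_⟩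
  rw [← (TwistedChain.hasSum_integral hreg hx a b c₁ c₂).tsum_eq, F4, ← tsum_mul_left]
  refine tsum_congr fun n => ?_
  have g1 := Gamma_one_sub_sub_natCast hc₁ n.1
  have g2 := Gamma_one_sub_sub_natCast hc₂ n.2
  have n1 : poch c₁ n.1 ≠ 0 := poch_ne_zero (fun k hk => hc₁ (-k) (by simp [hk])) n.1
  have n2 : poch c₂ n.2 ≠ 0 := poch_ne_zero (fun k hk => hc₂ (-k) (by simp [hk])) n.2
  rw [Delta₁_moment hc₁ hc₂ ha hx, div_eq_mul_inv _ (Gamma (1 - a - _)),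
    inv_Gamma_one_sub_sub_natCast, eq_div_of_mul_eq n1 g1, eq_div_of_mul_eq n2 g2, poch_one, poch_one,
    pow_add]
  -- The signs from the two numerator Gamma factors cancel against (-1)^{n₁+n₂} from 1/Γ(1-a-n₁-n₂).
  have s1 : ((-1 : ℂ) ^ n.1) * (-1) ^ n.1 = 1 := by rw [← mul_pow]; simp
  have s2 : ((-1 : ℂ) ^ n.2) * (-1) ^ n.2 = 1 := by rw [← mul_pow]; simp
  simp only [div_eq_mul_inv, mul_inv]
  linear_combination (poch b (n.1 + n.2) * poch a (n.1 + n.2) * (n.1.factorial : ℂ)⁻¹ *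
    (n.2.factorial : ℂ)⁻¹ * x.1 ^ n.1 * x.2 ^ n.2 * Gamma (1 - c₁) * Gamma (1 - c₂) *
    (poch c₁ n.1)⁻¹ * (poch c₂ n.2)⁻¹ * Gamma (c₁ + c₂ - a - 1) * (Gamma (1 - a))⁻¹) *
    ((-1) ^ n.2 * (-1) ^ n.2 * s1 + s2)

/-- By periodicity of `e2pi`, Δ₄ is the involution applied to Δ₁ with the transformed parameters a',
c₁', c₂'. The non-integrality of a' - c₁' - c₂' = b - 2 is that of b, and the two upper parameters
come out exchanged, which F₄ does not see. -/
theorem Delta₄_integral {a b c₁ c₂ : ℂ} (hc₁ : ∀ k : ℤ, c₁ ≠ k) (hc₂ : ∀ k : ℤ, c₂ ≠ k)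
    (hb : ∀ k : ℤ, b ≠ k) (hx : Admissible ε₁ ε₂ ε₃ x) {l₁ l₂ : ℂ} (h₁ : exp l₁ = x.1)
    (h₂ : exp l₂ = x.2) :
    (Delta₄ b c₁ c₂ ε₁ ε₂ ε₃ x l₁ l₂).Converges a b c₁ c₂ ∧
      (Delta₄ b c₁ c₂ ε₁ ε₂ ε₃ x l₁ l₂).integral a b c₁ c₂ =
        Gamma (c₁ - 1) * Gamma (c₂ - 1) * Gamma (1 - b) / Gamma (c₁ + c₂ - b - 1) *
          exp ((1 - c₁) * l₁) * exp ((1 - c₂) * l₂) *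
          F4 (a + 2 - c₁ - c₂) (b + 2 - c₁ - c₂) (2 - c₁) (2 - c₂) x := by
  have e0 (c : ℂ) : (e2pi (2 - c))⁻¹ = e2pi c := by
    rw [← e2pi_neg, ← e2pi_add_intCast c (-2)]
    push_cast
    ring_nf
  have e3 : e2pi (2 - c₁) * e2pi (2 - c₂) * (e2pi (b + 2 - c₁ - c₂))⁻¹ = (e2pi b)⁻¹ := by
    rw [← e2pi_neg, ← e2pi_neg, ← e2pi_add, ← e2pi_add, ← e2pi_add_intCast (-b) 2]
    push_cast
    ring_nf
  have e4 : Delta₄ b c₁ c₂ ε₁ ε₂ ε₃ x l₁ l₂ =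
      (Delta₁ (b + 2 - c₁ - c₂) (2 - c₁) (2 - c₂) ε₁ ε₂ ε₃ x).map
        fun q => (q.1, q.2.involution x l₁ l₂) := by
    rw [Delta₁, e0, e0, e3, Delta₄]
  have hreg := isRegular_Delta₁ hx (b + 2 - c₁ - c₂) (2 - c₁) (2 - c₂)
  have key := (Delta₁_integral (a := b + 2 - c₁ - c₂) (b := a + 2 - c₁ - c₂) (c₁ := 2 - c₁)
    (c₂ := 2 - c₂) (ε₁ := ε₁) (ε₂ := ε₂) (ε₃ := ε₃) (x := x)
    (fun k hk => hc₁ (2 - k) (by push_cast; linear_combination -hk))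
    (fun k hk => hc₂ (2 - k) (by push_cast; linear_combination -hk))
    (fun k hk => hb (k + 2) (by push_cast; linear_combination hk)) hx).2
  rw [e4]
  refine ⟨TwistedChain.involution_converges hreg hx h₁ h₂ a b c₁ c₂, ?_⟩
  rw [TwistedChain.involution_integral hreg h₁ h₂, key, F4_comm (a + 2 - c₁ - c₂)]
  have a1 : 1 - (2 - c₁) = c₁ - 1 := by ring
  have a2 : 1 - (2 - c₂) = c₂ - 1 := by ring
  have a3 : 2 - c₁ + (2 - c₂) - (b + 2 - c₁ - c₂) - 1 = 1 - b := by ring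
  have a4 : 1 - (b + 2 - c₁ - c₂) = c₁ + c₂ - b - 1 := by ring
  rw [a1, a2, a3, a4]
  ring

end AppellF4

/-! ### The four integrals on U -/

theorem mainTheorem8 (a b c₁ c₂ : ℂ)
    (U : Set (ℂ × ℂ)) (hUo : IsOpen U) (hUc : IsPreconnected U) (hUD : U ⊆ AppellF4.convDomain)
    (x₀ : ℝ × ℝ) (hx₀₁ : 0 < x₀.1) (hx₀₂ : 0 < x₀.2) (hx₀ : ((x₀.1 : ℂ), (x₀.2 : ℂ)) ∈ U)
    (l₁ l₂ : ℂ × ℂ → ℂ)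
    (hl₁ : AppellF4.IsLogBranch U ((x₀.1 : ℂ), (x₀.2 : ℂ)) (Real.log x₀.1) Prod.fst l₁)
    (hl₂ : AppellF4.IsLogBranch U ((x₀.1 : ℂ), (x₀.2 : ℂ)) (Real.log x₀.2) Prod.snd l₂) :
    -- the first integral
    ((∀ k : ℤ, c₁ ≠ k) → (∀ k : ℤ, c₂ ≠ k) → (∀ k : ℤ, a - c₁ - c₂ ≠ k) →
      ∀ x ∈ U, ∀ ε₁ ε₂ ε₃ : ℝ, AppellF4.Admissible ε₁ ε₂ ε₃ x →
        (AppellF4.Delta₁ a c₁ c₂ ε₁ ε₂ ε₃ x).Converges a b c₁ c₂ ∧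
        (AppellF4.Delta₁ a c₁ c₂ ε₁ ε₂ ε₃ x).integral a b c₁ c₂ =
          Gamma (1 - c₁) * Gamma (1 - c₂) * Gamma (c₁ + c₂ - a - 1) / Gamma (1 - a) *
            AppellF4.F4 a b c₁ c₂ x) ∧
    -- the second integral
    (0 < (b - c₁ + 1).re → 0 < (c₁ + c₂ - a - 1).re → 0 < (1 - b).re → 0 < (a - c₁ + 1).re →
      (∀ x₁ x₂ : ℝ, 0 < x₁ → 0 < x₂ → √x₁ + √x₂ < 1 →
        (AppellF4.Delta₂ x₁ x₂).Converges a b c₁ c₂ ∧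
        (AppellF4.Delta₂ x₁ x₂).integral a b c₁ c₂ =
          Gamma (a + 1 - c₁) * Gamma (b + 1 - c₁) * Gamma (1 - b) * Gamma (c₁ + c₂ - a - 1) /
              (Gamma (2 - c₁) * Gamma c₂) *
            exp (-(Real.pi * I * (c₁ + c₂ - a - b))) * (x₁ : ℂ) ^ (1 - c₁) *
            AppellF4.F4 (a + 1 - c₁) (b + 1 - c₁) (2 - c₁) c₂ ((x₁ : ℂ), (x₂ : ℂ))) ∧
      (∃ f, AppellF4.IsContinuation
        (fun x₁ x₂ => (AppellF4.Delta₂ x₁ x₂).integral a b c₁ c₂) U x₀ f) ∧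
      (∀ f, AppellF4.IsContinuation
          (fun x₁ x₂ => (AppellF4.Delta₂ x₁ x₂).integral a b c₁ c₂) U x₀ f →
        ∀ x ∈ U, f x =
          Gamma (a + 1 - c₁) * Gamma (b + 1 - c₁) * Gamma (1 - b) * Gamma (c₁ + c₂ - a - 1) /
              (Gamma (2 - c₁) * Gamma c₂) *
            exp (-(Real.pi * I * (c₁ + c₂ - a - b))) * exp ((1 - c₁) * l₁ x) *
            AppellF4.F4 (a + 1 - c₁) (b + 1 - c₁) (2 - c₁) c₂ x)) ∧
    -- the third integral
    (0 < (b - c₂ + 1).re → 0 < (c₁ + c₂ - a - 1).re → 0 < (1 - b).re → 0 < (a - c₂ + 1).re →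
      (∀ x₁ x₂ : ℝ, 0 < x₁ → 0 < x₂ → √x₁ + √x₂ < 1 →
        (AppellF4.Delta₃ x₁ x₂).Converges a b c₁ c₂ ∧
        (AppellF4.Delta₃ x₁ x₂).integral a b c₁ c₂ =
          Gamma (a + 1 - c₂) * Gamma (b + 1 - c₂) * Gamma (1 - b) * Gamma (c₁ + c₂ - a - 1) /
              (Gamma c₁ * Gamma (2 - c₂)) *
            exp (-(Real.pi * I * (c₁ + c₂ - a - b))) * (x₂ : ℂ) ^ (1 - c₂) *
            AppellF4.F4 (a + 1 - c₂) (b + 1 - c₂) c₁ (2 - c₂) ((x₁ : ℂ), (x₂ : ℂ))) ∧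
      (∃ f, AppellF4.IsContinuation
        (fun x₁ x₂ => (AppellF4.Delta₃ x₁ x₂).integral a b c₁ c₂) U x₀ f) ∧
      (∀ f, AppellF4.IsContinuation
          (fun x₁ x₂ => (AppellF4.Delta₃ x₁ x₂).integral a b c₁ c₂) U x₀ f →
        ∀ x ∈ U, f x =
          Gamma (a + 1 - c₂) * Gamma (b + 1 - c₂) * Gamma (1 - b) * Gamma (c₁ + c₂ - a - 1) /
              (Gamma c₁ * Gamma (2 - c₂)) *
            exp (-(Real.pi * I * (c₁ + c₂ - a - b))) * exp ((1 - c₂) * l₂ x) *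
            AppellF4.F4 (a + 1 - c₂) (b + 1 - c₂) c₁ (2 - c₂) x)) ∧
    -- the fourth integral
    ((∀ k : ℤ, c₁ ≠ k) → (∀ k : ℤ, c₂ ≠ k) → (∀ k : ℤ, b ≠ k) →
      ∀ x ∈ U, ∀ ε₁ ε₂ ε₃ : ℝ, AppellF4.Admissible ε₁ ε₂ ε₃ x →
        (AppellF4.Delta₄ b c₁ c₂ ε₁ ε₂ ε₃ x (l₁ x) (l₂ x)).Converges a b c₁ c₂ ∧
        (AppellF4.Delta₄ b c₁ c₂ ε₁ ε₂ ε₃ x (l₁ x) (l₂ x)).integral a b c₁ c₂ =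
          Gamma (c₁ - 1) * Gamma (c₂ - 1) * Gamma (1 - b) / Gamma (c₁ + c₂ - b - 1) *
            exp ((1 - c₁) * l₁ x) * exp ((1 - c₂) * l₂ x) *
            AppellF4.F4 (a + 2 - c₁ - c₂) (b + 2 - c₁ - c₂) (2 - c₁) (2 - c₂) x) := by
  refine ⟨fun hc₁ hc₂ ha x _ ε₁ ε₂ ε₃ hx => AppellF4.Delta₁_integral hc₁ hc₂ ha hx,
    fun h₁ h₂ h₃ h₄ => ?_, fun h₁ h₂ h₃ h₄ => ?_,
    fun hc₁ hc₂ hb x hxU ε₁ ε₂ ε₃ hx =>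
      AppellF4.Delta₄_integral hc₁ hc₂ hb hx (hl₁.exp_eq x hxU) (hl₂.exp_eq x hxU)⟩
  -- Adding the hypotheses in pairs gives Re(2-c₁) > 0 and Re c₂ > 0, so the lower parameters avoid
  -- the nonpositive integers and F₄ is holomorphic on U.
  · have hc₁ : 0 < (2 - c₁).re := by
      simp at h₁ h₃ ⊢
      linarith
    have hc₂ : 0 < c₂.re := by
      simp at h₂ h₄
      linarith
    refine ⟨fun x₁ x₂ hx₁ hx₂ hx => AppellF4.Delta₂_integral h₁ h₂ h₃ h₄ hx₁ hx₂ hx,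
      AppellF4.isContinuation_iff_eqOn hUo hUc hx₀ ?_ ?_⟩
    · have d1 := hl₁.differentiableOn hUo differentiable_fst
      have d2 := (AppellF4.differentiableOn_F4 (a + 1 - c₁) (b + 1 - c₁)
        (AppellF4.ne_neg_nat_of_re_pos hc₁) (AppellF4.ne_neg_nat_of_re_pos hc₂)).mono hUD
      exact ((d1.const_mul (1 - c₁)).cexp.const_mul _).mul d2
    · filter_upwards [AppellF4.eventually_real_mem_domain hUo hUD hx₀₁ hx₀₂ hx₀,
        hl₁.eventually_real hUo (r := Prod.fst) hx₀ continuous_fst hx₀₁ fun y => rfl]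
        with y hy hly
      rw [(AppellF4.Delta₂_integral h₁ h₂ h₃ h₄ hy.1 hy.2.1 hy.2.2).2, hly,
        AppellF4.ofReal_cpow_eq_exp hy.1, mul_comm (1 - c₁)]
  · have hc₁ : 0 < c₁.re := by
      simp at h₂ h₄
      linarith
    have hc₂ : 0 < (2 - c₂).re := by
      simp at h₁ h₃ ⊢
      linarith
    refine ⟨fun x₁ x₂ hx₁ hx₂ hx => AppellF4.Delta₃_integral h₁ h₂ h₃ h₄ hx₁ hx₂ hx,
      AppellF4.isContinuation_iff_eqOn hUo hUc hx₀ ?_ ?_⟩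
    · have d1 := hl₂.differentiableOn hUo differentiable_snd
      have d2 := (AppellF4.differentiableOn_F4 (a + 1 - c₂) (b + 1 - c₂)
        (AppellF4.ne_neg_nat_of_re_pos hc₁) (AppellF4.ne_neg_nat_of_re_pos hc₂)).mono hUD
      exact ((d1.const_mul (1 - c₂)).cexp.const_mul _).mul d2
    · filter_upwards [AppellF4.eventually_real_mem_domain hUo hUD hx₀₁ hx₀₂ hx₀,
        hl₂.eventually_real hUo (r := Prod.snd) hx₀ continuous_snd hx₀₂ fun y => rfl]
        with y hy hly
      rw [(AppellF4.Delta₃_integral h₁ h₂ h₃ h₄ hy.1 hy.2.1 hy.2.2).2, hly,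
        AppellF4.ofReal_cpow_eq_exp hy.2.1, mul_comm (1 - c₂)]
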